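/- Let $k$ be a commutative ring. A graded $k$-quiver $\mathcal A$ is a set of objects with a $\mathbb Z$-graded $k$-module $\mathcal A(X,Y)$ for every pair of objects; all quivers are small with respect to one fixed universe. Operators are written on the right, and signs follow Koszul's rule $(x\otimes y)(f\otimes g)=(-1)^{\deg y\deg f}\,xf\otimes yg$. **Conventions.** $T\mathcal A$ is the tensor cocategory, with the same objects and $$T\mathcal A(X,Y)=\bigoplus_{n\ge 0}\ \bigoplus_{X=X_0,X_1,\dots,X_n=Y}\mathcal A(X_0,X_1)\otimes_k\dots\otimes_k\mathcal A(X_{n-1},X_n)$$ (for $n=0$: $k$ in degree $0$ if $X=Y$, and $0$ otherwise), the cut comultiplication $\Delta$ and the counit $\varepsilon=\mathrm{pr}_0$. Tensor products of cocategories have pairs of objects as objects and comultiplication $(\Delta\otimes\Delta)(1\otimes c\otimes 1)$, where $c$ is the graded symmetry. A cocategory homomorphism $f$ is a map of objects with $k$-linear maps of degree $0$ compatible with $\Delta$ and $\varepsilon$; for tensor cocategories and their tensor products it is moreover required to map the $T^0$-part into the $T^0$-part (that is, $f_0=0$, respectively $\phi_{0\dots0}=0$). For two homomorphisms $f,g$,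 an $(f,g)$-coderivation of degree $d$ is a system of $k$-linear maps $r:T\mathcal A(X,Y)\to T\mathcal B(Xf,Yg)$ of degree $d$ with $r\Delta=\Delta(f\otimes r+r\otimes g)$. $\mathrm{Coder}(\mathcal A,\mathcal B)$ is the graded quiver whose objects are the cocategory homomorphisms $T\mathcal A\to T\mathcal B$ and whose morphisms of degree $d$ from $f$ to $g$ are the $(f,g)$-coderivations of degree $d$. For coderivations $f^0\xrightarrow{r^1}f^1\to\dots\xrightarrow{r^n}f^n$ let $(r^1\otimes\dots\otimes r^n)\theta:T\mathcal A\to T\mathcal B$ be the map whose component $T^i\mathcal A\to T^l\mathcal B$ is the sum of all terms $$f^0_{i^0_1}\otimes\dots\otimes f^0_{i^0_{m_0}}\otimes r^1_{j_1}\otimes f^1_{i^1_1}\otimes\dots\otimes f^1_{i^1_{m_1}}\otimes\dots\otimes r^n_{j_n}\otimes f^n_{i^n_1}\otimes\dots\otimes f^n_{i^n_{m_n}}$$ with $l$ tensor factors and indices adding up to $i$, where $f^p_i$ and $r^p_j$ denote the components $T^i\mathcal A\to\mathcal B$ and $T^j\mathcal A\to\mathcal B$ of $f^p\mathrm{pr}_1$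 and $r^p\mathrm{pr}_1$; and let $$\alpha:T\mathcal A\otimes T\mathrm{Coder}(\mathcal A,\mathcal B)\to T\mathcal B,\qquad a\otimes r^1\otimes\dots\otimes r^n\mapsto a[(r^1\otimes\dots\otimes r^n)\theta].$$ **(Graded version.)** Let $\mathcal A,\mathcal B$ be graded $k$-quivers. Then $\alpha$ is a cocategory homomorphism of degree $0$. For all graded $k$-quivers $\mathcal C^1,\dots,\mathcal C^q$, $q\ge1$, and every cocategory homomorphism $\phi:T\mathcal A\otimes T\mathcal C^1\otimes\dots\otimes T\mathcal C^q\to T\mathcal B$ of degree $0$ there is a unique cocategory homomorphism $\psi:T\mathcal C^1\otimes\dots\otimes T\mathcal C^q\to T\mathrm{Coder}(\mathcal A,\mathcal B)$ of degree $0$ such that $\phi=(1\otimes\psi)\alpha$. **($A_\infty$-version.)** Let $s$ denote the suspension, $(s\mathcal A)^d=\mathcal A^{d+1}$. An $A_\infty$-category is a graded $k$-quiver $\mathcal A$ with a $(1,1)$-coderivation $b:Ts\mathcal A\to Ts\mathcal A$ of degree $1$ such that $b^2=0$ and $(T^0s\mathcal A)b=0$. An $A_\infty$-functor between tensor products of cocategories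 $Ts\mathcal A$ is a cocategory homomorphism of degree $0$ which commutes with the differentials $\sum 1\otimes\dots\otimes b\otimes\dots\otimes1$. For $A_\infty$-categories $\mathcal A,\mathcal B$ let $A_\infty(\mathcal A,\mathcal B)$ be the graded quiver such that $sA_\infty(\mathcal A,\mathcal B)$ is the full subquiver of $\mathrm{Coder}(s\mathcal A,s\mathcal B)$ whose objects are the $A_\infty$-functors $Ts\mathcal A\to Ts\mathcal B$. Then there is exactly one $A_\infty$-structure on $A_\infty(\mathcal A,\mathcal B)$ for which the restriction $\alpha:Ts\mathcal A\otimes TsA_\infty(\mathcal A,\mathcal B)\to Ts\mathcal B$ is an $A_\infty$-functor. With this structure, for all $A_\infty$-categories $\mathcal C^1,\dots,\mathcal C^q$, $q\ge1$, and every $A_\infty$-functor $\phi:Ts\mathcal A\otimes Ts\mathcal C^1\otimes\dots\otimes Ts\mathcal C^q\to Ts\mathcal B$ there is a unique $A_\infty$-functor $\psi:Ts\mathcal C^1\otimes\dots\otimes Ts\mathcal C^q\to TsA_\infty(\mathcal A,\mathcal B)$ such that $\phi=(1\otimes\psi)\alpha$. Thus $T\mathrm{Coder}(\mathcal A,\mathcal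 B)$ and $TsA_\infty(\mathcal A,\mathcal B)$ are internal hom-objects for tensor cocategories. -/

import Mathlib

open scoped TensorProduct DirectSum

universe u v w

noncomputable section

namespace AInf

/-! ### Graded modules -/

/-- A `ℤ`-graded `k`-module: a module that is the internal direct sum of its submodules
`deg d` of homogeneous elements of degree `d`. -/
structure GMod (k : Type u) [CommRing k] where
  carrier : Type v
  [acg : AddCommGroup carrier]
  [mod : Module k carrier]
  deg : ℤ → Submodule k carrier
  internal : DirectSum.IsInternal deg

namespace GMod

variable {k : Type u} [CommRing k]

instance : CoeSort (GMod.{u, v} k) (Type v) := ⟨GMod.carrier⟩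

attribute [instance] GMod.acg GMod.mod

/-- The decomposition of a graded module into its homogeneous components. -/
def decomp (M : GMod.{u, v} k) : M ≃ₗ[k] ⨁ d, M.deg d :=
  (LinearEquiv.ofBijective (DirectSum.coeLinearMap M.deg) M.internal).symm

/-- Linear maps out of a graded module, given on each homogeneous component. -/
def lift (M : GMod.{u, v} k) {N : Type w} [AddCommGroup N] [Module k N]
    (f : ∀ d, M.deg d →ₗ[k] N) : M →ₗ[k] N :=
  (DirectSum.toModule k ℤ N f) ∘ₗ M.decomp.toLinearMap

theorem lift_of_mem (M : GMod.{u, v} k) {N : Type w} [AddCommGroup N] [Module k N]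
    (f : ∀ d, M.deg d →ₗ[k] N) {d : ℤ} {x : M} (hx : x ∈ M.deg d) :
    M.lift f x = f d ⟨x, hx⟩ := by
  have h : M.decomp x = DirectSum.lof k ℤ (fun d => M.deg d) d ⟨x, hx⟩ := by
    rw [decomp, LinearEquiv.symm_apply_eq]
    exact (DirectSum.coeLinearMap_lof M.deg d ⟨x, hx⟩).symm
  simp [lift, h]

/-- The projection onto the homogeneous component of degree `n`. -/
def proj (M : GMod.{u, v} k) (n : ℤ) : M →ₗ[k] M :=
  M.lift fun d => if d = n then (M.deg d).subtype else 0

theorem proj_of_mem (M : GMod.{u, v} k) {d : ℤ} (n : ℤ) {x : M} (hx : x ∈ M.deg d) :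
    M.proj n x = if d = n then x else 0 := by
  rw [proj, lift_of_mem M _ hx]
  split_ifs <;> simp

theorem iSup_deg (M : GMod.{u, v} k) : ⨆ d, M.deg d = ⊤ := M.internal.submodule_iSup_eq_top

/-- The map `x ↦ (-1) ^ (n * deg x) x`. -/
def sgn (M : GMod.{u, v} k) (n : ℤ) : M →ₗ[k] M :=
  M.lift fun d => ((Int.negOnePow (n * d) : ℤˣ) : ℤ) • (M.deg d).subtype

theorem sgn_of_mem (M : GMod.{u, v} k) {d : ℤ} (n : ℤ) {x : M} (hx : x ∈ M.deg d) :
    M.sgn n x = ((Int.negOnePow (n * d) : ℤˣ) : ℤ) • x := by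
  rw [sgn, lift_of_mem M _ hx]; rfl

/-- A criterion for internality through projections. -/
theorem internal_of_proj {M : Type v} [AddCommGroup M] [Module k M] (D : ℤ → Submodule k M)
    (p : ℤ → M →ₗ[k] M) (hp : ∀ d n x, x ∈ D d → p n x = if d = n then x else 0)
    (htop : ⨆ d, D d = ⊤) : DirectSum.IsInternal D := by
  constructor
  · rw [← AddMonoidHom.ker_eq_bot_iff, eq_bot_iff]
    intro x hx
    have hx0 : DirectSum.coeLinearMap D x = 0 := hx
    have key : ∀ (y : ⨁ d, D d) (n : ℤ), p n (DirectSum.coeLinearMap D y) = y n := by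
      intro y n
      induction y using DirectSum.induction_on with
      | zero => simp
      | of d z =>
        rw [← DirectSum.lof_eq_of k, DirectSum.coeLinearMap_lof, hp d n _ z.2,
          DirectSum.lof_eq_of]
        split_ifs with h
        · subst h; rw [DirectSum.of_eq_same]
        · rw [DirectSum.of_eq_of_ne _ _ _ (Ne.symm h)]; rfl
      | add y z hy hz => simp [hy, hz]
    have : x = 0 := by
      ext n
      rw [← key x n, hx0]; simp
    simpa using this
  · have h : LinearMap.range (DirectSum.coeLinearMap D) = ⊤ := by
      rw [← htop]; exact (Submodule.iSup_eq_range_dfinsupp_lsum D).symm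
    exact LinearMap.range_eq_top.mp h

variable (k) in
/-- The unit graded module: `k` in degree `0`. -/
abbrev unit : GMod.{u, u} k where
  carrier := k
  deg d := if d = 0 then ⊤ else ⊥
  internal := by
    refine internal_of_proj _ (fun n => if n = 0 then LinearMap.id else 0) ?_ ?_
    · intro d n x hx
      by_cases hd : d = 0 <;> by_cases hn : n = 0 <;> simp_all [eq_comm]
    · exact eq_top_iff.mpr (le_iSup_of_le 0 (by simp))

open scoped Classical in
/-- The direct sum of a family of graded modules. -/
def directSum {ι : Type w} (M : ι → GMod.{u, v} k) : GMod.{u, max w v} k where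
  carrier := ⨁ i, M i
  deg d :=
    { carrier := {x | ∀ i, x i ∈ (M i).deg d}
      add_mem' := fun hx hy i => add_mem (hx i) (hy i)
      zero_mem' := fun _ => zero_mem _
      smul_mem' := fun c _ hx i => Submodule.smul_mem _ c (hx i) }
  internal := by
    refine internal_of_proj _ (fun n => DirectSum.lmap fun i => (M i).proj n) ?_ ?_
    · intro d n x hx
      ext i
      rw [DirectSum.lmap_apply, proj_of_mem _ n (hx i)]
      split_ifs <;> rfl
    · rw [eq_top_iff]
      rintro x -
      induction x using DirectSum.induction_on with
      | zero => exact zero_mem _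
      | add y z hy hz => exact add_mem hy hz
      | of i y =>
        have hy : y ∈ ⨆ d, (M i).deg d := by rw [iSup_deg]; trivial
        induction hy using Submodule.iSup_induction' with
        | zero => simp
        | add y z _ _ hy hz => rw [map_add]; exact add_mem hy hz
        | mem d y hy =>
          refine Submodule.mem_iSup_of_mem d fun j => ?_
          by_cases h : j = i
          · subst h; rwa [DirectSum.of_eq_same]
          · rw [DirectSum.of_eq_of_ne _ _ _ h]; exact zero_mem _

open scoped Classical in
/-- The inclusion of a summand. -/
def incl {ι : Type w} (M : ι → GMod.{u, v} k) (i : ι) : M i →ₗ[k] directSum M :=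
  DirectSum.lof k ι (fun i => M i) i

open scoped Classical in
/-- Linear maps out of a direct sum, given on each summand. -/
def desc {ι : Type w} {M : ι → GMod.{u, v} k} {N : Type*} [AddCommGroup N] [Module k N]
    (f : ∀ i, M i →ₗ[k] N) : directSum M →ₗ[k] N :=
  DirectSum.toModule k ι N f

theorem desc_incl {ι : Type w} {M : ι → GMod.{u, v} k} {N : Type*} [AddCommGroup N] [Module k N]
    (f : ∀ i, M i →ₗ[k] N) (i : ι) (x : M i) : desc f (incl M i x) = f i x := by
  classical
  exact DirectSum.toModule_lof k (M := fun i => M i) i x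

theorem directSum_ext {ι : Type w} {M : ι → GMod.{u, v} k} {N : Type*} [AddCommGroup N]
    [Module k N] {f g : directSum M →ₗ[k] N} (h : ∀ i x, f (incl M i x) = g (incl M i x)) :
    f = g := by
  classical
  exact DirectSum.linearMap_ext k fun i => LinearMap.ext fun x => h i x

/-- The tensor product of graded modules: the degree `n` part is spanned by the `x ⊗ y` with
`deg x + deg y = n`. -/
abbrev tensor (M : GMod.{u, v} k) (N : GMod.{u, w} k) : GMod.{u, max v w} k where
  carrier := M ⊗[k] N
  deg n := Submodule.span k
    {t | ∃ i j : ℤ, i + j = n ∧ ∃ x ∈ M.deg i, ∃ y ∈ N.deg j, x ⊗ₜ[k] y = t}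
  internal := by
    refine internal_of_proj _ (fun n => TensorProduct.lift (M.lift fun i =>
      ((TensorProduct.mk k M N).compl₂ (N.proj (n - i))) ∘ₗ (M.deg i).subtype)) ?_ ?_
    · intro d n t ht
      induction ht using Submodule.span_induction with
      | zero => simp
      | add x y _ _ hx hy => rw [map_add, hx, hy]; split_ifs <;> simp
      | smul c x _ hx => rw [map_smul, hx]; split_ifs <;> simp
      | mem t ht =>
        obtain ⟨i, j, hij, x, hx, y, hy, rfl⟩ := ht
        rw [TensorProduct.lift.tmul, lift_of_mem M _ hx]
        simp only [LinearMap.comp_apply, Submodule.subtype_apply, LinearMap.compl₂_apply,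
          TensorProduct.mk_apply, proj_of_mem N _ hy]
        have : j = n - i ↔ d = n := by omega
        simp only [this]
        split_ifs <;> simp
    · rw [eq_top_iff]
      rintro t -
      induction t using TensorProduct.induction_on with
      | zero => exact zero_mem _
      | add y z hy hz => exact add_mem hy hz
      | tmul x y =>
        have hx : x ∈ ⨆ d, M.deg d := by rw [iSup_deg]; trivial
        have hy : y ∈ ⨆ d, N.deg d := by rw [iSup_deg]; trivial
        induction hx using Submodule.iSup_induction' with
        | zero => simp
        | add _ _ _ _ h1 h2 => rw [TensorProduct.add_tmul]; exact add_mem h1 h2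
        | mem i x hx =>
          induction hy using Submodule.iSup_induction' with
          | zero => simp
          | add _ _ _ _ h1 h2 => rw [TensorProduct.tmul_add]; exact add_mem h1 h2
          | mem j y hy =>
            exact Submodule.mem_iSup_of_mem (i + j)
              (Submodule.subset_span ⟨i, j, rfl, x, hx, y, hy, rfl⟩)

/-- The shift `M[n]`, with `M[n]^d = M^(d + n)`. -/
abbrev shift (M : GMod.{u, v} k) (n : ℤ) : GMod.{u, v} k where
  carrier := M
  deg d := M.deg (d + n)
  internal := by
    refine internal_of_proj _ (fun d => M.proj (d + n)) ?_ ?_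
    · intro d e x hx
      rw [proj_of_mem M _ hx]; simp
    · rw [← iSup_deg M]
      exact (Equiv.addRight n).iSup_comp (g := M.deg)

/-- The graded module with prescribed homogeneous components. -/
abbrev ofFamily (F : ℤ → Type v) [∀ d, AddCommGroup (F d)] [∀ d, Module k (F d)] :
    GMod.{u, v} k where
  carrier := ⨁ d, F d
  deg d := LinearMap.range (DirectSum.lof k ℤ F d)
  internal := by
    refine internal_of_proj _
      (fun n => DirectSum.lof k ℤ F n ∘ₗ DirectSum.component k ℤ F n) ?_ ?_
    · rintro d n _ ⟨x, rfl⟩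
      rw [LinearMap.comp_apply]
      split_ifs with h
      · subst h; rw [DirectSum.component.lof_self]
      · rw [DirectSum.component.of, dif_neg h, map_zero]
    · rw [eq_top_iff]
      rintro x -
      induction x using DirectSum.induction_on with
      | zero => exact zero_mem _
      | add y z hy hz => exact add_mem hy hz
      | of i y => exact Submodule.mem_iSup_of_mem i ⟨y, rfl⟩

/-- The symmetry `x ⊗ y ↦ (-1) ^ (deg x * deg y) y ⊗ x`. -/
def braid (M : GMod.{u, v} k) (N : GMod.{u, w} k) : M ⊗[k] N →ₗ[k] N ⊗[k] M :=
  TensorProduct.lift (M.lift fun d =>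
    (((TensorProduct.mk k N M).comp (N.sgn d)).flip) ∘ₗ (M.deg d).subtype)

theorem braid_tmul (M : GMod.{u, v} k) (N : GMod.{u, w} k) {i j : ℤ} {x : M} {y : N}
    (hx : x ∈ M.deg i) (hy : y ∈ N.deg j) :
    braid M N (x ⊗ₜ y) = ((Int.negOnePow (i * j) : ℤˣ) : ℤ) • (y ⊗ₜ[k] x) := by
  rw [braid, TensorProduct.lift.tmul, lift_of_mem M _ hx]
  simp [sgn_of_mem N i hy, TensorProduct.smul_tmul']

/-- `1 ⊗ c ⊗ 1` with `c` the symmetry. -/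
def midSwap (M₁ M₂ N₁ N₂ : GMod.{u, v} k) :
    (M₁ ⊗[k] M₂) ⊗[k] (N₁ ⊗[k] N₂) →ₗ[k] (M₁ ⊗[k] N₁) ⊗[k] (M₂ ⊗[k] N₂) :=
  (TensorProduct.assoc k M₁ N₁ (M₂ ⊗[k] N₂)).symm.toLinearMap ∘ₗ
    LinearMap.lTensor M₁ ((TensorProduct.assoc k N₁ M₂ N₂).toLinearMap ∘ₗ
      LinearMap.rTensor N₂ (braid M₂ N₁) ∘ₗ
        (TensorProduct.assoc k M₂ N₁ N₂).symm.toLinearMap) ∘ₗ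
          (TensorProduct.assoc k M₁ M₂ (N₁ ⊗[k] N₂)).toLinearMap

end GMod

/-! ### Graded quivers and cocategories -/

/-- A graded `k`-quiver. -/
structure GQuiver (k : Type u) [CommRing k] where
  Ob : Type u
  Hom : Ob → Ob → GMod.{u, u} k

variable {k : Type u} [CommRing k]

/-- The quiver with all modules of morphisms shifted by `n`; `A.shift 1` is the suspension. -/
abbrev GQuiver.shift (A : GQuiver k) (n : ℤ) : GQuiver k := ⟨A.Ob, fun X Y => (A.Hom X Y).shift n⟩

/-- Families of linear maps `C(X, Y) → D(X f, Y g)` for given maps `f`, `g` of objects. -/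
abbrev Fam (C D : GQuiver k) (f g : C.Ob → D.Ob) : Type u :=
  ∀ X Y : C.Ob, C.Hom X Y →ₗ[k] D.Hom (f X) (g Y)

/-- A map of objects with linear maps `C(X, Y) → D(X f, Y f)`. -/
@[ext] structure QMap (C D : GQuiver k) where
  obj : C.Ob → D.Ob
  map : Fam C D obj obj

/-- The identity. -/
def QMap.id (C : GQuiver k) : QMap C C := ⟨fun X => X, fun _ _ => LinearMap.id⟩

/-- Composition, in the order `f` first, `g` second. -/
def QMap.comp {C D E : GQuiver k} (f : QMap C D) (g : QMap D E) : QMap C E :=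
  ⟨fun X => g.obj (f.obj X), fun X Y => g.map _ _ ∘ₗ f.map X Y⟩

/-- The family consists of maps of degree `d`. -/
def Fam.HasDegree {C D : GQuiver k} {f g : C.Ob → D.Ob} (r : Fam C D f g) (d : ℤ) : Prop :=
  ∀ X Y (n : ℤ) (x : C.Hom X Y), x ∈ (C.Hom X Y).deg n →
    r X Y x ∈ (D.Hom (f X) (g Y)).deg (n + d)

/-- `⨁_Z C(X, Z) ⊗ C(Z, Y)`. -/
def GQuiver.Mid (C : GQuiver k) (X Y : C.Ob) : Type u := ⨁ Z : C.Ob, C.Hom X Z ⊗[k] C.Hom Z Y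

instance (C : GQuiver k) (X Y : C.Ob) : AddCommGroup (C.Mid X Y) :=
  inferInstanceAs (AddCommGroup (⨁ Z : C.Ob, C.Hom X Z ⊗[k] C.Hom Z Y))

instance (C : GQuiver k) (X Y : C.Ob) : Module k (C.Mid X Y) :=
  inferInstanceAs (Module k (⨁ Z : C.Ob, C.Hom X Z ⊗[k] C.Hom Z Y))

open scoped Classical in
/-- The inclusion of `C(X, Z) ⊗ C(Z, Y)` in `⨁_Z C(X, Z) ⊗ C(Z, Y)`. -/
def GQuiver.midIncl (C : GQuiver k) (X Z Y : C.Ob) : C.Hom X Z ⊗[k] C.Hom Z Y →ₗ[k] C.Mid X Y :=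
  DirectSum.lof k C.Ob (fun Z => C.Hom X Z ⊗[k] C.Hom Z Y) Z

open scoped Classical in
/-- Linear maps out of `⨁_Z C(X, Z) ⊗ C(Z, Y)`. -/
def GQuiver.midDesc (C : GQuiver k) {X Y : C.Ob} {N : Type*} [AddCommGroup N] [Module k N]
    (t : ∀ Z, C.Hom X Z ⊗[k] C.Hom Z Y →ₗ[k] N) : C.Mid X Y →ₗ[k] N :=
  DirectSum.toModule k C.Ob N t

theorem GQuiver.mid_ext (C : GQuiver k) {X Y : C.Ob} {N : Type*} [AddCommGroup N] [Module k N]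
    {t t' : C.Mid X Y →ₗ[k] N}
    (h : ∀ Z x y, t (C.midIncl X Z Y (x ⊗ₜ y)) = t' (C.midIncl X Z Y (x ⊗ₜ y))) : t = t' := by
  classical
  refine DirectSum.linearMap_ext _ fun Z => TensorProduct.ext' fun x y => ?_
  exact h Z x y

@[simp] theorem GQuiver.midDesc_midIncl (C : GQuiver k) {X Y : C.Ob} {N : Type*} [AddCommGroup N]
    [Module k N] (t : ∀ Z, C.Hom X Z ⊗[k] C.Hom Z Y →ₗ[k] N) (Z : C.Ob)
    (x : C.Hom X Z ⊗[k] C.Hom Z Y) : C.midDesc t (C.midIncl X Z Y x) = t Z x := by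
  classical
  exact DirectSum.toModule_lof k (M := fun Z => C.Hom X Z ⊗[k] C.Hom Z Y) Z x

/-- The data of a coaugmented graded cocategory: a graded quiver with a comultiplication, a counit
(extended by `0` to pairs of different objects) and the distinguished group-like elements
`1_X ∈ C(X, X)`. It is used only for tensor cocategories and their tensor products. -/
structure Cocat (k : Type u) [CommRing k] extends GQuiver k where
  comul : ∀ X Y : Ob, Hom X Y →ₗ[k] toGQuiver.Mid X Y
  counit : ∀ X Y : Ob, Hom X Y →ₗ[k] k
  one : ∀ X : Ob, Hom X X

/-- `u ⊗ v : ⨁_Z C(X, Z) ⊗ C(Z, Y) → ⨁_W D(X f, W) ⊗ D(W, Y h)` for maps `u`, `v` which involve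
no sign; it sends the summand `Z` to the summand `W = Z g`. -/
def Fam.tens {C D : GQuiver k} {f g h : C.Ob → D.Ob} (r : Fam C D f g) (s : Fam C D g h)
    (X Y : C.Ob) : C.Mid X Y →ₗ[k] D.Mid (f X) (h Y) :=
  C.midDesc fun Z => D.midIncl (f X) (g Z) (h Y) ∘ₗ TensorProduct.map (r X Z) (s Z Y)

/-- The family `x ↦ (-1) ^ (n * deg x) (x) r`. -/
def Fam.twist {C D : GQuiver k} {f g : C.Ob → D.Ob} (r : Fam C D f g) (n : ℤ) : Fam C D f g :=
  fun X Y => r X Y ∘ₗ (C.Hom X Y).sgn n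

/-- Evaluation of a family at a pair of objects. -/
def Fam.evalL {C D : GQuiver k} (f g : C.Ob → D.Ob) (X Y : C.Ob) :
    Fam C D f g →ₗ[k] C.Hom X Y →ₗ[k] D.Hom (f X) (g Y) where
  toFun r := r X Y
  map_add' _ _ := rfl
  map_smul' _ _ := rfl

/-- Homomorphisms of degree `0` of coaugmented graded cocategories. Between tensor cocategories and
tensor products of these, the last condition says that the image of `T⁰` is contained in `T⁰`. -/
@[ext] structure CocatHom (C D : Cocat k) extends QMap C.toGQuiver D.toGQuiver where
  hasDegree : map.HasDegree 0
  map_comul : ∀ X Y (x : C.Hom X Y),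
    D.comul _ _ (map X Y x) = map.tens map X Y (C.comul X Y x)
  map_counit : ∀ X Y (x : C.Hom X Y), D.counit _ _ (map X Y x) = C.counit X Y x
  map_one : ∀ X, map X X (C.one X) = D.one (obj X)

/-- `r` is an `(f, g)`-coderivation of degree `d`: `r Δ = Δ (f ⊗ r + r ⊗ g)`, where by Koszul's
rule `(x ⊗ y)(r ⊗ g) = (-1) ^ (d * deg y) (x) r ⊗ (y) g`. -/
def IsCoderivation {C D : Cocat k} (f g : QMap C.toGQuiver D.toGQuiver) (d : ℤ)
    (r : Fam C.toGQuiver D.toGQuiver f.obj g.obj) : Prop :=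
  r.HasDegree d ∧ ∀ X Y (x : C.Hom X Y),
    D.comul _ _ (r X Y x) =
      f.map.tens r X Y (C.comul X Y x) + r.tens (g.map.twist d) X Y (C.comul X Y x)

theorem Fam.tens_add_left {C D : GQuiver k} {f g h : C.Ob → D.Ob} (r r' : Fam C D f g)
    (s : Fam C D g h) (X Y : C.Ob) : (r + r').tens s X Y = r.tens s X Y + r'.tens s X Y := by
  refine C.mid_ext fun Z x y => ?_
  simp [Fam.tens, TensorProduct.add_tmul]

theorem Fam.tens_smul_left {C D : GQuiver k} {f g h : C.Ob → D.Ob} (c : k) (r : Fam C D f g)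
    (s : Fam C D g h) (X Y : C.Ob) : (c • r).tens s X Y = c • r.tens s X Y := by
  refine C.mid_ext fun Z x y => ?_
  simp [Fam.tens, ← TensorProduct.smul_tmul']

theorem Fam.tens_add_right {C D : GQuiver k} {f g h : C.Ob → D.Ob} (r : Fam C D f g)
    (s s' : Fam C D g h) (X Y : C.Ob) : r.tens (s + s') X Y = r.tens s X Y + r.tens s' X Y := by
  refine C.mid_ext fun Z x y => ?_
  simp [Fam.tens, TensorProduct.tmul_add]

theorem Fam.tens_smul_right {C D : GQuiver k} {f g h : C.Ob → D.Ob} (c : k) (r : Fam C D f g)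
    (s : Fam C D g h) (X Y : C.Ob) : r.tens (c • s) X Y = c • r.tens s X Y := by
  refine C.mid_ext fun Z x y => ?_
  simp [Fam.tens]

/-- The module of `(f, g)`-coderivations of degree `d`. -/
def coderivations {C D : Cocat k} (f g : QMap C.toGQuiver D.toGQuiver) (d : ℤ) :
    Submodule k (Fam C.toGQuiver D.toGQuiver f.obj g.obj) where
  carrier := {r | IsCoderivation f g d r}
  add_mem' := by
    rintro r s ⟨hr, hr'⟩ ⟨hs, hs'⟩
    refine ⟨fun X Y n x hx => add_mem (hr X Y n x hx) (hs X Y n x hx), fun X Y x => ?_⟩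
    rw [Fam.tens_add_left, Fam.tens_add_right]
    simp only [Pi.add_apply, LinearMap.add_apply, map_add, hr', hs']
    abel
  zero_mem' := by
    refine ⟨fun X Y n x hx => zero_mem _, fun X Y x => ?_⟩
    have h1 := Fam.tens_smul_right (0 : k) f.map (0 : Fam C.toGQuiver D.toGQuiver f.obj g.obj) X Y
    have h2 := Fam.tens_smul_left (0 : k) (0 : Fam C.toGQuiver D.toGQuiver f.obj g.obj)
      (g.map.twist d) X Y
    rw [zero_smul, zero_smul] at h1 h2
    rw [h1, h2]; simp
  smul_mem' := by
    rintro c r ⟨hr, hr'⟩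
    refine ⟨fun X Y n x hx => Submodule.smul_mem _ c (hr X Y n x hx), fun X Y x => ?_⟩
    rw [Fam.tens_smul_left, Fam.tens_smul_right]
    simp only [Pi.smul_apply, LinearMap.smul_apply, map_smul, hr', smul_add]

/-! ### Tensor products of cocategories -/

/-- The tensor product of graded quivers. -/
abbrev GQuiver.tensor (C D : GQuiver k) : GQuiver k :=
  ⟨C.Ob × D.Ob, fun X Y => (C.Hom X.1 Y.1).tensor (D.Hom X.2 Y.2)⟩

/-- The tensor product of quiver maps (which involve no sign). -/
def QMap.tensor {C D C' D' : GQuiver k} (f : QMap C C') (g : QMap D D') :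
    QMap (C.tensor D) (C'.tensor D') :=
  ⟨fun X => (f.obj X.1, g.obj X.2), fun X Y =>
    TensorProduct.map (f.map X.1 Y.1) (g.map X.2 Y.2)⟩

open scoped Classical in
/-- The tensor product of cocategories, with comultiplication `(Δ ⊗ Δ)(1 ⊗ c ⊗ 1)`. -/
abbrev Cocat.tensor (C D : Cocat k) : Cocat k where
  toGQuiver := C.toGQuiver.tensor D.toGQuiver
  comul X Y :=
    (DirectSum.toModule k (C.Ob × D.Ob) ((C.toGQuiver.tensor D.toGQuiver).Mid X Y) fun Z =>
      (C.toGQuiver.tensor D.toGQuiver).midIncl X Z Y ∘ₗ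
        GMod.midSwap (C.Hom X.1 Z.1) (C.Hom Z.1 Y.1) (D.Hom X.2 Z.2) (D.Hom Z.2 Y.2)) ∘ₗ
    (TensorProduct.directSum k k (fun Z : C.Ob => C.Hom X.1 Z ⊗[k] C.Hom Z Y.1)
      (fun Z : D.Ob => D.Hom X.2 Z ⊗[k] D.Hom Z Y.2)).toLinearMap ∘ₗ
    TensorProduct.map (C.comul X.1 Y.1) (D.comul X.2 Y.2)
  counit X Y := LinearMap.mul' k k ∘ₗ TensorProduct.map (C.counit X.1 Y.1) (D.counit X.2 Y.2)
  one X := C.one X.1 ⊗ₜ D.one X.2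

/-- `C¹ ⊗ (C² ⊗ (⋯ ⊗ C^q))` for the nonempty list `C¹, …, C^q`. -/
def Cocat.tensorList (C : Cocat k) : List (Cocat k) → Cocat k
  | [] => C
  | D :: L => C.tensor (Cocat.tensorList D L)

/-! ### The tensor cocategory of a quiver -/

namespace GQuiver

/-- `Tⁿ A (X, Y) = ⨁ A(X, X₁) ⊗ (A(X₁, X₂) ⊗ ⋯ (A(Xₙ₋₁, Y) ⊗ k))`, the sum over all sequences of
intermediate objects; `T⁰ A (X, Y)` is `k` if `X = Y` and `0` otherwise. -/
def pow (A : GQuiver k) : ℕ → A.Ob → A.Ob → GMod.{u, u} k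
  | 0, X, Y => GMod.directSum fun _ : PLift (X = Y) => GMod.unit k
  | n + 1, X, Y => GMod.directSum fun Z => (A.Hom X Z).tensor (pow A n Z Y)

/-- `T A (X, Y) = ⨁ Tⁿ A (X, Y)`. -/
def tHom (A : GQuiver k) (X Y : A.Ob) : GMod.{u, u} k := GMod.directSum fun n => A.pow n X Y

/-- The underlying quiver of `T A`. -/
abbrev tq (A : GQuiver k) : GQuiver k := ⟨A.Ob, A.tHom⟩

/-- The element `1 ∈ k = T⁰ A (X, X)`. -/
def powOne (A : GQuiver k) (X : A.Ob) : A.pow 0 X X :=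
  GMod.incl (fun _ : PLift (X = X) => GMod.unit k) ⟨rfl⟩ (1 : k)

/-- `a, h₁ ⊗ ⋯ ⊗ hₙ ↦ a ⊗ h₁ ⊗ ⋯ ⊗ hₙ`. -/
def powCons (A : GQuiver k) (n : ℕ) (X Z Y : A.Ob) :
    A.Hom X Z →ₗ[k] A.pow n Z Y →ₗ[k] A.pow (n + 1) X Y :=
  (TensorProduct.mk k (A.Hom X Z) (A.pow n Z Y)).compr₂
    (GMod.incl (fun Z => (A.Hom X Z).tensor (A.pow n Z Y)) Z)

/-- Linear maps out of `T⁰ A (X, Y)`, given by the image of `1` if `X = Y`. -/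
def powZeroDesc (A : GQuiver k) {X Y : A.Ob} {N : Type*} [AddCommGroup N] [Module k N]
    (t : X = Y → N) : A.pow 0 X Y →ₗ[k] N :=
  GMod.desc (M := fun _ : PLift (X = Y) => GMod.unit k) fun h =>
    LinearMap.toSpanSingleton k N (t h.down)

theorem powZeroDesc_powOne (A : GQuiver k) {X : A.Ob} {N : Type*} [AddCommGroup N] [Module k N]
    (t : X = X → N) : A.powZeroDesc t (A.powOne X) = t rfl :=
  (GMod.desc_incl _ _ _).trans (one_smul k _)

/-- Linear maps out of `Tⁿ⁺¹ A (X, Y)`, given by bilinear maps on `A(X, Z) × Tⁿ A(Z, Y)`. -/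
def powSuccDesc (A : GQuiver k) {n : ℕ} {X Y : A.Ob} {N : Type*} [AddCommGroup N] [Module k N]
    (t : ∀ Z, A.Hom X Z →ₗ[k] A.pow n Z Y →ₗ[k] N) : A.pow (n + 1) X Y →ₗ[k] N :=
  GMod.desc (M := fun Z => (A.Hom X Z).tensor (A.pow n Z Y)) fun Z => TensorProduct.lift (t Z)

theorem powSuccDesc_powCons (A : GQuiver k) {n : ℕ} {X Y : A.Ob} {N : Type*} [AddCommGroup N]
    [Module k N] (t : ∀ Z, A.Hom X Z →ₗ[k] A.pow n Z Y →ₗ[k] N) (Z : A.Ob) (a : A.Hom X Z)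
    (p : A.pow n Z Y) : A.powSuccDesc t (A.powCons n X Z Y a p) = t Z a p :=
  (GMod.desc_incl _ _ _).trans (TensorProduct.lift.tmul _ _)

/-- Linear maps out of `T A (X, Y)`. -/
def tDesc (A : GQuiver k) {X Y : A.Ob} {N : Type*} [AddCommGroup N] [Module k N]
    (t : ∀ n, A.pow n X Y →ₗ[k] N) : A.tHom X Y →ₗ[k] N :=
  GMod.desc (M := fun n => A.pow n X Y) t

/-- The inclusion of `Tⁿ A` in `T A`. -/
def tIncl (A : GQuiver k) (n : ℕ) (X Y : A.Ob) : A.pow n X Y →ₗ[k] A.tHom X Y :=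
  GMod.incl (fun n => A.pow n X Y) n

theorem tDesc_tIncl (A : GQuiver k) {X Y : A.Ob} {N : Type*} [AddCommGroup N] [Module k N]
    (t : ∀ n, A.pow n X Y →ₗ[k] N) (n : ℕ) (x : A.pow n X Y) :
    A.tDesc t (A.tIncl n X Y x) = t n x :=
  GMod.desc_incl _ _ _

/-- The element `1 ∈ k = T⁰ A (X, X)`, in `T A (X, X)`. -/
def tOne (A : GQuiver k) (X : A.Ob) : A.tHom X X := A.tIncl 0 X X (A.powOne X)

/-- `a, h₁ ⊗ ⋯ ⊗ hₙ ↦ a ⊗ h₁ ⊗ ⋯ ⊗ hₙ` on `T A`. -/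
def cons (A : GQuiver k) (X Z Y : A.Ob) :
    A.Hom X Z →ₗ[k] A.tHom Z Y →ₗ[k] A.tHom X Y :=
  (A.tDesc fun n => ((A.powCons n X Z Y).compr₂ (A.tIncl (n + 1) X Y)).flip).flip

theorem cons_tIncl (A : GQuiver k) (X Z Y : A.Ob) (n : ℕ) (a : A.Hom X Z) (p : A.pow n Z Y) :
    A.cons X Z Y a (A.tIncl n Z Y p) = A.tIncl (n + 1) X Y (A.powCons n X Z Y a p) := by
  rw [cons, LinearMap.flip_apply, tDesc_tIncl]; rfl

/-- The inclusion of `A = T¹ A` in `T A`. -/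
def tIncl₁ (A : GQuiver k) (X Y : A.Ob) : A.Hom X Y →ₗ[k] A.tHom X Y :=
  (A.cons X Y Y).flip (A.tOne Y)

/-- The projection of `Tⁿ A` to `A = T¹ A`: zero unless `n = 1`. -/
def powPr₁ (A : GQuiver k) : ∀ (n : ℕ) (X Y : A.Ob), A.pow n X Y →ₗ[k] A.Hom X Y
  | 1, X, Y => A.powSuccDesc fun Z =>
      (A.powZeroDesc fun h : Z = Y =>
        (h ▸ LinearMap.id : A.Hom X Z →ₗ[k] A.Hom X Y)).flip
  | 0, _, _ => 0
  | _ + 2, _, _ => 0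

/-- The projection `pr₁ : T A → A`. -/
def pr₁ (A : GQuiver k) (X Y : A.Ob) : A.tHom X Y →ₗ[k] A.Hom X Y :=
  A.tDesc fun n => A.powPr₁ n X Y

/-- Concatenation with a fixed element of `Tⁿ A` on the left. -/
def powConcat (A : GQuiver k) : ∀ (n : ℕ) (X Y Z : A.Ob),
    A.pow n X Y →ₗ[k] A.tHom Y Z →ₗ[k] A.tHom X Z
  | 0, X, Y, Z => A.powZeroDesc fun h : X = Y =>
      (h ▸ LinearMap.id : A.tHom Y Z →ₗ[k] A.tHom X Z)
  | n + 1, X, Y, Z => A.powSuccDesc fun W =>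
      ((LinearMap.llcomp k (A.tHom Y Z) (A.tHom W Z) (A.tHom X Z)) ∘ₗ
        A.cons X W Z).compl₂ (powConcat A n W Y Z)

/-- Concatenation of tensors `T A (X, Y) ⊗ T A (Y, Z) → T A (X, Z)`. -/
def concat (A : GQuiver k) (X Y Z : A.Ob) :
    A.tHom X Y →ₗ[k] A.tHom Y Z →ₗ[k] A.tHom X Z :=
  A.tDesc fun n => A.powConcat n X Y Z

/-- `a, ∑ t' ⊗ t'' ↦ ∑ (a ⊗ t') ⊗ t''`. -/
def consMid (A : GQuiver k) (X W Y : A.Ob) :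
    A.Hom X W →ₗ[k] A.tq.Mid W Y →ₗ[k] A.tq.Mid X Y :=
  (A.tq.midDesc fun Z => ((LinearMap.rTensorHom (A.tHom Z Y) ∘ₗ A.cons X W Z).compr₂
    (A.tq.midIncl X Z Y)).flip).flip

/-- The cut comultiplication on `Tⁿ A`: `Δ(1_X) = 1_X ⊗ 1_X` and
`Δ(a ⊗ t) = 1_X ⊗ (a ⊗ t) + ∑ (a ⊗ t') ⊗ t''` for `Δ(t) = ∑ t' ⊗ t''`. -/
def powComul (A : GQuiver k) : ∀ (n : ℕ) (X Y : A.Ob), A.pow n X Y →ₗ[k] A.tq.Mid X Y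
  | 0, X, Y => A.powZeroDesc fun h =>
      A.tq.midIncl X X Y (A.tOne X ⊗ₜ (h ▸ A.tOne X : A.tHom X Y))
  | n + 1, X, Y => A.powSuccDesc fun W =>
      ((A.cons X W Y).compl₂ (A.tIncl n W Y)).compr₂
        (A.tq.midIncl X X Y ∘ₗ
          TensorProduct.mk k (A.tHom X X) (A.tHom X Y) (A.tOne X)) +
      (A.consMid X W Y).compl₂ (powComul A n W Y)

/-- The projection of `Tⁿ A` to `T⁰ A`, followed by the identity of `k`: zero unless `n = 0`. -/
def powCounit (A : GQuiver k) : ∀ (n : ℕ) (X Y : A.Ob), A.pow n X Y →ₗ[k] k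
  | 0, _, _ => A.powZeroDesc fun _ => 1
  | _ + 1, _, _ => 0

/-- The tensor cocategory `T A`. -/
abbrev T (A : GQuiver k) : Cocat k where
  toGQuiver := A.tq
  comul X Y := A.tDesc fun n => A.powComul n X Y
  counit X Y := A.tDesc fun n => A.powCounit n X Y
  one := A.tOne

end GQuiver

/-- The map `T F : T A → T B` induced by a map `F : A → B` of quivers. -/
def QMap.powMap {A B : GQuiver k} (F : QMap A B) :
    ∀ (n : ℕ) (X Y : A.Ob), A.pow n X Y →ₗ[k] B.tHom (F.obj X) (F.obj Y)
  | 0, X, Y => A.powZeroDesc fun h : X = Y =>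
      (h ▸ B.tOne (F.obj X) : B.tHom (F.obj X) (F.obj Y))
  | n + 1, X, Y => A.powSuccDesc fun Z =>
      (B.cons (F.obj X) (F.obj Z) (F.obj Y)).compl₁₂ (F.map X Z) (powMap F n Z Y)

/-- The map `T F : T A → T B` induced by a map `F : A → B` of quivers. -/
def QMap.T {A B : GQuiver k} (F : QMap A B) : QMap A.T.toGQuiver B.T.toGQuiver :=
  ⟨F.obj, fun X Y => A.tDesc fun n => F.powMap n X Y⟩

/-! ### The quiver of coderivations and its action -/

/-- The quiver `Coder(A, B)`: objects are the cocategory homomorphisms `T A → T B`, and morphisms of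
degree `d` are the coderivations of degree `d`. -/
abbrev Coder (A B : GQuiver k) : GQuiver k :=
  ⟨CocatHom A.T B.T, fun f g => GMod.ofFamily fun d => coderivations f.toQMap g.toQMap d⟩

/-- The product `Δ (r ⊗ s) μ` of families of maps `T A → T B`, with `μ` the concatenation. -/
def conv {A B : GQuiver k} {f g h : A.Ob → B.Ob} (r : Fam A.T.toGQuiver B.T.toGQuiver f g)
    (s : Fam A.T.toGQuiver B.T.toGQuiver g h) : Fam A.T.toGQuiver B.T.toGQuiver f h := fun X Y =>
  (B.T.midDesc fun W => TensorProduct.lift (B.concat (f X) W (h Y))) ∘ₗ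
    r.tens s X Y ∘ₗ A.T.comul X Y

/-- `conv` as a bilinear map. -/
def convL {A B : GQuiver k} (f g h : A.Ob → B.Ob) :
    Fam A.T.toGQuiver B.T.toGQuiver f g →ₗ[k] Fam A.T.toGQuiver B.T.toGQuiver g h →ₗ[k]
      Fam A.T.toGQuiver B.T.toGQuiver f h :=
  LinearMap.mk₂ k conv
    (fun r r' s => funext fun X => funext fun Y => by
      rw [conv, Fam.tens_add_left, LinearMap.add_comp, LinearMap.comp_add]; rfl)
    (fun c r s => funext fun X => funext fun Y => by
      rw [conv, Fam.tens_smul_left, LinearMap.smul_comp, LinearMap.comp_smul]; rfl)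
    (fun r s s' => funext fun X => funext fun Y => by
      rw [conv, Fam.tens_add_right, LinearMap.add_comp, LinearMap.comp_add]; rfl)
    (fun c r s => funext fun X => funext fun Y => by
      rw [conv, Fam.tens_smul_right, LinearMap.smul_comp, LinearMap.comp_smul]; rfl)

/-- `r ↦ r pr₁`, considered with values in `T¹ B ⊂ T B`. -/
def linPart {A B : GQuiver k} (f g : A.Ob → B.Ob) :
    Fam A.T.toGQuiver B.T.toGQuiver f g →ₗ[k] Fam A.T.toGQuiver B.T.toGQuiver f g where
  toFun r := fun X Y => B.tIncl₁ (f X) (g Y) ∘ₗ B.pr₁ (f X) (g Y) ∘ₗ r X Y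
  map_add' r s := by funext X Y; simp only [Pi.add_apply, LinearMap.comp_add]
  map_smul' c r := by
    funext X Y; simp only [Pi.smul_apply, LinearMap.comp_smul, RingHom.id_apply]

/-- `Fam.twist` as a linear map. -/
def twistL {A B : GQuiver k} (f g : A.Ob → B.Ob) (d : ℤ) :
    Fam A B f g →ₗ[k] Fam A B f g where
  toFun r := r.twist d
  map_add' r s := by funext X Y; simp only [Fam.twist, Pi.add_apply, LinearMap.add_comp]
  map_smul' c r := by
    funext X Y; simp only [Fam.twist, Pi.smul_apply, LinearMap.smul_comp, RingHom.id_apply]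

/-- The maps `(r¹ ⊗ ⋯ ⊗ rⁿ)θ : T A → T B`, for coderivations `f⁰ → f¹ → ⋯ → fⁿ`. Their components
are the sums of all `f⁰ ⊗ ⋯ ⊗ f⁰ ⊗ r¹ ⊗ f¹ ⊗ ⋯ ⊗ f¹ ⊗ r² ⊗ ⋯ ⊗ rⁿ ⊗ fⁿ ⊗ ⋯ ⊗ fⁿ` (of components of
`fⁱ` and `rⁱ`). Recursively, `( )θ = f⁰` and
`(r¹ ⊗ ⋯ ⊗ rⁿ)θ = Δ⁽³⁾ (f⁰ ⊗ r¹ pr₁ ⊗ (r² ⊗ ⋯ ⊗ rⁿ)θ) μ⁽³⁾`, with the sign of Koszul's rule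
`(x ⊗ y ⊗ z)(f⁰ ⊗ r ⊗ w) = (-1) ^ (deg r * deg z) (x) f⁰ ⊗ (y) r ⊗ (z) w`. -/
def thetaPow (A B : GQuiver k) : ∀ (n : ℕ) (f g : CocatHom A.T B.T),
    (Coder A B).pow n f g →ₗ[k] Fam A.T.toGQuiver B.T.toGQuiver f.obj g.obj
  | 0, f, g => (Coder A B).powZeroDesc fun h : f = g =>
      (h ▸ f.map : Fam A.T.toGQuiver B.T.toGQuiver f.obj g.obj)
  | n + 1, f, g => (Coder A B).powSuccDesc fun h =>
      DirectSum.toModule k ℤ _ fun d =>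
        ((convL (A := A) (B := B) f.obj h.obj g.obj).compl₁₂
            (linPart (A := A) (B := B) f.obj h.obj ∘ₗ (coderivations f.toQMap h.toQMap d).subtype)
            (twistL h.obj g.obj d ∘ₗ thetaPow A B n h g)).compr₂
          (convL (A := A) (B := B) f.obj f.obj g.obj f.map)

/-- `θ` on `T Coder(A, B)`. -/
def theta (A B : GQuiver k) (f g : CocatHom A.T B.T) :
    (Coder A B).T.Hom f g →ₗ[k] Fam A.T.toGQuiver B.T.toGQuiver f.obj g.obj :=
  (Coder A B).tDesc fun n => thetaPow A B n f g

/-- The action `α : T A ⊗ T Coder(A, B) → T B`, `a ⊗ r¹ ⊗ ⋯ ⊗ rⁿ ↦ a[(r¹ ⊗ ⋯ ⊗ rⁿ)θ]`. -/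
def action (A B : GQuiver k) : QMap (A.T.tensor (Coder A B).T).toGQuiver B.T.toGQuiver :=
  ⟨fun X => X.2.obj X.1, fun X Y => TensorProduct.lift
    ((Fam.evalL X.2.obj Y.2.obj X.1 Y.1) ∘ₗ theta A B X.2 Y.2).flip⟩

/-! ### `A∞`-categories -/

/-- The structure of an `A∞`-category on a graded quiver `A`: a differential `b` of degree `1` on
`T s A` which is a `(1, 1)`-coderivation and vanishes on `T⁰ s A`. -/
@[ext] structure AInfStructure (A : GQuiver k) where
  b : Fam (A.shift 1).T.toGQuiver (A.shift 1).T.toGQuiver id id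
  coderivation :
    IsCoderivation (QMap.id (A.shift 1).T.toGQuiver) (QMap.id (A.shift 1).T.toGQuiver) 1 b
  sq_zero : ∀ X Y (x : (A.shift 1).T.Hom X Y), b X Y (b X Y x) = 0
  map_one : ∀ X, b X X ((A.shift 1).T.one X) = 0

/-- An `A∞`-category. -/
structure AInfCat (k : Type u) [CommRing k] where
  quiver : GQuiver k
  str : AInfStructure quiver

/-- A (coaugmented) cocategory with an endomorphism `d` of every module of morphisms, which will be
a differential. It is used only for `T s A` with `A` an `A∞`-category, and for tensor products of
these. -/
structure DGCocat (k : Type u) [CommRing k] extends Cocat k where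
  d : ∀ X Y : Ob, Hom X Y →ₗ[k] Hom X Y

/-- The tensor product, with differential `1 ⊗ d + d ⊗ 1`, where by Koszul's rule
`(x ⊗ y)(d ⊗ 1) = (-1) ^ deg y (x) d ⊗ y`. -/
abbrev DGCocat.tensor (C D : DGCocat k) : DGCocat k where
  toCocat := C.toCocat.tensor D.toCocat
  d X Y := LinearMap.lTensor (C.Hom X.1 Y.1) (D.d X.2 Y.2) +
    TensorProduct.map (C.d X.1 Y.1) ((D.Hom X.2 Y.2).sgn 1)

/-- `C¹ ⊗ (C² ⊗ (⋯ ⊗ C^q))` for the nonempty list `C¹, …, C^q`. -/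
def DGCocat.tensorList (C : DGCocat k) : List (DGCocat k) → DGCocat k
  | [] => C
  | D :: L => C.tensor (DGCocat.tensorList D L)

/-- The differential graded cocategory `T s A` for an `A∞`-structure on `A`. -/
abbrev AInfStructure.bar {A : GQuiver k} (S : AInfStructure A) : DGCocat k :=
  ⟨(A.shift 1).T, S.b⟩

/-- The differential graded cocategory `T s A`. -/
abbrev AInfCat.bar (A : AInfCat k) : DGCocat k := A.str.bar

/-- A map of quivers commutes with the differentials. -/
def QMap.IsChain {C D : DGCocat k} (f : QMap C.toGQuiver D.toGQuiver) : Prop :=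
  ∀ X Y (x : C.Hom X Y), D.d _ _ (f.map X Y x) = f.map X Y (C.d X Y x)

/-- `A∞`-functors, in the generalized sense: homomorphisms of (coaugmented) graded cocategories
that commute with the differentials. The usual `A∞`-functors `A → B` are those from `T s A` to
`T s B`. -/
@[ext] structure AInfFunctor (C D : DGCocat k) extends CocatHom C.toCocat D.toCocat where
  isChain : toQMap.IsChain (C := C) (D := D)

/-- The graded quiver underlying `A∞(A, B)`: objects are the `A∞`-functors `A → B`, and morphisms of
degree `d + 1` are the coderivations (`A∞`-transformations) of degree `d`. -/
abbrev aInfQuiver (A B : AInfCat k) : GQuiver k :=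
  ⟨AInfFunctor A.bar B.bar, fun f g =>
    ((Coder (A.quiver.shift 1) (B.quiver.shift 1)).Hom f.toCocatHom g.toCocatHom).shift (-1)⟩

/-- The embedding of `s A∞(A, B)` in `Coder(s A, s B)` as a full subquiver. -/
def aInfIncl (A B : AInfCat k) :
    QMap ((aInfQuiver A B).shift 1) (Coder (A.quiver.shift 1) (B.quiver.shift 1)) :=
  ⟨fun f => f.toCocatHom, fun _ _ => LinearMap.id⟩

/-- The action `α : T s A ⊗ T s A∞(A, B) → T s B`, the restriction of the action of
`T Coder(s A, s B)`. -/
def aInfAction (A B : AInfCat k) :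
    QMap ((A.quiver.shift 1).T.tensor ((aInfQuiver A B).shift 1).T).toGQuiver
      (B.quiver.shift 1).T.toGQuiver :=
  ((QMap.id _).tensor (aInfIncl A B).T).comp (action (A.quiver.shift 1) (B.quiver.shift 1))

end AInf
end

/-!
The tensor cocategory `T B` is cofree among conilpotent cocategories: a homomorphism `C → T B`, or a
coderivation between two homomorphisms, is the same as its linear part, the composition with
`pr₁ : T B → B`. Conilpotency is recorded by a weight (`Cocat.Conil`), which is the tensor degree on
`T A` and is additive under tensor products. A homomorphism `F` satisfies the recursion
`(x)F = ε(x) 1 + ∑ (x')F pr₁ ⊗ (x'')F`, and a coderivation satisfies a similar one. By induction on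
the weight, such recursions have at most one solution with given linear part, every solution is a
homomorphism, respectively a coderivation, and solutions exist (`CocatHom.eq_of_lin`,
`Cocat.Conil.cohomOfRec`, `exists_cohom`, `IsCoderivation.eq_of_lin`, `isCoderivation_of_rec`).

The definition of `θ` gives the recursion for the action `α` (`thetaEval_eq_actionRec`), so `α` is a
homomorphism. Its linear part sends `a ⊗ 1_f` to `(a)f pr₁` and `a ⊗ r` to `(a)r pr₁`, and vanishes
on `a ⊗ r¹ ⊗ ⋯ ⊗ rⁿ` for `n ≥ 2` (`pr₁_thetaEval`). Hence a homomorphism `φ : T A ⊗ C → T B` can be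
written as `(1 ⊗ ψ)α` in exactly one way: the object `x` must go to the restriction of `φ` to the
`a ⊗ 1_x`, and for `c` in the kernel of the counit, `(c)ψ pr₁` must be the coderivation with linear
part `a ↦ (a ⊗ c)φ pr₁` (`exists_curry`, `curry_unique`). Likewise, a coderivation with values in
`T Coder(A, B)` is determined by its action on `T A` (`IsCoderivation.eq_of_curryFam`).

All this holds for a full subquiver `Q` of `Coder(A, B)`, given by a map `ι` with `ι.IsFull`, in
place of `Coder(A, B)`; for the `A∞`-version, `Q` is `s A∞(A, B)`. The action commutes with the
differentials if and only if the differential `b` on `T Q` satisfies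
`(a ⊗ (z)b)α = (a ⊗ z)α b_B - (-1) ^ deg z (a b_A ⊗ z)α`. The right hand side is a coderivation over
`α`, and comparing linear parts yields exactly one coderivation `b` with this property
(`exists_coderivation`). That `b² = 0`, and that `ψ` commutes with the differentials if `φ` does,
are equations between coderivations with values in `T Q`, and they are checked after acting on `T A`
(`differential_sq`, `isChain_of_curryFam`).
-/

noncomputable section

namespace AInf

/-! ### Signs and homogeneous elements -/

section Signs

variable {k : Type u} [CommRing k]

variable (k) in
/-- The sign `(-1) ^ n` as a scalar of `k`. -/
def ksign (n : ℤ) : k := (((Int.negOnePow n : ℤˣ) : ℤ) : k)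

theorem ksign_add (m n : ℤ) : ksign k (m + n) = ksign k m * ksign k n := by
  simp [ksign, Int.negOnePow_add]

theorem ksign_congr {m n : ℤ} (h : Even (m - n)) : ksign k m = ksign k n := by
  rw [ksign, ksign, (Int.negOnePow_eq_iff m n).mpr h]

theorem ksign_even {m : ℤ} (h : Even m) : ksign k m = 1 := by
  rw [ksign, Int.negOnePow_even m h]; simp

@[simp] theorem ksign_zero : ksign k 0 = 1 := ksign_even (by simp)

@[simp] theorem ksign_one : ksign k 1 = -1 := by simp [ksign]

theorem ksign_smul {M : Type*} [AddCommGroup M] [Module k M] (n : ℤ) (x : M) :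
    ((Int.negOnePow n : ℤˣ) : ℤ) • x = ksign k n • x :=
  (Int.cast_smul_eq_zsmul k _ x).symm

namespace GMod

theorem sgn_mem (M : GMod.{u, v} k) {d : ℤ} (n : ℤ) {x : M} (hx : x ∈ M.deg d) :
    M.sgn n x = ksign k (n * d) • x := by
  rw [sgn_of_mem M n hx, ksign_smul (k := k)]

theorem braid_mem (M : GMod.{u, v} k) (N : GMod.{u, w} k) {i j : ℤ} {x : M} {y : N}
    (hx : x ∈ M.deg i) (hy : y ∈ N.deg j) :
    braid M N (x ⊗ₜ y) = ksign k (i * j) • (y ⊗ₜ[k] x) := by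
  rw [braid_tmul M N hx hy, ksign_smul (k := k)]

theorem midSwap_mem (M₁ M₂ N₁ N₂ : GMod.{u, v} k) {i j : ℤ} (x₁ : M₁) {x₂ : M₂} {y₁ : N₁}
    (y₂ : N₂) (hx : x₂ ∈ M₂.deg i) (hy : y₁ ∈ N₁.deg j) :
    midSwap M₁ M₂ N₁ N₂ ((x₁ ⊗ₜ x₂) ⊗ₜ (y₁ ⊗ₜ y₂)) =
      ksign k (i * j) • ((x₁ ⊗ₜ[k] y₁) ⊗ₜ[k] (x₂ ⊗ₜ[k] y₂)) := by
  simp [midSwap, braid_mem _ _ hx hy, TensorProduct.smul_tmul']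

theorem hom_induction (M : GMod.{u, v} k) {p : M → Prop} (zero : p 0)
    (add : ∀ x y, p x → p y → p (x + y)) (mem : ∀ d, ∀ x ∈ M.deg d, p x) (x : M) : p x := by
  have hx : x ∈ ⨆ d, M.deg d := by rw [iSup_deg]; trivial
  induction hx using Submodule.iSup_induction' with
  | zero => exact zero
  | add x y _ _ h1 h2 => exact add x y h1 h2
  | mem i x hx => exact mem i x hx

theorem hom_ext {M : GMod.{u, v} k} {N : Type*} [AddCommGroup N] [Module k N] {f g : M →ₗ[k] N}
    (h : ∀ d, ∀ x ∈ M.deg d, f x = g x) : f = g := by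
  refine LinearMap.ext fun x => ?_
  induction x using M.hom_induction with
  | zero => simp
  | add x y hx hy => simp [hx, hy]
  | mem d x hx => exact h d x hx

theorem proj_self (M : GMod.{u, v} k) {d : ℤ} {x : M} (hx : x ∈ M.deg d) : M.proj d x = x := by
  rw [proj_of_mem M d hx, if_pos rfl]

theorem eq_zero_of_mem_mem (M : GMod.{u, v} k) {d e : ℤ} (hne : d ≠ e) {x : M}
    (hd : x ∈ M.deg d) (he : x ∈ M.deg e) : x = 0 := by
  rw [← proj_self M he, proj_of_mem M e hd, if_neg hne]

theorem sgn_mem_deg (M : GMod.{u, v} k) {d : ℤ} (n : ℤ) {x : M} (hx : x ∈ M.deg d) :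
    M.sgn n x ∈ M.deg d := by
  rw [sgn_mem M n hx]; exact Submodule.smul_mem _ _ hx

/-- Koszul's rule for a map of degree `e` passing the sign operator. -/
theorem sgn_comm {M : GMod.{u, v} k} {N : GMod.{u, w} k} {e : ℤ} (f : M →ₗ[k] N)
    (hf : ∀ d, ∀ x ∈ M.deg d, f x ∈ N.deg (d + e)) (n : ℤ) (x : M) :
    N.sgn n (f x) = ksign k (n * e) • f (M.sgn n x) := by
  suffices h : N.sgn n ∘ₗ f = ksign k (n * e) • f ∘ₗ M.sgn n from LinearMap.congr_fun h x
  refine hom_ext fun d x hx => ?_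
  simp only [LinearMap.comp_apply, LinearMap.smul_apply]
  rw [sgn_mem N n (hf d x hx), sgn_mem M n hx, map_smul, smul_smul, mul_add, ksign_add, mul_comm]

theorem sgn_sgn (M : GMod.{u, v} k) (m n : ℤ) (x : M) : M.sgn m (M.sgn n x) = M.sgn (m + n) x := by
  induction x using M.hom_induction with
  | zero => simp
  | add x y hx hy => simp [hx, hy]
  | mem d x hx =>
    rw [sgn_mem M n hx, map_smul, sgn_mem M m hx, sgn_mem M _ hx, smul_smul, add_mul, ksign_add,
      mul_comm]

theorem sgn_even (M : GMod.{u, v} k) {n : ℤ} (hn : Even n) (x : M) : M.sgn n x = x := by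
  induction x using M.hom_induction with
  | zero => simp
  | add x y hx hy => simp [hx, hy]
  | mem d x hx => rw [sgn_mem M n hx, ksign_even (hn.mul_right d), one_smul]

theorem tmul_mem (M : GMod.{u, v} k) (N : GMod.{u, w} k) {i j : ℤ} {x : M} {y : N}
    (hx : x ∈ M.deg i) (hy : y ∈ N.deg j) : x ⊗ₜ[k] y ∈ (M.tensor N).deg (i + j) :=
  Submodule.subset_span ⟨i, j, rfl, x, hx, y, hy, rfl⟩

theorem tensor_hom_ext {M : GMod.{u, v} k} {N : GMod.{u, w} k} {P : Type*} [AddCommGroup P]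
    [Module k P] {f g : M ⊗[k] N →ₗ[k] P}
    (h : ∀ i, ∀ x ∈ M.deg i, ∀ j, ∀ y ∈ N.deg j, f (x ⊗ₜ y) = g (x ⊗ₜ y)) : f = g := by
  refine TensorProduct.ext (hom_ext fun i x hx => hom_ext fun j y hy => ?_)
  exact h i x hx j y hy

theorem sgn_tmul (M : GMod.{u, v} k) (N : GMod.{u, w} k) (n : ℤ) (x : M) (y : N) :
    (M.tensor N).sgn n (x ⊗ₜ[k] y) = M.sgn n x ⊗ₜ[k] N.sgn n y := by
  have : (M.tensor N).sgn n = TensorProduct.map (M.sgn n) (N.sgn n) := by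
    refine tensor_hom_ext fun i x hx j y hy => ?_
    rw [sgn_mem _ n (tmul_mem M N hx hy), TensorProduct.map_tmul, sgn_mem M n hx, sgn_mem N n hy,
      TensorProduct.smul_tmul_smul, mul_add, ksign_add]
  rw [this, TensorProduct.map_tmul]

end GMod

end Signs

/-! ### Tensors over intermediate objects -/

section Mid

variable {k : Type u} [CommRing k]

@[simp] theorem Fam.tens_midIncl {C D : GQuiver k} {f g h : C.Ob → D.Ob} (r : Fam C D f g)
    (s : Fam C D g h) (X Z Y : C.Ob) (t : C.Hom X Z ⊗[k] C.Hom Z Y) :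
    r.tens s X Y (C.midIncl X Z Y t) =
      D.midIncl (f X) (g Z) (h Y) (TensorProduct.map (r X Z) (s Z Y) t) := by
  simp [Fam.tens]

theorem GQuiver.mid_induction (C : GQuiver k) {X Y : C.Ob} {p : C.Mid X Y → Prop} (zero : p 0)
    (add : ∀ x y, p x → p y → p (x + y))
    (mem : ∀ Z i, ∀ x ∈ (C.Hom X Z).deg i, ∀ j, ∀ y ∈ (C.Hom Z Y).deg j,
      p (C.midIncl X Z Y (x ⊗ₜ y))) (u : C.Mid X Y) : p u := by
  classical
  have lofp : ∀ Z (t : C.Hom X Z ⊗[k] C.Hom Z Y), p (C.midIncl X Z Y t) := by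
    intro Z t
    induction t using TensorProduct.induction_on with
    | zero => simpa using zero
    | add a b ha hb => rw [map_add]; exact add _ _ ha hb
    | tmul x y =>
      induction x using GMod.hom_induction with
      | zero => simpa using zero
      | add a b ha hb => rw [TensorProduct.add_tmul, map_add]; exact add _ _ ha hb
      | mem i x hx =>
        induction y using GMod.hom_induction with
        | zero => simpa using zero
        | add a b ha hb => rw [TensorProduct.tmul_add, map_add]; exact add _ _ ha hb
        | mem j y hy => exact mem Z i x hx j y hy
  exact DirectSum.induction_on (motive := p) u zero lofp add

/-- Linear maps out of `C.Mid X Y` agree if they do so on `x ⊗ y` with homogeneous `x` and `y`; the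
signs in later computations are only defined for these. -/
theorem GQuiver.mid_hom_ext (C : GQuiver k) {X Y : C.Ob} {N : Type*} [AddCommGroup N] [Module k N]
    {t t' : C.Mid X Y →ₗ[k] N}
    (h : ∀ Z i, ∀ x ∈ (C.Hom X Z).deg i, ∀ j, ∀ y ∈ (C.Hom Z Y).deg j,
      t (C.midIncl X Z Y (x ⊗ₜ y)) = t' (C.midIncl X Z Y (x ⊗ₜ y))) : t = t' := by
  refine LinearMap.ext fun u => ?_
  induction u using C.mid_induction with
  | zero => simp
  | add a b ha hb => simp [ha, hb]
  | mem Z i x hx j y hy => exact h Z i x hx j y hy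

/-- The span of the `a ⊗ b` with `a` and `b` of weights `i` and `j` such that `i + j = n` and
`P i j`, and of degrees adding up to `d`, for given submodules `W n d` of elements of weight `n`
and degree `d`. -/
def GQuiver.midW (C : GQuiver k) (W : ∀ X Y, ℕ → ℤ → Submodule k (C.Hom X Y))
    (P : ℕ → ℕ → Prop) (X Y : C.Ob) (n : ℕ) (d : ℤ) : Submodule k (C.Mid X Y) :=
  Submodule.span k {t | ∃ Z i j p q, P i j ∧ i + j = n ∧ p + q = d ∧
    ∃ a ∈ W X Z i p, ∃ b ∈ W Z Y j q, C.midIncl X Z Y (a ⊗ₜ b) = t}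

theorem GQuiver.midW_mem (C : GQuiver k) {W : ∀ X Y, ℕ → ℤ → Submodule k (C.Hom X Y)}
    {P : ℕ → ℕ → Prop} {X Z Y : C.Ob} {i j : ℕ} {p q : ℤ} (h : P i j) {a : C.Hom X Z}
    (ha : a ∈ W X Z i p) {b : C.Hom Z Y} (hb : b ∈ W Z Y j q) :
    C.midIncl X Z Y (a ⊗ₜ b) ∈ C.midW W P X Y (i + j) (p + q) :=
  Submodule.subset_span ⟨Z, i, j, p, q, h, rfl, rfl, a, ha, b, hb, rfl⟩

theorem GQuiver.midW_mono (C : GQuiver k) {W : ∀ X Y, ℕ → ℤ → Submodule k (C.Hom X Y)}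
    {P Q : ℕ → ℕ → Prop} (h : ∀ i j, P i j → Q i j) (X Y : C.Ob) (n : ℕ) (d : ℤ) :
    C.midW W P X Y n d ≤ C.midW W Q X Y n d := by
  refine Submodule.span_mono ?_
  rintro t ⟨Z, i, j, p, q, hP, h'⟩
  exact ⟨Z, i, j, p, q, h i j hP, h'⟩

/-- Linear maps into `N` that map the generators of `midW` into a submodule. -/
theorem GQuiver.midW_map (C : GQuiver k) {W : ∀ X Y, ℕ → ℤ → Submodule k (C.Hom X Y)}
    {P : ℕ → ℕ → Prop} {X Y : C.Ob} {n : ℕ} {d : ℤ} {N : Type*} [AddCommGroup N] [Module k N]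
    (t : C.Mid X Y →ₗ[k] N) (S : Submodule k N)
    (h : ∀ Z i j p q, P i j → i + j = n → p + q = d → ∀ a ∈ W X Z i p, ∀ b ∈ W Z Y j q,
      t (C.midIncl X Z Y (a ⊗ₜ b)) ∈ S) {u : C.Mid X Y} (hu : u ∈ C.midW W P X Y n d) :
    t u ∈ S := by
  have : C.midW W P X Y n d ≤ S.comap t := by
    refine Submodule.span_le.mpr ?_
    rintro _ ⟨Z, i, j, p, q, hP, h1, h2, a, ha, b, hb, rfl⟩
    exact h Z i j p q hP h1 h2 a ha b hb
  exact this hu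

/-- Two linear maps which agree on the generators of `midW` agree on `midW`. -/
theorem GQuiver.midW_eq (C : GQuiver k) {W : ∀ X Y, ℕ → ℤ → Submodule k (C.Hom X Y)}
    {P : ℕ → ℕ → Prop} {X Y : C.Ob} {n : ℕ} {d : ℤ} {N : Type*} [AddCommGroup N] [Module k N]
    (t t' : C.Mid X Y →ₗ[k] N)
    (h : ∀ Z i j p q, P i j → i + j = n → p + q = d → ∀ a ∈ W X Z i p, ∀ b ∈ W Z Y j q,
      t (C.midIncl X Z Y (a ⊗ₜ b)) = t' (C.midIncl X Z Y (a ⊗ₜ b)))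
    {u : C.Mid X Y} (hu : u ∈ C.midW W P X Y n d) : t u = t' u := by
  have := C.midW_map (t - t') ⊥ (fun Z i j p q hP h1 h2 a ha b hb => by
    simp [h Z i j p q hP h1 h2 a ha b hb]) hu
  simpa [sub_eq_zero] using this

/-- `⨁_{Z, W} C(X, Z) ⊗ (C(Z, W) ⊗ C(W, Y))`, the target of the two iterated comultiplications. -/
def GQuiver.Mid₃ (C : GQuiver k) (X Y : C.Ob) : Type u :=
  ⨁ P : C.Ob × C.Ob, C.Hom X P.1 ⊗[k] (C.Hom P.1 P.2 ⊗[k] C.Hom P.2 Y)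

instance (C : GQuiver k) (X Y : C.Ob) : AddCommGroup (C.Mid₃ X Y) :=
  inferInstanceAs (AddCommGroup
    (⨁ P : C.Ob × C.Ob, C.Hom X P.1 ⊗[k] (C.Hom P.1 P.2 ⊗[k] C.Hom P.2 Y)))

instance (C : GQuiver k) (X Y : C.Ob) : Module k (C.Mid₃ X Y) :=
  inferInstanceAs (Module k
    (⨁ P : C.Ob × C.Ob, C.Hom X P.1 ⊗[k] (C.Hom P.1 P.2 ⊗[k] C.Hom P.2 Y)))

open scoped Classical in
/-- The inclusion of a summand in `Mid₃`. -/
def GQuiver.incl₃ (C : GQuiver k) (X Z W Y : C.Ob) :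
    C.Hom X Z ⊗[k] (C.Hom Z W ⊗[k] C.Hom W Y) →ₗ[k] C.Mid₃ X Y :=
  DirectSum.lof k (C.Ob × C.Ob)
    (fun P => C.Hom X P.1 ⊗[k] (C.Hom P.1 P.2 ⊗[k] C.Hom P.2 Y)) (Z, W)

open scoped Classical in
/-- Linear maps out of `Mid₃`. -/
def GQuiver.desc₃ (C : GQuiver k) {X Y : C.Ob} {N : Type*} [AddCommGroup N] [Module k N]
    (t : ∀ Z W, C.Hom X Z ⊗[k] (C.Hom Z W ⊗[k] C.Hom W Y) →ₗ[k] N) : C.Mid₃ X Y →ₗ[k] N :=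
  DirectSum.toModule k (C.Ob × C.Ob) N fun P => t P.1 P.2

@[simp] theorem GQuiver.desc₃_incl₃ (C : GQuiver k) {X Y : C.Ob} {N : Type*} [AddCommGroup N]
    [Module k N] (t : ∀ Z W, C.Hom X Z ⊗[k] (C.Hom Z W ⊗[k] C.Hom W Y) →ₗ[k] N) (Z W : C.Ob)
    (x : C.Hom X Z ⊗[k] (C.Hom Z W ⊗[k] C.Hom W Y)) :
    C.desc₃ t (C.incl₃ X Z W Y x) = t Z W x := by
  classical
  exact DirectSum.toModule_lof k
    (M := fun P : C.Ob × C.Ob => C.Hom X P.1 ⊗[k] (C.Hom P.1 P.2 ⊗[k] C.Hom P.2 Y)) (Z, W) x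

/-- `a ⊗ ∑ b ⊗ c ↦ ∑ a ⊗ (b ⊗ c)`. -/
def GQuiver.mulLeft₃ (C : GQuiver k) (X Z Y : C.Ob) :
    C.Hom X Z ⊗[k] C.Mid Z Y →ₗ[k] C.Mid₃ X Y :=
  TensorProduct.lift (C.midDesc fun W =>
    (TensorProduct.curry (C.incl₃ X Z W Y)).flip).flip

@[simp] theorem GQuiver.mulLeft₃_tmul (C : GQuiver k) (X Z W Y : C.Ob) (a : C.Hom X Z)
    (t : C.Hom Z W ⊗[k] C.Hom W Y) :
    C.mulLeft₃ X Z Y (a ⊗ₜ C.midIncl Z W Y t) = C.incl₃ X Z W Y (a ⊗ₜ t) := by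
  simp [mulLeft₃]

/-- `(∑ a ⊗ b) ⊗ c ↦ ∑ a ⊗ (b ⊗ c)`. -/
def GQuiver.mulRight₃ (C : GQuiver k) (X W Y : C.Ob) :
    C.Mid X W ⊗[k] C.Hom W Y →ₗ[k] C.Mid₃ X Y :=
  TensorProduct.lift (C.midDesc fun Z =>
    TensorProduct.curry (C.incl₃ X Z W Y ∘ₗ (TensorProduct.assoc k _ _ _).toLinearMap))

@[simp] theorem GQuiver.mulRight₃_tmul (C : GQuiver k) (X Z W Y : C.Ob) (a : C.Hom X Z)
    (b : C.Hom Z W) (c : C.Hom W Y) :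
    C.mulRight₃ X W Y (C.midIncl X Z W (a ⊗ₜ b) ⊗ₜ c) = C.incl₃ X Z W Y (a ⊗ₜ (b ⊗ₜ c)) := by
  simp [mulRight₃]

/-- `1 ⊗ Δ`. -/
def Cocat.comulRight (C : Cocat k) (X Y : C.Ob) : C.Mid X Y →ₗ[k] C.Mid₃ X Y :=
  C.midDesc fun Z => C.mulLeft₃ X Z Y ∘ₗ LinearMap.lTensor _ (C.comul Z Y)

/-- `Δ ⊗ 1`. -/
def Cocat.comulLeft (C : Cocat k) (X Y : C.Ob) : C.Mid X Y →ₗ[k] C.Mid₃ X Y :=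
  C.midDesc fun W => C.mulRight₃ X W Y ∘ₗ LinearMap.rTensor _ (C.comul X W)

@[simp] theorem Cocat.comulRight_midIncl (C : Cocat k) (X Z Y : C.Ob) (a : C.Hom X Z)
    (b : C.Hom Z Y) : C.comulRight X Y (C.midIncl X Z Y (a ⊗ₜ b)) =
      C.mulLeft₃ X Z Y (a ⊗ₜ C.comul Z Y b) := by
  simp [comulRight]

@[simp] theorem Cocat.comulLeft_midIncl (C : Cocat k) (X Z Y : C.Ob) (a : C.Hom X Z)
    (b : C.Hom Z Y) : C.comulLeft X Y (C.midIncl X Z Y (a ⊗ₜ b)) =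
      C.mulRight₃ X Z Y (C.comul X Z a ⊗ₜ b) := by
  simp [comulLeft]

end Mid

/-! ### Conilpotent cocategories -/

section Conil

variable {k : Type u} [CommRing k]

/-- A weight on a coaugmented cocategory, which makes it coassociative, counital and conilpotent:
`W X Y n d` consists of elements of `C(X, Y)` of weight `n` and degree `d`. Generation by these
elements is all that is required, not a direct sum decomposition. The elements of weight
`0` are the multiples of the `1_X`, and `Δ` preserves the weight, where `Δ x - 1 ⊗ x` involves
positive weights only in the first factor, and `Δ x - x ⊗ 1` only in the second. Recursions along
`Δ` can then be solved by induction on the weight. -/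
structure Cocat.Conil (C : Cocat k) where
  W : ∀ X Y, ℕ → ℤ → Submodule k (C.Hom X Y)
  le_deg : ∀ X Y n d, W X Y n d ≤ (C.Hom X Y).deg d
  le_iSup : ∀ X Y d, (C.Hom X Y).deg d ≤ ⨆ n, W X Y n d
  one_mem : ∀ X, C.one X ∈ W X X 0 0
  weight_zero : ∀ X d, W X X 0 d ≤ Submodule.span k {C.one X}
  weight_zero_ne : ∀ X Y, X ≠ Y → ∀ d, W X Y 0 d = ⊥
  counit_one : ∀ X, C.counit X X (C.one X) = 1
  counit_pos : ∀ X Y n d x, 0 < n → x ∈ W X Y n d → C.counit X Y x = 0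
  comul_left : ∀ X Y n d x, x ∈ W X Y n d →
    C.comul X Y x - C.midIncl X X Y (C.one X ⊗ₜ x) ∈ C.midW W (fun i _ => 0 < i) X Y n d
  comul_right : ∀ X Y n d x, x ∈ W X Y n d →
    C.comul X Y x - C.midIncl X Y Y (x ⊗ₜ C.one Y) ∈ C.midW W (fun _ j => 0 < j) X Y n d
  coassoc : ∀ X Y x, C.comulLeft X Y (C.comul X Y x) = C.comulRight X Y (C.comul X Y x)

namespace Cocat.Conil

variable {C : Cocat k}

theorem induction (hC : C.Conil) {X Y : C.Ob} {p : C.Hom X Y → Prop} (zero : p 0)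
    (add : ∀ x y, p x → p y → p (x + y)) (mem : ∀ n d, ∀ x ∈ hC.W X Y n d, p x)
    (x : C.Hom X Y) : p x := by
  induction x using GMod.hom_induction with
  | zero => exact zero
  | add x y hx hy => exact add x y hx hy
  | mem d x hx =>
    have := hC.le_iSup X Y d hx
    clear hx
    induction this using Submodule.iSup_induction' with
    | zero => exact zero
    | add x y _ _ h1 h2 => exact add x y h1 h2
    | mem n x hx => exact mem n d x hx

theorem hom_ext (hC : C.Conil) {X Y : C.Ob} {N : Type*} [AddCommGroup N] [Module k N]
    {f g : C.Hom X Y →ₗ[k] N} (h : ∀ n d, ∀ x ∈ hC.W X Y n d, f x = g x) : f = g := by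
  refine LinearMap.ext fun x => ?_
  induction x using hC.induction with
  | zero => simp
  | add x y hx hy => simp [hx, hy]
  | mem n d x hx => exact h n d x hx

/-- A linear map vanishes on elements of weight `0` if it vanishes on the `1_X`. -/
theorem eq_zero_of_weight_zero (hC : C.Conil) {X Y : C.Ob} {N : Type*} [AddCommGroup N]
    [Module k N] (f : C.Hom X Y →ₗ[k] N) (hf : ∀ h : X = Y, f (h ▸ C.one X) = 0) {d : ℤ}
    {x : C.Hom X Y} (hx : x ∈ hC.W X Y 0 d) : f x = 0 := by
  by_cases h : X = Y
  · subst h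
    obtain ⟨c, rfl⟩ := Submodule.mem_span_singleton.mp (hC.weight_zero X d hx)
    rw [map_smul, hf rfl, smul_zero]
  · rw [hC.weight_zero_ne X Y h d] at hx
    rw [(Submodule.mem_bot k).mp hx, map_zero]

theorem eq_of_weight_zero (hC : C.Conil) {X Y : C.Ob} {N : Type*} [AddCommGroup N]
    [Module k N] (f g : C.Hom X Y →ₗ[k] N) (hf : ∀ h : X = Y, f (h ▸ C.one X) = g (h ▸ C.one X))
    {d : ℤ} {x : C.Hom X Y} (hx : x ∈ hC.W X Y 0 d) : f x = g x :=
  sub_eq_zero.mp (hC.eq_zero_of_weight_zero (f - g)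
    (fun h => by rw [LinearMap.sub_apply, hf h, sub_self]) hx)

theorem one_mem_deg (hC : C.Conil) (X : C.Ob) : C.one X ∈ (C.Hom X X).deg 0 :=
  hC.le_deg _ _ _ _ (hC.one_mem X)

theorem comul_mem (hC : C.Conil) {X Y : C.Ob} {n : ℕ} {d : ℤ} {x : C.Hom X Y}
    (hx : x ∈ hC.W X Y n d) : C.comul X Y x ∈ C.midW hC.W (fun _ _ => True) X Y n d := by
  have h1 := C.midW_mono (Q := fun _ _ => True) (by simp) X Y n d (hC.comul_left X Y n d x hx)
  have h2 := C.midW_mem (W := hC.W) (P := fun _ _ => True) trivial (hC.one_mem X) hx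
  rw [zero_add, zero_add] at h2
  simpa using add_mem h1 h2

/-- The `1_X` are grouplike: in weight `0` no tensor has a factor of positive weight. -/
theorem comul_one (hC : C.Conil) (X : C.Ob) :
    C.comul X X (C.one X) = C.midIncl X X X (C.one X ⊗ₜ C.one X) := by
  have := C.midW_map LinearMap.id ⊥ (fun Z i j p q h1 h2 => by omega)
    (hC.comul_left X X 0 0 _ (hC.one_mem X))
  exact sub_eq_zero.mp this

theorem counit_of_ne (hC : C.Conil) {X Y : C.Ob} (h : X ≠ Y) (x : C.Hom X Y) :
    C.counit X Y x = 0 := by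
  suffices h : C.counit X Y = 0 by rw [h]; rfl
  refine hC.hom_ext fun n d x hx => ?_
  obtain rfl | hn := n.eq_zero_or_pos
  · exact hC.eq_zero_of_weight_zero _ (fun e => absurd e h) hx
  · exact hC.counit_pos X Y n d x hn hx

theorem counit_of_deg (hC : C.Conil) {X Y : C.Ob} {d : ℤ} (hd : d ≠ 0) {x : C.Hom X Y}
    (hx : x ∈ (C.Hom X Y).deg d) : C.counit X Y x = 0 := by
  have := hC.le_iSup X Y d hx
  refine Submodule.iSup_induction (motive := fun x => C.counit X Y x = 0) _ this (fun n x hx => ?_)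
    (map_zero _) (fun x y hx hy => by rw [map_add, hx, hy, add_zero])
  obtain rfl | hn := n.eq_zero_or_pos
  · by_cases h : X = Y
    · subst h
      obtain ⟨c, rfl⟩ := Submodule.mem_span_singleton.mp (hC.weight_zero X d hx)
      rw [GMod.eq_zero_of_mem_mem _ hd (hC.le_deg _ _ _ _ hx)
        (Submodule.smul_mem _ c (hC.one_mem_deg X)), map_zero]
    · exact hC.counit_of_ne h x
  · exact hC.counit_pos X Y n d x hn hx

/-- The left counit law. -/
theorem counit_left (hC : C.Conil) {X Y : C.Ob} {N : Type*} [AddCommGroup N] [Module k N]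
    (t : C.Mid X Y →ₗ[k] N)
    (ht : ∀ Z a b, C.counit X Z a = 0 → t (C.midIncl X Z Y (a ⊗ₜ b)) = 0) (x : C.Hom X Y) :
    t (C.comul X Y x) = t (C.midIncl X X Y (C.one X ⊗ₜ x)) := by
  induction x using hC.induction with
  | zero => simp
  | add x y hx hy => simp [TensorProduct.tmul_add, hx, hy]
  | mem n d x hx =>
    have := C.midW_map t ⊥ (fun Z i j p q h1 h2 _ a ha b hb => by
      simpa using ht Z a b (hC.counit_pos _ _ _ _ a h1 ha)) (hC.comul_left X Y n d x hx)
    simpa [sub_eq_zero] using this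

/-- The right counit law. -/
theorem counit_right (hC : C.Conil) {X Y : C.Ob} {N : Type*} [AddCommGroup N] [Module k N]
    (t : C.Mid X Y →ₗ[k] N)
    (ht : ∀ Z a b, C.counit Z Y b = 0 → t (C.midIncl X Z Y (a ⊗ₜ b)) = 0) (x : C.Hom X Y) :
    t (C.comul X Y x) = t (C.midIncl X Y Y (x ⊗ₜ C.one Y)) := by
  induction x using hC.induction with
  | zero => simp
  | add x y hx hy => simp [TensorProduct.add_tmul, hx, hy]
  | mem n d x hx =>
    have := C.midW_map t ⊥ (fun Z i j p q h1 h2 _ a ha b hb => by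
      simpa using ht Z a b (hC.counit_pos _ _ _ _ b h1 hb)) (hC.comul_right X Y n d x hx)
    simpa [sub_eq_zero] using this

/-- The map `x ↦ (-1) ^ (n * deg x) x` is compatible with the comultiplication. -/
theorem comul_sgn (hC : C.Conil) {X Y : C.Ob} (m : ℤ) (x : C.Hom X Y) :
    C.comul X Y ((C.Hom X Y).sgn m x) =
      Fam.tens (D := C.toGQuiver) (f := fun X => X) (g := fun X => X) (h := fun X => X)
        (fun X Y => (C.Hom X Y).sgn m) (fun X Y => (C.Hom X Y).sgn m) X Y (C.comul X Y x) := by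
  induction x using hC.induction with
  | zero => simp
  | add x y hx hy => simp [hx, hy]
  | mem n d x hx =>
    rw [GMod.sgn_mem _ m (hC.le_deg _ _ _ _ hx), map_smul]
    refine (C.midW_eq (ksign k (m * d) • LinearMap.id) _ ?_ (hC.comul_mem hx))
    intro Z i j p q _ _ hpq a ha b hb
    rw [Fam.tens_midIncl, TensorProduct.map_tmul, GMod.sgn_mem _ m (hC.le_deg _ _ _ _ ha),
      GMod.sgn_mem _ m (hC.le_deg _ _ _ _ hb), TensorProduct.smul_tmul_smul, ← ksign_add, map_smul,
      ← hpq, mul_add]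
    rfl

/-- Coassociativity, in the form `∑ t(x' ⊗ (x'' ⊗ x''')) = ∑ Q(x' ⊗ x'') = ∑ P(x' ⊗ x'')` where
`P` and `Q` are obtained from `t` by applying `Δ` to the second and to the first factor. -/
theorem coassoc_apply (hC : C.Conil) {X Y : C.Ob} {N : Type*} [AddCommGroup N] [Module k N]
    (t : ∀ Z W, C.Hom X Z ⊗[k] (C.Hom Z W ⊗[k] C.Hom W Y) →ₗ[k] N) (P Q : C.Mid X Y →ₗ[k] N)
    (hP : ∀ Z a b, P (C.midIncl X Z Y (a ⊗ₜ b)) =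
      C.midDesc (fun W => t Z W ∘ₗ TensorProduct.mk k _ _ a) (C.comul Z Y b))
    (hQ : ∀ W a b, Q (C.midIncl X W Y (a ⊗ₜ b)) =
      C.midDesc (fun Z => t Z W ∘ₗ (TensorProduct.assoc k _ _ _).toLinearMap ∘ₗ
        (TensorProduct.mk k _ _).flip b) (C.comul X W a)) (x : C.Hom X Y) :
    P (C.comul X Y x) = Q (C.comul X Y x) := by
  have h1 : P = C.desc₃ t ∘ₗ C.comulRight X Y := by
    refine C.mid_ext fun Z a b => ?_
    rw [hP, LinearMap.comp_apply, C.comulRight_midIncl]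
    suffices h : C.midDesc (fun W => t Z W ∘ₗ TensorProduct.mk k _ _ a) =
      C.desc₃ t ∘ₗ C.mulLeft₃ X Z Y ∘ₗ TensorProduct.mk k _ _ a from LinearMap.congr_fun h _
    exact C.mid_ext fun W a b => by simp
  have h2 : Q = C.desc₃ t ∘ₗ C.comulLeft X Y := by
    refine C.mid_ext fun W a b => ?_
    rw [hQ, LinearMap.comp_apply, C.comulLeft_midIncl]
    suffices h : C.midDesc (fun Z => t Z W ∘ₗ (TensorProduct.assoc k _ _ _).toLinearMap ∘ₗ
        (TensorProduct.mk k _ _).flip b) =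
      C.desc₃ t ∘ₗ C.mulRight₃ X W Y ∘ₗ (TensorProduct.mk k _ _).flip b from
        LinearMap.congr_fun h _
    exact C.mid_ext fun W a b => by simp
  rw [h1, h2, LinearMap.comp_apply, LinearMap.comp_apply, hC.coassoc]

end Cocat.Conil

end Conil

/-! ### The tensor cocategory -/

section TensorCocat

variable {k : Type u} [CommRing k]

theorem GMod.incl_mem {ι : Type w} (M : ι → GMod.{u, v} k) (i : ι) {d : ℤ} {x : M i}
    (hx : x ∈ (M i).deg d) : incl M i x ∈ (directSum M).deg d := by
  classical
  have h : ∀ j, (DirectSum.lof k ι (fun i => M i) i x) j ∈ (M j).deg d := by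
    intro j
    rw [DirectSum.lof_eq_of]
    by_cases h : j = i
    · subst h; rwa [DirectSum.of_eq_same]
    · rw [DirectSum.of_eq_of_ne _ _ _ h]; exact zero_mem _
  intro j
  convert h j
  rw [incl]
  congr!

theorem GMod.directSum_deg_le {ι : Type w} (M : ι → GMod.{u, v} k) (d : ℤ) :
    (directSum M).deg d ≤ ⨆ i, ((M i).deg d).map (incl M i) := by
  classical
  have h : ∀ i (y : M i), incl M i y = (DirectSum.lof k ι (fun i => M i) i y : ⨁ i, M i) := by
    intro i y
    rw [incl]
    congr!
  have key : ∀ x : ⨁ i, M i, (∀ i, x i ∈ (M i).deg d) →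
      (x : directSum M) ∈ ⨆ i, ((M i).deg d).map (incl M i) := by
    intro x hx
    rw [← DirectSum.sum_support_of x]
    refine Submodule.sum_mem (⨆ i, ((M i).deg d).map (incl M i)) fun i _ =>
      Submodule.mem_iSup_of_mem i ⟨_, hx i, h i _⟩
  exact fun x hx => key x hx

theorem GMod.directSum_tensor_ext {ι : Type w} {M : ι → GMod.{u, v} k} {N : ι → GMod.{u, v} k}
    {P : Type*} [AddCommGroup P] [Module k P]
    {f g : directSum (fun i => (M i).tensor (N i)) →ₗ[k] P}
    (h : ∀ i a p, f (incl (fun i => (M i).tensor (N i)) i (a ⊗ₜ p)) =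
      g (incl (fun i => (M i).tensor (N i)) i (a ⊗ₜ p))) : f = g := by
  refine GMod.directSum_ext fun i x => ?_
  induction x using TensorProduct.induction_on with
  | zero => simp
  | add x y hx hy => rw [map_add, map_add, map_add, hx, hy]
  | tmul a p => exact h i a p

theorem GMod.directSum_unit_ext {ι : Type w} {P : Type*} [AddCommGroup P] [Module k P]
    {f g : directSum (fun _ : ι => GMod.unit k) →ₗ[k] P}
    (h : ∀ i, f (incl (fun _ : ι => GMod.unit k) i (1 : k)) =
      g (incl (fun _ : ι => GMod.unit k) i (1 : k))) : f = g := by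
  refine GMod.directSum_ext fun i => ?_
  suffices f ∘ₗ incl (fun _ : ι => GMod.unit k) i = g ∘ₗ incl (fun _ : ι => GMod.unit k) i from
    LinearMap.congr_fun this
  exact LinearMap.ext_ring (h i)

theorem GMod.directSum_tensor_deg_le {ι : Type w} {M : ι → GMod.{u, v} k} {N : ι → GMod.{u, v} k}
    (d : ℤ) {S : Submodule k (directSum (fun i => (M i).tensor (N i)))}
    (h : ∀ i p q, p + q = d → ∀ a ∈ (M i).deg p, ∀ b ∈ (N i).deg q,
      incl (fun i => (M i).tensor (N i)) i (a ⊗ₜ b) ∈ S) :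
    (directSum (fun i => (M i).tensor (N i))).deg d ≤ S := by
  refine (directSum_deg_le _ d).trans (iSup_le fun i => ?_)
  rw [Submodule.map_le_iff_le_comap]
  refine Submodule.span_le.mpr ?_
  rintro _ ⟨p, q, hpq, a, ha, b, hb, rfl⟩
  exact h i p q hpq a ha b hb

namespace GQuiver

variable (A : GQuiver k)

theorem pow_zero_ext {X Y : A.Ob} {N : Type*} [AddCommGroup N] [Module k N]
    {f g : A.pow 0 X Y →ₗ[k] N} (h : ∀ e : X = Y, f (e ▸ A.powOne X) = g (e ▸ A.powOne X)) :
    f = g := by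
  refine GMod.directSum_unit_ext (ι := PLift (X = Y)) fun e => ?_
  obtain ⟨e⟩ := e
  subst e
  exact h rfl

theorem pow_succ_ext {n : ℕ} {X Y : A.Ob} {N : Type*} [AddCommGroup N] [Module k N]
    {f g : A.pow (n + 1) X Y →ₗ[k] N}
    (h : ∀ Z a p, f (A.powCons n X Z Y a p) = g (A.powCons n X Z Y a p)) : f = g :=
  GMod.directSum_tensor_ext (M := fun Z => A.Hom X Z) (N := fun Z => A.pow n Z Y) h

theorem tHom_hom_ext {X Y : A.Ob} {N : Type*} [AddCommGroup N] [Module k N]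
    {f g : A.tHom X Y →ₗ[k] N} (h : ∀ n p, f (A.tIncl n X Y p) = g (A.tIncl n X Y p)) : f = g :=
  GMod.directSum_ext (M := fun n => A.pow n X Y) h

/-- Linear maps out of `T A (X, Y)` which agree on `1_X` and on all `a ⊗ t` are equal. -/
theorem tHom_ext {X Y : A.Ob} {N : Type*} [AddCommGroup N] [Module k N]
    {f g : A.tHom X Y →ₗ[k] N} (h0 : ∀ e : X = Y, f (e ▸ A.tOne X) = g (e ▸ A.tOne X))
    (h1 : ∀ Z a n p, f (A.cons X Z Y a (A.tIncl n Z Y p)) =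
      g (A.cons X Z Y a (A.tIncl n Z Y p))) : f = g := by
  refine A.tHom_hom_ext fun n p => ?_
  cases n with
  | zero =>
    suffices h : f ∘ₗ A.tIncl 0 X Y = g ∘ₗ A.tIncl 0 X Y from LinearMap.congr_fun h p
    refine A.pow_zero_ext fun e => ?_
    subst e
    exact h0 rfl
  | succ n =>
    suffices h : f ∘ₗ A.tIncl (n + 1) X Y = g ∘ₗ A.tIncl (n + 1) X Y from LinearMap.congr_fun h p
    refine A.pow_succ_ext fun Z a p => ?_
    simpa [cons_tIncl] using h1 Z a n p

theorem tIncl_mem {n : ℕ} {X Y : A.Ob} {d : ℤ} {p : A.pow n X Y} (hp : p ∈ (A.pow n X Y).deg d) :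
    A.tIncl n X Y p ∈ (A.tHom X Y).deg d :=
  GMod.incl_mem (fun n => A.pow n X Y) n hp

theorem powOne_mem (X : A.Ob) : A.powOne X ∈ (A.pow 0 X X).deg 0 :=
  GMod.incl_mem (fun _ : PLift (X = X) => GMod.unit k) _ (by simp)

theorem powCons_mem {n : ℕ} {X Z Y : A.Ob} {i j : ℤ} {a : A.Hom X Z}
    (ha : a ∈ (A.Hom X Z).deg i) {p : A.pow n Z Y} (hp : p ∈ (A.pow n Z Y).deg j) :
    A.powCons n X Z Y a p ∈ (A.pow (n + 1) X Y).deg (i + j) :=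
  GMod.incl_mem (fun Z => (A.Hom X Z).tensor (A.pow n Z Y)) Z (GMod.tmul_mem _ _ ha hp)

/-- The elements of `T A` of tensor degree `n` and degree `d`. -/
def tW (X Y : A.Ob) (n : ℕ) (d : ℤ) : Submodule k (A.tHom X Y) :=
  ((A.pow n X Y).deg d).map (A.tIncl n X Y)

theorem tOne_mem (X : A.Ob) : A.tOne X ∈ A.tW X X 0 0 := ⟨_, A.powOne_mem X, rfl⟩

theorem cons_mem {n : ℕ} {X Z Y : A.Ob} {i j : ℤ} {a : A.Hom X Z}
    (ha : a ∈ (A.Hom X Z).deg i) {t : A.tHom Z Y} (ht : t ∈ A.tW Z Y n j) :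
    A.cons X Z Y a t ∈ A.tW X Y (n + 1) (i + j) := by
  obtain ⟨p, hp, rfl⟩ := ht
  rw [cons_tIncl]
  exact ⟨_, A.powCons_mem ha hp, rfl⟩

theorem tW_le_deg (X Y : A.Ob) (n : ℕ) (d : ℤ) : A.tW X Y n d ≤ (A.tHom X Y).deg d := by
  rintro _ ⟨p, hp, rfl⟩; exact A.tIncl_mem hp

theorem deg_le_iSup_tW (X Y : A.Ob) (d : ℤ) : (A.tHom X Y).deg d ≤ ⨆ n, A.tW X Y n d :=
  GMod.directSum_deg_le (fun n => A.pow n X Y) d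

theorem cons_mem_deg {X Z Y : A.Ob} {i j : ℤ} {a : A.Hom X Z}
    (ha : a ∈ (A.Hom X Z).deg i) {t : A.tHom Z Y} (ht : t ∈ (A.tHom Z Y).deg j) :
    A.cons X Z Y a t ∈ (A.tHom X Y).deg (i + j) := by
  have : (⨆ n, A.tW Z Y n j) ≤ ((A.tHom X Y).deg (i + j)).comap (A.cons X Z Y a) :=
    iSup_le fun n t ht => A.tW_le_deg _ _ _ _ (A.cons_mem ha ht)
  exact this (A.deg_le_iSup_tW Z Y j ht)

theorem tW_zero (X : A.Ob) (d : ℤ) : A.tW X X 0 d ≤ Submodule.span k {A.tOne X} := by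
  have h : LinearMap.range (A.tIncl 0 X X) ≤ Submodule.span k {A.tOne X} := by
    rw [← Submodule.ker_mkQ (Submodule.span k {A.tOne X}), LinearMap.range_le_ker_iff]
    refine A.pow_zero_ext fun e => ?_
    exact (Submodule.Quotient.mk_eq_zero _).mpr (Submodule.mem_span_singleton_self (A.tOne X))
  rintro _ ⟨p, -, rfl⟩
  exact h ⟨p, rfl⟩

theorem tW_zero_ne (X Y : A.Ob) (h : X ≠ Y) (d : ℤ) : A.tW X Y 0 d = ⊥ := by
  rw [eq_bot_iff]
  rintro _ ⟨p, -, rfl⟩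
  have : A.tIncl 0 X Y = 0 := A.pow_zero_ext fun e => absurd e h
  rw [this]; simp

/-- Elements of positive tensor degree are sums of elements `a ⊗ t`. -/
theorem tW_succ_le {X Y : A.Ob} {n : ℕ} {d : ℤ} {S : Submodule k (A.tHom X Y)}
    (h : ∀ Z i j, i + j = d → ∀ a ∈ (A.Hom X Z).deg i, ∀ t ∈ A.tW Z Y n j, A.cons X Z Y a t ∈ S) :
    A.tW X Y (n + 1) d ≤ S := by
  rw [tW, Submodule.map_le_iff_le_comap]
  refine GMod.directSum_tensor_deg_le (M := fun Z => A.Hom X Z) (N := fun Z => A.pow n Z Y) d ?_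
  intro Z i j hij a ha p hp
  have := h Z i j hij a ha _ ⟨p, hp, rfl⟩
  rw [cons_tIncl] at this
  exact this

theorem T_comul_one (X : A.Ob) :
    A.T.comul X X (A.tOne X) = A.tq.midIncl X X X (A.tOne X ⊗ₜ A.tOne X) := by
  change A.tDesc _ (A.tIncl 0 X X (A.powOne X)) = _
  rw [tDesc_tIncl, powComul, powZeroDesc_powOne]

theorem consMid_midIncl (X W Z Y : A.Ob) (a : A.Hom X W) (t : A.tHom W Z) (t' : A.tHom Z Y) :
    A.consMid X W Y a (A.tq.midIncl W Z Y (t ⊗ₜ t')) =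
      A.tq.midIncl X Z Y (A.cons X W Z a t ⊗ₜ t') := by
  rw [consMid, LinearMap.flip_apply, midDesc_midIncl]
  rfl

theorem T_comul_cons (X Z Y : A.Ob) (a : A.Hom X Z) (t : A.tHom Z Y) :
    A.T.comul X Y (A.cons X Z Y a t) = A.tq.midIncl X X Y (A.tOne X ⊗ₜ A.cons X Z Y a t) +
      A.consMid X Z Y a (A.T.comul Z Y t) := by
  suffices h : A.T.comul X Y ∘ₗ A.cons X Z Y a =
      A.tq.midIncl X X Y ∘ₗ TensorProduct.mk k _ _ (A.tOne X) ∘ₗ A.cons X Z Y a +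
      A.consMid X Z Y a ∘ₗ A.T.comul Z Y from LinearMap.congr_fun h t
  refine A.tHom_hom_ext fun n p => ?_
  simp only [LinearMap.comp_apply, LinearMap.add_apply, tDesc_tIncl]
  rw [cons_tIncl, tDesc_tIncl, powComul, powSuccDesc_powCons, ← cons_tIncl]
  rfl

theorem T_counit_one (X : A.Ob) : A.T.counit X X (A.tOne X) = 1 := by
  change A.tDesc _ (A.tIncl 0 X X (A.powOne X)) = _
  rw [tDesc_tIncl, powCounit, powZeroDesc_powOne]

theorem T_counit_tIncl (X Y : A.Ob) (n : ℕ) (p : A.pow (n + 1) X Y) :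
    A.T.counit X Y (A.tIncl (n + 1) X Y p) = 0 := by
  change A.tDesc _ _ = _
  rw [tDesc_tIncl, powCounit]; rfl

theorem T_counit_cons (X Z Y : A.Ob) (a : A.Hom X Z) (t : A.tHom Z Y) :
    A.T.counit X Y (A.cons X Z Y a t) = 0 := by
  suffices h : A.T.counit X Y ∘ₗ A.cons X Z Y a = 0 from LinearMap.congr_fun h t
  refine A.tHom_hom_ext fun n p => ?_
  simp only [LinearMap.comp_apply, cons_tIncl]
  exact A.T_counit_tIncl _ _ _ _

/-- The induction is on the tensor degree, through `Δ(a ⊗ t) = 1 ⊗ (a ⊗ t) + ∑ (a ⊗ t') ⊗ t''`. -/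
theorem T_comul_left (n : ℕ) : ∀ (X Y : A.Ob) (d : ℤ), ∀ x ∈ A.tW X Y n d,
    A.T.comul X Y x - A.tq.midIncl X X Y (A.tOne X ⊗ₜ x) ∈
      A.tq.midW A.tW (fun i _ => 0 < i) X Y n d := by
  induction n with
  | zero =>
    intro X Y d x hx
    by_cases h : X = Y
    · subst h
      obtain ⟨c, rfl⟩ := Submodule.mem_span_singleton.mp (A.tW_zero X d hx)
      rw [map_smul, T_comul_one, TensorProduct.tmul_smul, map_smul, sub_self]
      exact zero_mem _
    · rw [A.tW_zero_ne X Y h d] at hx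
      rw [(Submodule.mem_bot k).mp hx, TensorProduct.tmul_zero, map_zero, map_zero, sub_zero]
      exact zero_mem _
  | succ n ih =>
    intro X Y d x hx
    let f := A.T.comul X Y - A.tq.midIncl X X Y ∘ₗ TensorProduct.mk k _ _ (A.tOne X)
    suffices h : A.tW X Y (n + 1) d ≤
        Submodule.comap f (A.tq.midW A.tW (fun i _ => 0 < i) X Y (n + 1) d) from h hx
    refine A.tW_succ_le fun Z i j hij a ha t ht => ?_
    change A.T.comul X Y _ - A.tq.midIncl X X Y (A.tOne X ⊗ₜ _) ∈
      A.tq.midW A.tW (fun i _ => 0 < i) X Y (n + 1) d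
    rw [T_comul_cons, add_sub_cancel_left]
    have h1 := ih Z Y j t ht
    have key : ∀ u ∈ A.tq.midW A.tW (fun _ _ => True) Z Y n j,
        A.consMid X Z Y a u ∈ A.tq.midW A.tW (fun i _ => 0 < i) X Y (n + 1) d := by
      intro u hu
      refine A.tq.midW_map _ _ (fun V i' j' p q _ h1 h2 b hb c hc => ?_) hu
      rw [consMid_midIncl]
      have := A.tq.midW_mem (P := fun i _ => 0 < i) (by omega) (A.cons_mem ha hb) hc
      rwa [show i' + 1 + j' = n + 1 by omega, show i + p + q = d by omega] at this
    have h2 : A.T.comul Z Y t ∈ A.tq.midW A.tW (fun _ _ => True) Z Y n j := by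
      have h3 := A.tq.midW_mono (Q := fun _ _ => True) (by simp) Z Y n j h1
      have h4 := A.tq.midW_mem (P := fun _ _ => True) trivial (A.tOne_mem Z) ht
      rw [zero_add, zero_add] at h4
      simpa using add_mem h3 h4
    exact key _ h2

theorem T_comul_right (n : ℕ) : ∀ (X Y : A.Ob) (d : ℤ), ∀ x ∈ A.tW X Y n d,
    A.T.comul X Y x - A.tq.midIncl X Y Y (x ⊗ₜ A.tOne Y) ∈
      A.tq.midW A.tW (fun _ j => 0 < j) X Y n d := by
  induction n with
  | zero =>
    intro X Y d x hx
    by_cases h : X = Y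
    · subst h
      obtain ⟨c, rfl⟩ := Submodule.mem_span_singleton.mp (A.tW_zero X d hx)
      rw [map_smul, T_comul_one, ← TensorProduct.smul_tmul', map_smul, sub_self]
      exact zero_mem _
    · rw [A.tW_zero_ne X Y h d] at hx
      rw [(Submodule.mem_bot k).mp hx, TensorProduct.zero_tmul, map_zero, map_zero, sub_zero]
      exact zero_mem _
  | succ n ih =>
    intro X Y d x hx
    let f := A.T.comul X Y - A.tq.midIncl X Y Y ∘ₗ (TensorProduct.mk k _ _).flip (A.tOne Y)
    suffices h : A.tW X Y (n + 1) d ≤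
        Submodule.comap f (A.tq.midW A.tW (fun _ j => 0 < j) X Y (n + 1) d) from h hx
    refine A.tW_succ_le fun Z i j hij a ha t ht => ?_
    change A.T.comul X Y _ - A.tq.midIncl X Y Y (_ ⊗ₜ A.tOne Y) ∈
      A.tq.midW A.tW (fun _ j => 0 < j) X Y (n + 1) d
    rw [T_comul_cons, add_sub_assoc, ← consMid_midIncl, ← map_sub]
    refine add_mem ?_ (A.tq.midW_map _ _ (fun V i' j' p q h0 h1 h2 b hb c hc => ?_) (ih Z Y j t ht))
    · have := A.tq.midW_mem (P := fun _ j => 0 < j) (by omega) (A.tOne_mem X) (A.cons_mem ha ht)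
      rwa [zero_add, zero_add, hij] at this
    · rw [consMid_midIncl]
      have := A.tq.midW_mem (P := fun _ j => 0 < j) h0 (A.cons_mem ha hb) hc
      rwa [show i' + 1 + j' = n + 1 by omega, show i + p + q = d by omega] at this

/-- Coassociativity of the cut comultiplication. In the step from `t` to `a ⊗ t`, both sides are
`1 ⊗ Δ(a ⊗ t)` plus the image of the identity for `t` under `a ⊗ -`. -/
theorem T_coassoc (X Y : A.Ob) (x : A.T.Hom X Y) :
    A.T.comulLeft X Y (A.T.comul X Y x) = A.T.comulRight X Y (A.T.comul X Y x) := by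
  suffices h : ∀ n X Y p, A.T.comulLeft X Y (A.T.comul X Y (A.tIncl n X Y p)) =
      A.T.comulRight X Y (A.T.comul X Y (A.tIncl n X Y p)) by
    suffices h' : A.T.comulLeft X Y ∘ₗ A.T.comul X Y = A.T.comulRight X Y ∘ₗ A.T.comul X Y from
      LinearMap.congr_fun h' x
    exact A.tHom_hom_ext fun n p => h n X Y p
  clear x X Y
  intro n
  induction n with
  | zero =>
    intro X Y p
    suffices h' : A.T.comulLeft X Y ∘ₗ A.T.comul X Y ∘ₗ A.tIncl 0 X Y =
        A.T.comulRight X Y ∘ₗ A.T.comul X Y ∘ₗ A.tIncl 0 X Y from LinearMap.congr_fun h' p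
    refine A.pow_zero_ext fun e => ?_
    subst e
    change A.T.comulLeft X X (A.T.comul X X (A.tOne X)) =
      A.T.comulRight X X (A.T.comul X X (A.tOne X))
    rw [T_comul_one, Cocat.comulLeft_midIncl, Cocat.comulRight_midIncl, T_comul_one,
      mulRight₃_tmul, mulLeft₃_tmul]
  | succ n ih =>
    intro X Y p
    suffices h' : A.T.comulLeft X Y ∘ₗ A.T.comul X Y ∘ₗ A.tIncl (n + 1) X Y =
        A.T.comulRight X Y ∘ₗ A.T.comul X Y ∘ₗ A.tIncl (n + 1) X Y from LinearMap.congr_fun h' p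
    refine A.pow_succ_ext fun Z a p => ?_
    simp only [LinearMap.comp_apply]
    rw [← cons_tIncl]
    specialize ih Z Y p
    generalize A.tIncl n Z Y p = t at ih
    -- `a ⊗ -` on `Mid₃`
    let c₃ : A.tq.Mid₃ Z Y →ₗ[k] A.tq.Mid₃ X Y := A.tq.desc₃ fun V W =>
      A.tq.incl₃ X V W Y ∘ₗ LinearMap.rTensor _ (A.cons X Z V a)
    have hR : A.T.comulRight X Y ∘ₗ A.consMid X Z Y a = c₃ ∘ₗ A.T.comulRight Z Y := by
      refine A.tq.mid_ext fun V b c => ?_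
      simp only [LinearMap.comp_apply]
      rw [consMid_midIncl, Cocat.comulRight_midIncl, Cocat.comulRight_midIncl]
      suffices h : A.tq.mulLeft₃ X V Y ∘ₗ TensorProduct.mk k _ _ (A.cons X Z V a b) =
        c₃ ∘ₗ A.tq.mulLeft₃ Z V Y ∘ₗ TensorProduct.mk k _ _ b from LinearMap.congr_fun h _
      refine A.tq.mid_ext fun W b c => ?_
      rw [LinearMap.comp_apply, LinearMap.comp_apply, LinearMap.comp_apply, TensorProduct.mk_apply,
        TensorProduct.mk_apply, mulLeft₃_tmul, mulLeft₃_tmul, desc₃_incl₃]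
      rfl
    have hL : ∀ u, A.T.comulLeft X Y (A.consMid X Z Y a u) =
        A.tq.mulLeft₃ X X Y (A.tOne X ⊗ₜ A.consMid X Z Y a u) + c₃ (A.T.comulLeft Z Y u) := by
      intro u
      suffices h : A.T.comulLeft X Y ∘ₗ A.consMid X Z Y a =
          A.tq.mulLeft₃ X X Y ∘ₗ TensorProduct.mk k _ _ (A.tOne X) ∘ₗ A.consMid X Z Y a +
            c₃ ∘ₗ A.T.comulLeft Z Y from LinearMap.congr_fun h u
      refine A.tq.mid_ext fun V b c => ?_
      simp only [LinearMap.comp_apply, LinearMap.add_apply, TensorProduct.mk_apply]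
      rw [consMid_midIncl, Cocat.comulLeft_midIncl, Cocat.comulLeft_midIncl, T_comul_cons,
        TensorProduct.add_tmul, map_add, mulRight₃_tmul, mulLeft₃_tmul]
      congr 1
      suffices h : A.tq.mulRight₃ X V Y ∘ₗ (TensorProduct.mk k _ _).flip c ∘ₗ A.consMid X Z V a =
        c₃ ∘ₗ A.tq.mulRight₃ Z V Y ∘ₗ (TensorProduct.mk k _ _).flip c from LinearMap.congr_fun h _
      refine A.tq.mid_ext fun W b c => ?_
      simp only [LinearMap.comp_apply, LinearMap.flip_apply, TensorProduct.mk_apply]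
      rw [consMid_midIncl, mulRight₃_tmul, mulRight₃_tmul, desc₃_incl₃]
      rfl
    rw [T_comul_cons, map_add, map_add, Cocat.comulLeft_midIncl, Cocat.comulRight_midIncl,
      T_comul_one, T_comul_cons, hL, ih, TensorProduct.tmul_add, map_add, mulRight₃_tmul,
      mulLeft₃_tmul, add_assoc]
    congr 2
    exact (LinearMap.congr_fun hR _).symm

/-- Tensor cocategories are conilpotent, the weight being the tensor degree. -/
def conil : A.T.Conil where
  W := A.tW
  le_deg := A.tW_le_deg
  le_iSup := A.deg_le_iSup_tW
  one_mem := A.tOne_mem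
  weight_zero := A.tW_zero
  weight_zero_ne := A.tW_zero_ne
  counit_one := A.T_counit_one
  counit_pos := by
    rintro X Y n d _ hn ⟨p, -, rfl⟩
    obtain ⟨n, rfl⟩ := Nat.exists_eq_succ_of_ne_zero hn.ne'
    exact A.T_counit_tIncl X Y n p
  comul_left X Y n d x hx := A.T_comul_left n X Y d x hx
  comul_right X Y n d x hx := A.T_comul_right n X Y d x hx
  coassoc := A.T_coassoc

end GQuiver

end TensorCocat

/-! ### Tensor products of conilpotent cocategories -/

section TensorProducts

variable {k : Type u} [CommRing k]

open scoped Classical in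
/-- The map `(x' ⊗ x'') ⊗ (y' ⊗ y'') ↦ ± (x' ⊗ y') ⊗ (x'' ⊗ y'')` which occurs in the
comultiplication of a tensor product. -/
def midShuffle (C D : GQuiver k) (X Y : C.Ob × D.Ob) :
    C.Mid X.1 Y.1 ⊗[k] D.Mid X.2 Y.2 →ₗ[k] (C.tensor D).Mid X Y :=
  (DirectSum.toModule k (C.Ob × D.Ob) ((C.tensor D).Mid X Y) fun Z =>
      (C.tensor D).midIncl X Z Y ∘ₗ
        GMod.midSwap (C.Hom X.1 Z.1) (C.Hom Z.1 Y.1) (D.Hom X.2 Z.2) (D.Hom Z.2 Y.2)) ∘ₗ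
    (TensorProduct.directSum k k (fun Z : C.Ob => C.Hom X.1 Z ⊗[k] C.Hom Z Y.1)
      (fun Z : D.Ob => D.Hom X.2 Z ⊗[k] D.Hom Z Y.2)).toLinearMap

theorem tensor_comul_tmul (C D : Cocat k) (X Y : C.Ob × D.Ob) (x : C.Hom X.1 Y.1)
    (y : D.Hom X.2 Y.2) : (C.tensor D).comul X Y (x ⊗ₜ y) =
      midShuffle C.toGQuiver D.toGQuiver X Y (C.comul X.1 Y.1 x ⊗ₜ D.comul X.2 Y.2 y) := rfl

open scoped Classical in
theorem midShuffle_tmul (C D : GQuiver k) (X Y : C.Ob × D.Ob) (Z : C.Ob) (W : D.Ob)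
    (s : C.Hom X.1 Z ⊗[k] C.Hom Z Y.1) (t : D.Hom X.2 W ⊗[k] D.Hom W Y.2) :
    midShuffle C D X Y (C.midIncl X.1 Z Y.1 s ⊗ₜ D.midIncl X.2 W Y.2 t) =
      (C.tensor D).midIncl X (Z, W) Y (GMod.midSwap _ _ _ _ (s ⊗ₜ t)) := by
  have h : (TensorProduct.directSum k k (fun Z : C.Ob => C.Hom X.1 Z ⊗[k] C.Hom Z Y.1)
      (fun Z : D.Ob => D.Hom X.2 Z ⊗[k] D.Hom Z Y.2)).toLinearMap
      (C.midIncl X.1 Z Y.1 s ⊗ₜ D.midIncl X.2 W Y.2 t) =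
      DirectSum.lof k (C.Ob × D.Ob) (fun P => (C.Hom X.1 P.1 ⊗[k] C.Hom P.1 Y.1) ⊗[k]
        (D.Hom X.2 P.2 ⊗[k] D.Hom P.2 Y.2)) (Z, W) (s ⊗ₜ t) := by
    exact TensorProduct.directSum_lof_tmul_lof k
      (M₁ := fun Z : C.Ob => C.Hom X.1 Z ⊗[k] C.Hom Z Y.1)
      (M₂ := fun Z : D.Ob => D.Hom X.2 Z ⊗[k] D.Hom Z Y.2) k Z s W t
  have h' := DirectSum.toModule_lof k (M := fun P : C.Ob × D.Ob =>
    (C.Hom X.1 P.1 ⊗[k] C.Hom P.1 Y.1) ⊗[k] (D.Hom X.2 P.2 ⊗[k] D.Hom P.2 Y.2))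
    (φ := fun Z => (C.tensor D).midIncl X Z Y ∘ₗ
        GMod.midSwap (C.Hom X.1 Z.1) (C.Hom Z.1 Y.1) (D.Hom X.2 Z.2) (D.Hom Z.2 Y.2))
    (Z, W) (s ⊗ₜ t)
  rw [← h] at h'
  exact h'

/-- `midShuffle` on homogeneous elements, with the sign of the symmetry. -/
theorem midShuffle_hom (C D : GQuiver k) (X Y : C.Ob × D.Ob) (Z : C.Ob) (W : D.Ob)
    (x : C.Hom X.1 Z) {x' : C.Hom Z Y.1} {y : D.Hom X.2 W} (y' : D.Hom W Y.2) {i j : ℤ}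
    (hx : x' ∈ (C.Hom Z Y.1).deg i) (hy : y ∈ (D.Hom X.2 W).deg j) :
    midShuffle C D X Y (C.midIncl X.1 Z Y.1 (x ⊗ₜ x') ⊗ₜ D.midIncl X.2 W Y.2 (y ⊗ₜ y')) =
      ksign k (i * j) • (C.tensor D).midIncl X (Z, W) Y ((x ⊗ₜ y) ⊗ₜ (x' ⊗ₜ y')) := by
  rw [midShuffle_tmul, GMod.midSwap_mem _ _ _ _ x y' hx hy, map_smul]

/-- The analogue of `midSwap` for three factors. -/
def swap₃ (M₁ M₂ M₃ N₁ N₂ N₃ : GMod.{u, u} k) :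
    (M₁ ⊗[k] (M₂ ⊗[k] M₃)) ⊗[k] (N₁ ⊗[k] (N₂ ⊗[k] N₃)) →ₗ[k]
      (M₁ ⊗[k] N₁) ⊗[k] ((M₂ ⊗[k] N₂) ⊗[k] (M₃ ⊗[k] N₃)) :=
  LinearMap.lTensor _ (GMod.midSwap M₂ M₃ N₂ N₃) ∘ₗ
    GMod.midSwap M₁ (M₂.tensor M₃) N₁ (N₂.tensor N₃)

theorem swap₃_mem (M₁ M₂ M₃ N₁ N₂ N₃ : GMod.{u, u} k) {a b c d : ℤ} (x₁ : M₁) {x₂ : M₂} {x₃ : M₃}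
    {y₁ : N₁} {y₂ : N₂} (y₃ : N₃) (hx₂ : x₂ ∈ M₂.deg a) (hx₃ : x₃ ∈ M₃.deg b)
    (hy₁ : y₁ ∈ N₁.deg c) (hy₂ : y₂ ∈ N₂.deg d) :
    swap₃ M₁ M₂ M₃ N₁ N₂ N₃ ((x₁ ⊗ₜ (x₂ ⊗ₜ x₃)) ⊗ₜ (y₁ ⊗ₜ (y₂ ⊗ₜ y₃))) =
      ksign k ((a + b) * c + b * d) • ((x₁ ⊗ₜ y₁) ⊗ₜ ((x₂ ⊗ₜ y₂) ⊗ₜ (x₃ ⊗ₜ y₃))) := by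
  rw [swap₃, LinearMap.comp_apply]
  have h := GMod.midSwap_mem M₁ (M₂.tensor M₃) N₁ (N₂.tensor N₃) x₁ (y₂ ⊗ₜ y₃)
    (GMod.tmul_mem _ _ hx₂ hx₃) hy₁
  rw [h, map_smul, LinearMap.lTensor_tmul, GMod.midSwap_mem _ _ _ _ x₂ y₃ hx₃ hy₂,
    TensorProduct.tmul_smul, smul_smul, ksign_add]

/-- The analogue of `midShuffle` for three factors. -/
def shuffle₃ (C D : GQuiver k) (X Y : C.Ob × D.Ob) :
    C.Mid₃ X.1 Y.1 ⊗[k] D.Mid₃ X.2 Y.2 →ₗ[k] (C.tensor D).Mid₃ X Y :=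
  TensorProduct.lift (C.desc₃ fun Z W => (D.desc₃ fun Z' W' =>
    (TensorProduct.curry ((C.tensor D).incl₃ X (Z, Z') (W, W') Y ∘ₗ
      swap₃ _ _ _ _ _ _)).flip).flip)

theorem shuffle₃_hom (C D : GQuiver k) (X Y : C.Ob × D.Ob) (Z W : C.Ob) (Z' W' : D.Ob)
    {a b c d : ℤ} (x₁ : C.Hom X.1 Z) {x₂ : C.Hom Z W} {x₃ : C.Hom W Y.1} {y₁ : D.Hom X.2 Z'}
    {y₂ : D.Hom Z' W'} (y₃ : D.Hom W' Y.2) (hx₂ : x₂ ∈ (C.Hom Z W).deg a)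
    (hx₃ : x₃ ∈ (C.Hom W Y.1).deg b) (hy₁ : y₁ ∈ (D.Hom X.2 Z').deg c)
    (hy₂ : y₂ ∈ (D.Hom Z' W').deg d) :
    shuffle₃ C D X Y (C.incl₃ X.1 Z W Y.1 (x₁ ⊗ₜ (x₂ ⊗ₜ x₃)) ⊗ₜ
        D.incl₃ X.2 Z' W' Y.2 (y₁ ⊗ₜ (y₂ ⊗ₜ y₃))) =
      ksign k ((a + b) * c + b * d) • (C.tensor D).incl₃ X (Z, Z') (W, W') Y
        ((x₁ ⊗ₜ y₁) ⊗ₜ ((x₂ ⊗ₜ y₂) ⊗ₜ (x₃ ⊗ₜ y₃))) := by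
  rw [shuffle₃, TensorProduct.lift.tmul, GQuiver.desc₃_incl₃, LinearMap.flip_apply,
    GQuiver.desc₃_incl₃, LinearMap.flip_apply, TensorProduct.curry_apply, LinearMap.comp_apply,
    swap₃_mem _ _ _ _ _ _ x₁ y₃ hx₂ hx₃ hy₁ hy₂, map_smul]

variable {C D : Cocat k}

/-- `Δ ⊗ 1` is compatible with the interchange of factors; both sides have the sign of the same
permutation of six factors. -/
theorem comulLeft_midShuffle (hD : D.Conil) (X Y : C.Ob × D.Ob)
    (u : C.Mid X.1 Y.1) (v : D.Mid X.2 Y.2) :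
    (C.tensor D).comulLeft X Y (midShuffle C.toGQuiver D.toGQuiver X Y (u ⊗ₜ v)) =
      shuffle₃ C.toGQuiver D.toGQuiver X Y (C.comulLeft X.1 Y.1 u ⊗ₜ D.comulLeft X.2 Y.2 v) := by
  suffices h : (C.tensor D).comulLeft X Y ∘ₗ midShuffle C.toGQuiver D.toGQuiver X Y =
      shuffle₃ C.toGQuiver D.toGQuiver X Y ∘ₗ
        TensorProduct.map (C.comulLeft X.1 Y.1) (D.comulLeft X.2 Y.2) from
    LinearMap.congr_fun h (u ⊗ₜ v)
  clear u v
  refine TensorProduct.ext (C.mid_hom_ext fun Z _ x₁ _ i x₂ hx₂ => D.mid_ext fun W y₁ y₂ => ?_)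
  change (C.tensor D).comulLeft X Y (midShuffle C.toGQuiver D.toGQuiver X Y
      (C.midIncl X.1 Z Y.1 (x₁ ⊗ₜ x₂) ⊗ₜ D.midIncl X.2 W Y.2 (y₁ ⊗ₜ y₂))) =
    shuffle₃ C.toGQuiver D.toGQuiver X Y (C.comulLeft X.1 Y.1 (C.midIncl X.1 Z Y.1 (x₁ ⊗ₜ x₂)) ⊗ₜ
      D.comulLeft X.2 Y.2 (D.midIncl X.2 W Y.2 (y₁ ⊗ₜ y₂)))
  rw [C.comulLeft_midIncl, D.comulLeft_midIncl]
  induction y₁ using hD.induction with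
  | zero => simp only [TensorProduct.zero_tmul, TensorProduct.tmul_zero, map_zero]
  | add y y' h h' =>
    simp only [TensorProduct.add_tmul, TensorProduct.tmul_add, map_add] at h h' ⊢
    rw [h, h']
  | mem n d y₁ hy =>
    rw [midShuffle_hom _ _ X Y Z W x₁ y₂ hx₂ (hD.le_deg _ _ _ _ hy), map_smul]
    refine Eq.trans (congrArg _ (Cocat.comulLeft_midIncl (C.tensor D) X (Z, W) Y _ _)) ?_
    rw [tensor_comul_tmul]
    have hv := hD.comul_mem hy
    generalize D.comul X.2 W y₁ = v at hv
    generalize C.comul X.1 Z x₁ = u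
    induction hv using Submodule.span_induction with
    | zero => simp only [TensorProduct.zero_tmul, TensorProduct.tmul_zero, map_zero, smul_zero]
    | add y y' _ _ h h' =>
      simp only [TensorProduct.add_tmul, TensorProduct.tmul_add, map_add, smul_add] at h h' ⊢
      rw [h, h']
    | smul c y _ h =>
      simp only [TensorProduct.tmul_smul, ← TensorProduct.smul_tmul', map_smul]
      rw [smul_comm, h]
    | mem _ h =>
      obtain ⟨V, i', j', p, q, -, -, hpq, y', hy', y'', hy'', rfl⟩ := h
      induction u using C.mid_induction with
      | zero => simp only [TensorProduct.zero_tmul, map_zero, smul_zero]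
      | add y y' h h' =>
        simp only [TensorProduct.add_tmul, map_add, smul_add] at h h' ⊢
        rw [h, h']
      | mem U _ x _ e x' hx' =>
        rw [midShuffle_hom _ _ X (Z, W) U V x y'' hx' (hD.le_deg _ _ _ _ hy'),
          ← TensorProduct.smul_tmul', map_smul]
        refine Eq.trans (congrArg _ (congrArg _ (GQuiver.mulRight₃_tmul (C.tensor D).toGQuiver
          X (U, V) (Z, W) Y _ _ _))) ?_
        rw [GQuiver.mulRight₃_tmul, GQuiver.mulRight₃_tmul, shuffle₃_hom _ _ X Y U Z V W x y₂ hx'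
          hx₂ (hD.le_deg _ _ _ _ hy') (hD.le_deg _ _ _ _ hy''), smul_smul, ← ksign_add, ← hpq]
        congr 2
        ring

/-- The counterpart of `comulLeft_midShuffle` for `1 ⊗ Δ`. -/
theorem comulRight_midShuffle (hC : C.Conil) (X Y : C.Ob × D.Ob)
    (u : C.Mid X.1 Y.1) (v : D.Mid X.2 Y.2) :
    (C.tensor D).comulRight X Y (midShuffle C.toGQuiver D.toGQuiver X Y (u ⊗ₜ v)) =
      shuffle₃ C.toGQuiver D.toGQuiver X Y (C.comulRight X.1 Y.1 u ⊗ₜ D.comulRight X.2 Y.2 v) := by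
  suffices h : (C.tensor D).comulRight X Y ∘ₗ midShuffle C.toGQuiver D.toGQuiver X Y =
      shuffle₃ C.toGQuiver D.toGQuiver X Y ∘ₗ
        TensorProduct.map (C.comulRight X.1 Y.1) (D.comulRight X.2 Y.2) from
    LinearMap.congr_fun h (u ⊗ₜ v)
  clear u v
  refine TensorProduct.ext (C.mid_ext fun Z x₁ x₂ => D.mid_hom_ext fun W j y₁ hy₁ _ y₂ _ => ?_)
  change (C.tensor D).comulRight X Y (midShuffle C.toGQuiver D.toGQuiver X Y
      (C.midIncl X.1 Z Y.1 (x₁ ⊗ₜ x₂) ⊗ₜ D.midIncl X.2 W Y.2 (y₁ ⊗ₜ y₂))) =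
    shuffle₃ C.toGQuiver D.toGQuiver X Y (C.comulRight X.1 Y.1 (C.midIncl X.1 Z Y.1 (x₁ ⊗ₜ x₂)) ⊗ₜ
      D.comulRight X.2 Y.2 (D.midIncl X.2 W Y.2 (y₁ ⊗ₜ y₂)))
  rw [C.comulRight_midIncl, D.comulRight_midIncl]
  induction x₂ using hC.induction with
  | zero => simp only [TensorProduct.zero_tmul, TensorProduct.tmul_zero, map_zero]
  | add y y' h h' =>
    simp only [TensorProduct.add_tmul, TensorProduct.tmul_add, map_add] at h h' ⊢
    rw [h, h']
  | mem n d x₂ hx =>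
    rw [midShuffle_hom _ _ X Y Z W x₁ y₂ (hC.le_deg _ _ _ _ hx) hy₁, map_smul]
    refine Eq.trans (congrArg _ (Cocat.comulRight_midIncl (C.tensor D) X (Z, W) Y _ _)) ?_
    rw [tensor_comul_tmul]
    have hu := hC.comul_mem hx
    generalize C.comul Z Y.1 x₂ = u at hu
    generalize D.comul W Y.2 y₂ = v
    induction hu using Submodule.span_induction with
    | zero => simp only [TensorProduct.zero_tmul, TensorProduct.tmul_zero, map_zero, smul_zero]
    | add y y' _ _ h h' =>
      simp only [TensorProduct.add_tmul, TensorProduct.tmul_add, map_add, smul_add] at h h' ⊢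
      rw [h, h']
    | smul c y _ h =>
      simp only [TensorProduct.tmul_smul, ← TensorProduct.smul_tmul', map_smul]
      rw [smul_comm, h]
    | mem _ h =>
      obtain ⟨V, i', j', p, q, -, -, hpq, x', hx', x'', hx'', rfl⟩ := h
      induction v using D.mid_induction with
      | zero => simp only [TensorProduct.tmul_zero, map_zero, smul_zero]
      | add y y' h h' =>
        simp only [TensorProduct.tmul_add, map_add, smul_add] at h h' ⊢
        rw [h, h']
      | mem U e y hy _ y' _ =>
        rw [midShuffle_hom _ _ (Z, W) Y V U x' y' (hC.le_deg _ _ _ _ hx'') hy,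
          TensorProduct.tmul_smul, map_smul]
        refine Eq.trans (congrArg _ (congrArg _ (GQuiver.mulLeft₃_tmul (C.tensor D).toGQuiver
          X (Z, W) (V, U) Y _ _))) ?_
        rw [GQuiver.mulLeft₃_tmul, GQuiver.mulLeft₃_tmul, shuffle₃_hom _ _ X Y Z V W U x₁ y'
          (hC.le_deg _ _ _ _ hx') (hC.le_deg _ _ _ _ hx'') hy₁ hy, smul_smul, ← ksign_add, ← hpq]

theorem tensor_coassoc (hC : C.Conil) (hD : D.Conil) (X Y : C.Ob × D.Ob)
    (z : (C.tensor D).Hom X Y) : (C.tensor D).comulLeft X Y ((C.tensor D).comul X Y z) =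
      (C.tensor D).comulRight X Y ((C.tensor D).comul X Y z) := by
  induction z using TensorProduct.induction_on with
  | zero => simp only [map_zero]
  | add z z' h h' => simp only [map_add] at h h' ⊢; rw [h, h']
  | tmul x y =>
    rw [tensor_comul_tmul, comulLeft_midShuffle hD, comulRight_midShuffle hC, hC.coassoc,
      hD.coassoc]

/-- The elements of weight `n` and degree `d` of a tensor product. -/
def tensorW (WC : ∀ X Y, ℕ → ℤ → Submodule k (C.Hom X Y))
    (WD : ∀ X Y, ℕ → ℤ → Submodule k (D.Hom X Y)) (X Y : C.Ob × D.Ob) (n : ℕ) (d : ℤ) :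
    Submodule k (C.Hom X.1 Y.1 ⊗[k] D.Hom X.2 Y.2) :=
  Submodule.span k {t | ∃ i j p q, i + j = n ∧ p + q = d ∧
    ∃ x ∈ WC X.1 Y.1 i p, ∃ y ∈ WD X.2 Y.2 j q, x ⊗ₜ y = t}

theorem tensorW_mem {WC : ∀ X Y, ℕ → ℤ → Submodule k (C.Hom X Y)}
    {WD : ∀ X Y, ℕ → ℤ → Submodule k (D.Hom X Y)} {X Y : C.Ob × D.Ob} {i j : ℕ} {p q : ℤ}
    {x : C.Hom X.1 Y.1} (hx : x ∈ WC X.1 Y.1 i p) {y : D.Hom X.2 Y.2} (hy : y ∈ WD X.2 Y.2 j q) :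
    x ⊗ₜ[k] y ∈ tensorW WC WD X Y (i + j) (p + q) :=
  Submodule.subset_span ⟨i, j, p, q, rfl, rfl, x, hx, y, hy, rfl⟩

/-- The interchange of factors adds weights and degrees in each position. -/
theorem midShuffle_mem (hC : C.Conil) (hD : D.Conil) {P P' P'' : ℕ → ℕ → Prop}
    (hP : ∀ i j i' j', P i j → P' i' j' → P'' (i + i') (j + j')) {X Y : C.Ob × D.Ob} {n n' : ℕ}
    {d d' : ℤ} {u : C.Mid X.1 Y.1} (hu : u ∈ C.midW hC.W P X.1 Y.1 n d) {v : D.Mid X.2 Y.2}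
    (hv : v ∈ D.midW hD.W P' X.2 Y.2 n' d') :
    midShuffle C.toGQuiver D.toGQuiver X Y (u ⊗ₜ v) ∈
      (C.tensor D).midW (tensorW hC.W hD.W) P'' X Y (n + n') (d + d') := by
  refine C.midW_map (midShuffle C.toGQuiver D.toGQuiver X Y ∘ₗ (TensorProduct.mk k _ _).flip v) _
    (fun Z i j p q h1 h2 h3 a ha b hb => ?_) hu
  refine D.midW_map (midShuffle C.toGQuiver D.toGQuiver X Y ∘ₗ TensorProduct.mk k _ _
    (C.midIncl X.1 Z Y.1 (a ⊗ₜ b))) _ (fun Z' i' j' p' q' h1' h2' h3' a' ha' b' hb' => ?_) hv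
  rw [LinearMap.comp_apply, TensorProduct.mk_apply, midShuffle_hom _ _ X Y Z Z' a b'
    (hC.le_deg _ _ _ _ hb) (hD.le_deg _ _ _ _ ha')]
  refine Submodule.smul_mem _ _ ?_
  have := (C.tensor D).midW_mem (W := tensorW hC.W hD.W) (X := X) (Y := Y) (Z := (Z, Z'))
    (hP i j i' j' h1 h1') (tensorW_mem ha ha') (tensorW_mem hb hb')
  rwa [show i + i' + (j + j') = n + n' by omega, show p + p' + (q + q') = d + d' by omega] at this

theorem tensorW_le {WC : ∀ X Y, ℕ → ℤ → Submodule k (C.Hom X Y)}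
    {WD : ∀ X Y, ℕ → ℤ → Submodule k (D.Hom X Y)} {X Y : C.Ob × D.Ob} {n : ℕ} {d : ℤ}
    {S : Submodule k (C.Hom X.1 Y.1 ⊗[k] D.Hom X.2 Y.2)}
    (h : ∀ i j p q, i + j = n → p + q = d → ∀ x ∈ WC X.1 Y.1 i p, ∀ y ∈ WD X.2 Y.2 j q,
      x ⊗ₜ y ∈ S) : tensorW WC WD X Y n d ≤ S := by
  refine Submodule.span_le.mpr ?_
  rintro _ ⟨i, j, p, q, h1, h2, x, hx, y, hy, rfl⟩
  exact h i j p q h1 h2 x hx y hy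

/-- The tensor product of conilpotent cocategories is conilpotent. -/
def Cocat.Conil.tensor (hC : C.Conil) (hD : D.Conil) : (C.tensor D).Conil where
  W := tensorW hC.W hD.W
  le_deg X Y n d := tensorW_le fun i j p q _ h2 x hx y hy => by
    have := GMod.tmul_mem _ _ (hC.le_deg _ _ _ _ hx) (hD.le_deg _ _ _ _ hy)
    rwa [h2] at this
  le_iSup X Y d := by
    refine Submodule.span_le.mpr ?_
    rintro _ ⟨p, q, h, x, hx, y, hy, rfl⟩
    have h1 : (⨆ i, hC.W X.1 Y.1 i p) ≤
        (⨆ n, tensorW hC.W hD.W X Y n d).comap ((TensorProduct.mk k _ _).flip y) := by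
      refine iSup_le fun i x hx => ?_
      have h2 : (⨆ j, hD.W X.2 Y.2 j q) ≤
          (⨆ n, tensorW hC.W hD.W X Y n d).comap (TensorProduct.mk k _ _ x) := by
        refine iSup_le fun j y hy => Submodule.mem_iSup_of_mem (i + j) ?_
        have := tensorW_mem (X := X) (Y := Y) hx hy
        rwa [h] at this
      exact h2 (hD.le_iSup _ _ _ hy)
    exact h1 (hC.le_iSup _ _ _ hx)
  one_mem X := by
    have := tensorW_mem (X := X) (Y := X) (hC.one_mem X.1) (hD.one_mem X.2)
    rwa [add_zero, add_zero] at this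
  weight_zero X d := tensorW_le fun i j p q h1 _ x hx y hy => by
    obtain ⟨rfl, rfl⟩ : i = 0 ∧ j = 0 := by omega
    obtain ⟨a, rfl⟩ := Submodule.mem_span_singleton.mp (hC.weight_zero _ _ hx)
    obtain ⟨b, rfl⟩ := Submodule.mem_span_singleton.mp (hD.weight_zero _ _ hy)
    rw [TensorProduct.smul_tmul_smul]
    exact Submodule.smul_mem _ _ (Submodule.mem_span_singleton_self _)
  weight_zero_ne X Y hne d := by
    refine eq_bot_iff.mpr (tensorW_le fun i j p q h1 _ x hx y hy => ?_)
    obtain ⟨rfl, rfl⟩ : i = 0 ∧ j = 0 := by omega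
    by_cases h : X.1 = Y.1
    · have h' : X.2 ≠ Y.2 := fun h' => hne (Prod.ext h h')
      rw [hD.weight_zero_ne _ _ h'] at hy
      rw [(Submodule.mem_bot k).mp hy, TensorProduct.tmul_zero]
      exact zero_mem _
    · rw [hC.weight_zero_ne _ _ h] at hx
      rw [(Submodule.mem_bot k).mp hx, TensorProduct.zero_tmul]
      exact zero_mem _
  counit_one X := by
    change LinearMap.mul' k k (C.counit _ _ (C.one _) ⊗ₜ D.counit _ _ (D.one _)) = 1
    rw [hC.counit_one, hD.counit_one, LinearMap.mul'_apply, mul_one]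
  counit_pos X Y n d z hn hz := by
    suffices h : tensorW hC.W hD.W X Y n d ≤ LinearMap.ker ((C.tensor D).counit X Y) from h hz
    refine tensorW_le fun i j p q h1 _ x hx y hy => ?_
    change LinearMap.mul' k k (C.counit _ _ x ⊗ₜ D.counit _ _ y) = 0
    rw [LinearMap.mul'_apply]
    obtain hi | hj : 0 < i ∨ 0 < j := by omega
    · rw [hC.counit_pos _ _ _ _ x hi hx, zero_mul]
    · rw [hD.counit_pos _ _ _ _ y hj hy, mul_zero]
  comul_left X Y n d z hz := by
    suffices h : tensorW hC.W hD.W X Y n d ≤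
        ((C.tensor D).midW (tensorW hC.W hD.W) (fun i _ => 0 < i) X Y n d).comap
          ((C.tensor D).comul X Y - (C.tensor D).midIncl X X Y ∘ₗ
            TensorProduct.mk k _ _ ((C.tensor D).one X)) from h hz
    refine tensorW_le fun i j p q h1 h2 x hx y hy => ?_
    have e := midShuffle_hom C.toGQuiver D.toGQuiver X Y X.1 X.2 (C.one X.1) y
      (hC.le_deg _ _ _ _ hx) (hD.one_mem_deg X.2)
    rw [mul_zero, ksign_zero, one_smul] at e
    change (C.tensor D).comul X Y (x ⊗ₜ y) -
      (C.tensor D).midIncl X X Y ((C.one X.1 ⊗ₜ D.one X.2) ⊗ₜ (x ⊗ₜ y)) ∈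
        (C.tensor D).midW (tensorW hC.W hD.W) (fun i _ => 0 < i) X Y n d
    rw [← e, tensor_comul_tmul]
    have hu := midShuffle_mem hC hD (P'' := fun i _ => 0 < i) (fun i j i' j' h _ => by omega)
      (hC.comul_left _ _ _ _ x hx) (hD.comul_mem hy)
    have hv := midShuffle_mem hC hD (P'' := fun i _ => 0 < i) (fun i j i' j' _ h => by omega)
      (C.midW_mem (P := fun _ _ => True) trivial (hC.one_mem X.1) hx)
      (hD.comul_left _ _ _ _ y hy)
    rw [zero_add, zero_add, h1, h2] at hv
    rw [h1, h2] at hu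
    rw [TensorProduct.sub_tmul, map_sub] at hu
    rw [TensorProduct.tmul_sub, map_sub] at hv
    simpa only [sub_add_sub_cancel] using add_mem hu hv
  comul_right X Y n d z hz := by
    suffices h : tensorW hC.W hD.W X Y n d ≤
        ((C.tensor D).midW (tensorW hC.W hD.W) (fun _ j => 0 < j) X Y n d).comap
          ((C.tensor D).comul X Y - (C.tensor D).midIncl X Y Y ∘ₗ
            (TensorProduct.mk k _ _).flip ((C.tensor D).one Y)) from h hz
    refine tensorW_le fun i j p q h1 h2 x hx y hy => ?_
    have e := midShuffle_hom C.toGQuiver D.toGQuiver X Y Y.1 Y.2 x (D.one Y.2)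
      (hC.one_mem_deg Y.1) (hD.le_deg _ _ _ _ hy)
    rw [zero_mul, ksign_zero, one_smul] at e
    change (C.tensor D).comul X Y (x ⊗ₜ y) -
      (C.tensor D).midIncl X Y Y ((x ⊗ₜ y) ⊗ₜ (C.one Y.1 ⊗ₜ D.one Y.2)) ∈
        (C.tensor D).midW (tensorW hC.W hD.W) (fun _ j => 0 < j) X Y n d
    rw [← e, tensor_comul_tmul]
    have hu := midShuffle_mem hC hD (P'' := fun _ j => 0 < j) (fun i j i' j' h _ => by omega)
      (hC.comul_right _ _ _ _ x hx) (hD.comul_mem hy)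
    have hv := midShuffle_mem hC hD (P'' := fun _ j => 0 < j) (fun i j i' j' _ h => by omega)
      (C.midW_mem (P := fun _ _ => True) trivial hx (hC.one_mem Y.1))
      (hD.comul_right _ _ _ _ y hy)
    rw [add_zero, add_zero, h1, h2] at hv
    rw [h1, h2] at hu
    rw [TensorProduct.sub_tmul, map_sub] at hu
    rw [TensorProduct.tmul_sub, map_sub] at hv
    simpa only [sub_add_sub_cancel] using add_mem hu hv
  coassoc := tensor_coassoc hC hD

end TensorProducts

/-! ### Maps into tensor cocategories -/

section Cofree

variable {k : Type u} [CommRing k]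

/-- Composition of `r ⊗ s` with `r' ⊗ s'`, for maps without signs. -/
theorem Fam.tens_comp {C D E : GQuiver k} {f g h : C.Ob → D.Ob} {f' g' h' : D.Ob → E.Ob}
    (r : Fam C D f g) (s : Fam C D g h) (r' : Fam D E f' g') (s' : Fam D E g' h')
    (X Y : C.Ob) (u : C.Mid X Y) :
    r'.tens s' (f X) (h Y) (r.tens s X Y u) =
      Fam.tens (D := E) (f := fun X => f' (f X)) (g := fun X => g' (g X)) (h := fun X => h' (h X))
        (fun X Y => r' (f X) (g Y) ∘ₗ r X Y) (fun X Y => s' (g X) (h Y) ∘ₗ s X Y) X Y u := by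
  suffices e : r'.tens s' (f X) (h Y) ∘ₗ r.tens s X Y =
      Fam.tens (D := E) (f := fun X => f' (f X)) (g := fun X => g' (g X)) (h := fun X => h' (h X))
        (fun X Y => r' (f X) (g Y) ∘ₗ r X Y) (fun X Y => s' (g X) (h Y) ∘ₗ s X Y) X Y from
    LinearMap.congr_fun e u
  exact C.mid_ext fun Z x y => by simp

/-- A linear map which vanishes in positive weights vanishes on the kernel of the counit. -/
theorem Cocat.Conil.eq_zero_of_counit {C : Cocat k} (hC : C.Conil) {X Y : C.Ob} {N : Type*}
    [AddCommGroup N] [Module k N] (f : C.Hom X Y →ₗ[k] N)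
    (hf : ∀ n d, 0 < n → ∀ x ∈ hC.W X Y n d, f x = 0) {x : C.Hom X Y}
    (hx : C.counit X Y x = 0) : f x = 0 := by
  by_cases h : X = Y
  · subst h
    have : f = (C.counit X X).smulRight (f (C.one X)) := by
      refine hC.hom_ext fun n d x hx => ?_
      obtain rfl | hn := n.eq_zero_or_pos
      · exact hC.eq_of_weight_zero f _ (fun h => by simp [hC.counit_one]) hx
      · simp [hf n d hn x hx, hC.counit_pos _ _ _ _ x hn hx]
    rw [this, LinearMap.smulRight_apply, hx, zero_smul]
  · have : f = 0 := by
      refine hC.hom_ext fun n d x hx => ?_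
      obtain rfl | hn := n.eq_zero_or_pos
      · exact hC.eq_of_weight_zero f 0 (fun e => absurd e h) hx
      · exact hf n d hn x hx
    rw [this]; rfl

open scoped Classical in
/-- The maps `x ↦ ε(x) 1`. -/
def Cocat.unitFam (C D : Cocat k) (o : C.Ob → D.Ob) : Fam C.toGQuiver D.toGQuiver o o :=
  fun X Y => if h : X = Y then
    (C.counit X Y).smulRight (h ▸ D.one (o X) : D.Hom (o X) (o Y)) else 0

theorem Cocat.unitFam_self (C D : Cocat k) (o : C.Ob → D.Ob) (X : C.Ob) (x : C.Hom X X) :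
    C.unitFam D o X X x = C.counit X X x • D.one (o X) := by
  rw [unitFam, dif_pos rfl]; rfl

theorem Cocat.unitFam_of_counit (C D : Cocat k) (o : C.Ob → D.Ob) {X Y : C.Ob} {x : C.Hom X Y}
    (h : C.counit X Y x = 0) : C.unitFam D o X Y x = 0 := by
  rw [unitFam]
  split_ifs with e
  · rw [LinearMap.smulRight_apply, h, zero_smul]
  · rfl

theorem Cocat.Conil.unitFam_one {C : Cocat k} (hC : C.Conil) (D : Cocat k) (o : C.Ob → D.Ob)
    (X : C.Ob) : C.unitFam D o X X (C.one X) = D.one (o X) := by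
  rw [unitFam_self, hC.counit_one, one_smul]

namespace GQuiver

variable (B : GQuiver k)

theorem pr₁_one (X : B.Ob) : B.pr₁ X X (B.tOne X) = 0 := by
  rw [pr₁, tOne, tDesc_tIncl, powPr₁]; rfl

theorem pr₁_cons_one (X Z : B.Ob) (a : B.Hom X Z) :
    B.pr₁ X Z (B.cons X Z Z a (B.tOne Z)) = a := by
  rw [pr₁, tOne, cons_tIncl, tDesc_tIncl, powPr₁, powSuccDesc_powCons, LinearMap.flip_apply,
    powZeroDesc_powOne]
  rfl

theorem pr₁_cons_tIncl (X Z Y : B.Ob) (a : B.Hom X Z) (n : ℕ) (p : B.pow (n + 1) Z Y) :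
    B.pr₁ X Y (B.cons X Z Y a (B.tIncl (n + 1) Z Y p)) = 0 := by
  rw [pr₁, cons_tIncl, tDesc_tIncl, powPr₁]; rfl

theorem pr₁_cons_of_counit (X Z Y : B.Ob) (a : B.Hom X Z) {t : B.tHom Z Y}
    (ht : B.T.counit Z Y t = 0) : B.pr₁ X Y (B.cons X Z Y a t) = 0 := by
  refine B.conil.eq_zero_of_counit (B.pr₁ X Y ∘ₗ B.cons X Z Y a) ?_ ht
  rintro n d hn _ ⟨p, -, rfl⟩
  obtain ⟨n, rfl⟩ := Nat.exists_eq_succ_of_ne_zero hn.ne'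
  exact B.pr₁_cons_tIncl X Z Y a n p

theorem pr₁_mem {X Y : B.Ob} {d : ℤ} {t : B.tHom X Y} (ht : t ∈ (B.tHom X Y).deg d) :
    B.pr₁ X Y t ∈ (B.Hom X Y).deg d := by
  suffices h : ⨆ n, B.tW X Y n d ≤ ((B.Hom X Y).deg d).comap (B.pr₁ X Y) from
    h (B.deg_le_iSup_tW X Y d ht)
  refine iSup_le fun n => ?_
  cases n with
  | zero =>
    intro t ht
    have : B.pr₁ X Y t = 0 := B.conil.eq_zero_of_weight_zero (B.pr₁ X Y)
      (fun e => by subst e; exact B.pr₁_one X) ht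
    rw [Submodule.mem_comap, this]; exact zero_mem _
  | succ n =>
    refine B.tW_succ_le fun Z i j hij a ha t ht => ?_
    rw [Submodule.mem_comap]
    cases n with
    | zero =>
      by_cases e : Z = Y
      · subst e
        obtain ⟨c, rfl⟩ := Submodule.mem_span_singleton.mp (B.tW_zero Z j ht)
        rw [map_smul, map_smul, pr₁_cons_one]
        by_cases hj : j = 0
        · subst hj; rw [add_zero] at hij; rw [← hij]; exact Submodule.smul_mem _ c ha
        · have hc := GMod.eq_zero_of_mem_mem _ hj (B.tW_le_deg _ _ _ _ ht)
            (Submodule.smul_mem _ c (B.conil.one_mem_deg Z))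
          have := congrArg (B.T.counit Z Z) hc
          rw [map_smul, T_counit_one, map_zero, smul_eq_mul, mul_one] at this
          rw [this, zero_smul]; exact zero_mem _
      · rw [B.tW_zero_ne Z Y e] at ht
        rw [(Submodule.mem_bot k).mp ht, map_zero, map_zero]; exact zero_mem _
    | succ n =>
      obtain ⟨p, -, rfl⟩ := ht
      rw [pr₁_cons_tIncl]; exact zero_mem _

end GQuiver

variable {C : Cocat k} {B : GQuiver k}

/-- `x ⊗ y ↦ (x) b ⊗ (y) G`, with values in `T B`. -/
def consMap {f g h : C.Ob → B.Ob} (b : Fam C.toGQuiver B f g)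
    (G : Fam C.toGQuiver B.T.toGQuiver g h) (X Y : C.Ob) : C.Mid X Y →ₗ[k] B.tHom (f X) (h Y) :=
  C.midDesc fun Z => TensorProduct.lift (B.cons (f X) (g Z) (h Y)) ∘ₗ
    TensorProduct.map (b X Z) (G Z Y)

theorem consMap_midIncl {f g h : C.Ob → B.Ob} (b : Fam C.toGQuiver B f g)
    (G : Fam C.toGQuiver B.T.toGQuiver g h) (X Z Y : C.Ob) (x : C.Hom X Z) (y : C.Hom Z Y) :
    consMap b G X Y (C.midIncl X Z Y (x ⊗ₜ y)) = B.cons _ _ _ (b X Z x) (G Z Y y) := by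
  rw [consMap, GQuiver.midDesc_midIncl, LinearMap.comp_apply, TensorProduct.map_tmul,
    TensorProduct.lift.tmul]

/-- The convolution product `x ↦ ∑ (x') b ⊗ (x'') G`. -/
def consConv {f g h : C.Ob → B.Ob} (b : Fam C.toGQuiver B f g)
    (G : Fam C.toGQuiver B.T.toGQuiver g h) : Fam C.toGQuiver B.T.toGQuiver f h :=
  fun X Y => consMap b G X Y ∘ₗ C.comul X Y

theorem consMap_sub_right {f g h : C.Ob → B.Ob} (b : Fam C.toGQuiver B f g)
    (G G' : Fam C.toGQuiver B.T.toGQuiver g h) (X Y : C.Ob) :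
    consMap b (G - G') X Y = consMap b G X Y - consMap b G' X Y := by
  refine C.mid_ext fun Z x y => ?_
  rw [LinearMap.sub_apply, consMap_midIncl, consMap_midIncl, consMap_midIncl]
  exact map_sub _ _ _

theorem consConv_sub_right {f g h : C.Ob → B.Ob} (b : Fam C.toGQuiver B f g)
    (G G' : Fam C.toGQuiver B.T.toGQuiver g h) :
    consConv b (G - G') = consConv b G - consConv b G' := by
  funext X Y
  rw [consConv, consMap_sub_right]; rfl

namespace Cocat.Conil

/-- Two convolution products agree on elements of weight `n` if the factors agree in weight `< n`
and `b` vanishes on the `1_X`. -/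
theorem consConv_congr (hC : C.Conil) {f g : C.Ob → B.Ob} {b : Fam C.toGQuiver B f f}
    (hb : ∀ X, b X X (C.one X) = 0) {G G' : Fam C.toGQuiver B.T.toGQuiver f g} {n : ℕ}
    (h : ∀ j < n, ∀ X Y q, ∀ x ∈ hC.W X Y j q, G X Y x = G' X Y x) {X Y : C.Ob} {d : ℤ}
    {x : C.Hom X Y} (hx : x ∈ hC.W X Y n d) : consConv b G X Y x = consConv b G' X Y x := by
  refine C.midW_eq (consMap b G X Y) (consMap b G' X Y) ?_ (hC.comul_mem hx)
  intro Z i j p q _ hij _ a ha c hc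
  rw [consMap_midIncl, consMap_midIncl]
  obtain rfl | hi := i.eq_zero_or_pos
  · rw [hC.eq_zero_of_weight_zero (b X Z) (fun e => by subst e; exact hb X) ha, map_zero]; rfl
  · rw [h j (by omega) Z Y q c hc]

/-- The recursion `(x)h = ∑ (x') b ⊗ (x'') h` has only the zero solution, if `b` vanishes on the
`1_X`: the value in weight `n` depends on the values in smaller weights only. -/
theorem eq_zero_of_rec (hC : C.Conil) {f g : C.Ob → B.Ob} {b : Fam C.toGQuiver B f f}
    (hb : ∀ X, b X X (C.one X) = 0) {h : Fam C.toGQuiver B.T.toGQuiver f g}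
    (hh : h = consConv b h) : h = 0 := by
  have key : ∀ n X Y d, ∀ x ∈ hC.W X Y n d, h X Y x = 0 := by
    intro n
    induction n using Nat.strong_induction_on with
    | _ n ih =>
      intro X Y d x hx
      rw [hh, hC.consConv_congr hb (G' := 0) ih hx]
      have : consMap b (0 : Fam C.toGQuiver B.T.toGQuiver f g) X Y = 0 := by
        have := consMap_sub_right b (0 : Fam C.toGQuiver B.T.toGQuiver f g) 0 X Y
        rwa [sub_self, sub_self] at this
      rw [consConv, this]; rfl
  funext X Y
  exact hC.hom_ext fun n d x hx => key n X Y d x hx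

/-- Coassociativity for products of maps to `T B`: with `Δ` applied to the second factor,
`∑ (x') b ⊗ ((x'') G ⊗ (x''') H)` equals `∑ ((x') b ⊗ (x'') G) ⊗ (x''') H`. -/
theorem consMid_coassoc (hC : C.Conil) {f g h l : C.Ob → B.Ob} (b : Fam C.toGQuiver B f g)
    (G : Fam C.toGQuiver B.T.toGQuiver g h) (H : Fam C.toGQuiver B.T.toGQuiver h l) (X Y : C.Ob)
    (x : C.Hom X Y) :
    C.midDesc (fun Z => TensorProduct.lift (B.consMid (f X) (g Z) (l Y)) ∘ₗ
        TensorProduct.map (b X Z) (G.tens H Z Y ∘ₗ C.comul Z Y)) (C.comul X Y x) =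
      (consConv b G).tens H X Y (C.comul X Y x) := by
  refine hC.coassoc_apply (fun Z W => TensorProduct.lift (B.consMid (f X) (g Z) (l Y)) ∘ₗ
    TensorProduct.map (b X Z) (B.tq.midIncl (g Z) (h W) (l Y) ∘ₗ
      TensorProduct.map (G Z W) (H W Y))) _ _ (fun Z a c => ?_) (fun W a c => ?_) x
  · rw [GQuiver.midDesc_midIncl, LinearMap.comp_apply, TensorProduct.map_tmul,
      TensorProduct.lift.tmul, LinearMap.comp_apply]
    suffices e : B.consMid (f X) (g Z) (l Y) (b X Z a) ∘ₗ G.tens H Z Y =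
        C.midDesc (fun W => (TensorProduct.lift (B.consMid (f X) (g Z) (l Y)) ∘ₗ
          TensorProduct.map (b X Z) (B.tq.midIncl (g Z) (h W) (l Y) ∘ₗ
            TensorProduct.map (G Z W) (H W Y))) ∘ₗ TensorProduct.mk k _ _ a) from
      LinearMap.congr_fun e _
    refine C.mid_ext fun W y z => ?_
    rw [LinearMap.comp_apply, Fam.tens_midIncl, GQuiver.midDesc_midIncl]
    rfl
  · rw [Fam.tens_midIncl, TensorProduct.map_tmul]
    suffices e : B.tq.midIncl (f X) (h W) (l Y) ∘ₗ (TensorProduct.mk k _ _).flip (H W Y c) ∘ₗ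
          consMap b G X W =
        C.midDesc (fun Z => (TensorProduct.lift (B.consMid (f X) (g Z) (l Y)) ∘ₗ
          TensorProduct.map (b X Z) (B.tq.midIncl (g Z) (h W) (l Y) ∘ₗ
            TensorProduct.map (G Z W) (H W Y))) ∘ₗ (TensorProduct.assoc k _ _ _).toLinearMap ∘ₗ
              (TensorProduct.mk k _ _).flip c) from LinearMap.congr_fun e _
    refine C.mid_ext fun Z y z => ?_
    rw [LinearMap.comp_apply, LinearMap.comp_apply, consMap_midIncl, GQuiver.midDesc_midIncl]
    exact (B.consMid_midIncl (f X) (g Z) (h W) (l Y) _ _ _).symm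

/-- The recursion for the cut comultiplication, applied to the values of `consMap b G`. -/
theorem comul_consMap {f g h : C.Ob → B.Ob} (b : Fam C.toGQuiver B f g)
    (G : Fam C.toGQuiver B.T.toGQuiver g h) (X Y : C.Ob) (v : C.Mid X Y) :
    B.T.comul _ _ (consMap b G X Y v) =
      B.tq.midIncl _ _ _ (B.tOne (f X) ⊗ₜ consMap b G X Y v) +
      C.midDesc (fun Z => TensorProduct.lift (B.consMid (f X) (g Z) (h Y)) ∘ₗ
        TensorProduct.map (b X Z) (B.T.comul _ _ ∘ₗ G Z Y)) v := by
  suffices e : B.T.comul _ _ ∘ₗ consMap b G X Y =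
      B.tq.midIncl _ _ _ ∘ₗ TensorProduct.mk k _ _ (B.tOne (f X)) ∘ₗ consMap b G X Y +
      C.midDesc (fun Z => TensorProduct.lift (B.consMid (f X) (g Z) (h Y)) ∘ₗ
        TensorProduct.map (b X Z) (B.T.comul _ _ ∘ₗ G Z Y)) from LinearMap.congr_fun e v
  refine C.mid_ext fun Z x y => ?_
  rw [LinearMap.add_apply, GQuiver.midDesc_midIncl, LinearMap.comp_apply, LinearMap.comp_apply,
    LinearMap.comp_apply, consMap_midIncl, B.T_comul_cons]
  rfl

/-- The analogue of `consConv_congr` for maps `G` to `T B ⊗ T B`: on elements of weight `n`, the sum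
`∑ (x') b ⊗ (x'') G` depends only on `G` in weights less than `n`, if `b` vanishes on the `1_X`. -/
theorem consMid_congr (hC : C.Conil) {f g : C.Ob → B.Ob} {b : Fam C.toGQuiver B f f}
    (hb : ∀ X, b X X (C.one X) = 0)
    {G G' : ∀ X Y : C.Ob, C.Hom X Y →ₗ[k] B.tq.Mid (f X) (g Y)} {n : ℕ}
    (h : ∀ j < n, ∀ X Y q, ∀ x ∈ hC.W X Y j q, G X Y x = G' X Y x) {X Y : C.Ob} {d : ℤ}
    {x : C.Hom X Y} (hx : x ∈ hC.W X Y n d) :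
    C.midDesc (fun Z => TensorProduct.lift (B.consMid (f X) (f Z) (g Y)) ∘ₗ
        TensorProduct.map (b X Z) (G Z Y)) (C.comul X Y x) =
      C.midDesc (fun Z => TensorProduct.lift (B.consMid (f X) (f Z) (g Y)) ∘ₗ
        TensorProduct.map (b X Z) (G' Z Y)) (C.comul X Y x) := by
  refine C.midW_eq _ _ ?_ (hC.comul_mem hx)
  intro Z i j p q _ hij _ a ha c hc
  rw [GQuiver.midDesc_midIncl, GQuiver.midDesc_midIncl, LinearMap.comp_apply, LinearMap.comp_apply,
    TensorProduct.map_tmul, TensorProduct.map_tmul]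
  obtain rfl | hi := i.eq_zero_or_pos
  · rw [hC.eq_zero_of_weight_zero (b X Z) (fun e => by subst e; exact hb X) ha,
      TensorProduct.zero_tmul, TensorProduct.zero_tmul]
  · rw [h j (by omega) Z Y q c hc]

theorem unitFam_tens (hC : C.Conil) {f g : C.Ob → B.Ob} (G : Fam C.toGQuiver B.T.toGQuiver f g)
    (X Y : C.Ob) (x : C.Hom X Y) :
    (C.unitFam B.T f).tens G X Y (C.comul X Y x) =
      B.tq.midIncl _ _ _ (B.tOne (f X) ⊗ₜ G X Y x) := by
  rw [hC.counit_left _ (fun Z a c ha => ?_), Fam.tens_midIncl, TensorProduct.map_tmul,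
    hC.unitFam_one]
  rw [Fam.tens_midIncl, TensorProduct.map_tmul, unitFam_of_counit _ _ _ ha,
    TensorProduct.zero_tmul, map_zero]

theorem comul_unitFam (f : C.Ob → B.Ob) (X Y : C.Ob) (x : C.Hom X Y) :
    B.T.comul _ _ (C.unitFam B.T f X Y x) =
      B.tq.midIncl _ _ _ (B.tOne (f X) ⊗ₜ C.unitFam B.T f X Y x) := by
  by_cases e : X = Y
  · subst e
    rw [unitFam_self, map_smul, B.T_comul_one, TensorProduct.tmul_smul, map_smul]
  · rw [unitFam, dif_neg e, LinearMap.zero_apply, map_zero, TensorProduct.tmul_zero, map_zero]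

theorem counit_consConv {f g h : C.Ob → B.Ob} (b : Fam C.toGQuiver B f g)
    (G : Fam C.toGQuiver B.T.toGQuiver g h) (X Y : C.Ob) (x : C.Hom X Y) :
    B.T.counit _ _ (consConv b G X Y x) = 0 := by
  suffices e : B.T.counit _ _ ∘ₗ consMap b G X Y = 0 from LinearMap.congr_fun e _
  refine C.mid_ext fun Z x y => ?_
  rw [LinearMap.comp_apply, consMap_midIncl, B.T_counit_cons]; rfl

theorem consConv_one (hC : C.Conil) {f g : C.Ob → B.Ob} {b : Fam C.toGQuiver B f f}
    (hb : ∀ X, b X X (C.one X) = 0) (G : Fam C.toGQuiver B.T.toGQuiver f g) (X : C.Ob) :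
    consConv b G X X (C.one X) = 0 := by
  rw [consConv, LinearMap.comp_apply, hC.comul_one, consMap_midIncl, hb, map_zero]; rfl

theorem hasDegree_of_weight (hC : C.Conil) {D : GQuiver k} {f g : C.Ob → D.Ob}
    (F : Fam C.toGQuiver D f g) (e : ℤ)
    (h : ∀ n X Y d, ∀ x ∈ hC.W X Y n d, F X Y x ∈ (D.Hom (f X) (g Y)).deg (d + e)) :
    F.HasDegree e := by
  intro X Y d x hx
  have : ⨆ n, hC.W X Y n d ≤ ((D.Hom (f X) (g Y)).deg (d + e)).comap (F X Y) :=
    iSup_le fun n x hx => h n X Y d x hx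
  exact this (hC.le_iSup X Y d hx)

theorem unitFam_mem (hC : C.Conil) (f : C.Ob → B.Ob) {X Y : C.Ob} {d : ℤ} {x : C.Hom X Y}
    (hx : x ∈ (C.Hom X Y).deg d) : C.unitFam B.T f X Y x ∈ (B.tHom (f X) (f Y)).deg d := by
  by_cases e : X = Y
  · subst e
    rw [unitFam_self]
    by_cases hd : d = 0
    · subst hd; exact Submodule.smul_mem _ _ (B.conil.one_mem_deg _)
    · rw [hC.counit_of_deg hd hx, zero_smul]; exact zero_mem _
  · rw [unitFam, dif_neg e]; exact zero_mem _

/-- `consConv b G` has degree `d + e` on elements of weight `n` if `b` has degree `d` and vanishes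
on the `1_X`, and `G` has degree `e` in weights less than `n`. -/
theorem consConv_mem_of_lt (hC : C.Conil) {f g : C.Ob → B.Ob} {b : Fam C.toGQuiver B f f} {d e : ℤ}
    (hb : b.HasDegree d) (hb1 : ∀ X, b X X (C.one X) = 0) (G : Fam C.toGQuiver B.T.toGQuiver f g)
    {n : ℕ} (h : ∀ j < n, ∀ X Y q, ∀ x ∈ hC.W X Y j q, G X Y x ∈ (B.tHom (f X) (g Y)).deg (q + e))
    {X Y : C.Ob} {p : ℤ} {x : C.Hom X Y} (hx : x ∈ hC.W X Y n p) :
    consConv b G X Y x ∈ (B.tHom (f X) (g Y)).deg (p + (d + e)) := by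
  refine C.midW_map (consMap b G X Y) _ ?_ (hC.comul_mem hx)
  intro Z i j p q _ hij hpq a ha c hc
  rw [consMap_midIncl]
  obtain rfl | hi := i.eq_zero_or_pos
  · rw [hC.eq_zero_of_weight_zero (b X Z) (fun e => by subst e; exact hb1 X) ha, map_zero]
    exact zero_mem _
  · have := B.cons_mem_deg (hb _ _ _ _ (hC.le_deg _ _ _ _ ha)) (h j (by omega) _ _ _ c hc)
    rwa [show p + d + (q + e) = p + q + (d + e) by ring, hpq] at this

/-- A solution of `(x)F = ε(x) 1 + ∑ (x') b ⊗ (x'') F` has degree `0` if `b` has. -/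
theorem rec_hasDegree (hC : C.Conil) (f : C.Ob → B.Ob) (b : Fam C.toGQuiver B f f)
    (hb : b.HasDegree 0) (hb1 : ∀ X, b X X (C.one X) = 0) (F : Fam C.toGQuiver B.T.toGQuiver f f)
    (hF : F = C.unitFam B.T f + consConv b F) : F.HasDegree 0 := by
  refine hC.hasDegree_of_weight F 0 fun n => ?_
  induction n using Nat.strong_induction_on with
  | _ n ih =>
    intro X Y d x hx
    have h1 : F X Y x = C.unitFam B.T f X Y x + consConv b F X Y x :=
      LinearMap.congr_fun (congrFun (congrFun hF X) Y) x
    rw [h1]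
    have h2 := hC.consConv_mem_of_lt hb hb1 F ih hx
    have h3 := hC.unitFam_mem (B := B) f (hC.le_deg _ _ _ _ hx)
    rw [add_zero, add_zero] at h2
    rw [add_zero]
    exact add_mem h3 h2

/-- A solution of `(x)F = ε(x) 1 + ∑ (x') b ⊗ (x'') F` is compatible with the comultiplications, by
induction on the weight of `x`: the cut comultiplication of `(x') b ⊗ (x'') F` is known from that of
`(x'') F`, and coassociativity of `C` applies. -/
theorem rec_comul (hC : C.Conil) (f : C.Ob → B.Ob) (b : Fam C.toGQuiver B f f)
    (hb1 : ∀ X, b X X (C.one X) = 0) (F : Fam C.toGQuiver B.T.toGQuiver f f)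
    (hF : F = C.unitFam B.T f + consConv b F) (X Y : C.Ob) (x : C.Hom X Y) :
    B.T.comul _ _ (F X Y x) = F.tens F X Y (C.comul X Y x) := by
  have key : ∀ n X Y d, ∀ x ∈ hC.W X Y n d,
      B.T.comul _ _ (F X Y x) = F.tens F X Y (C.comul X Y x) := by
    intro n
    induction n using Nat.strong_induction_on with
    | _ n ih =>
      intro X Y d x hx
      have h1 : F X Y x = C.unitFam B.T f X Y x + consConv b F X Y x :=
        LinearMap.congr_fun (congrFun (congrFun hF X) Y) x
      have h2 : B.T.comul _ _ (consConv b F X Y x) =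
          B.tq.midIncl _ _ _ (B.tOne (f X) ⊗ₜ consConv b F X Y x) +
            (consConv b F).tens F X Y (C.comul X Y x) := by
        have e1 := comul_consMap b F X Y (C.comul X Y x)
        have e2 := hC.consMid_congr hb1 (G := fun X Y => B.T.comul _ _ ∘ₗ F X Y)
          (G' := fun X Y => F.tens F X Y ∘ₗ C.comul X Y) ih hx
        rw [e2.trans (hC.consMid_coassoc b F F X Y x)] at e1
        exact e1
      have h3 : F.tens F X Y = (C.unitFam B.T f).tens F X Y + (consConv b F).tens F X Y := by
        rw [← Fam.tens_add_left, ← hF]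
      rw [h1, map_add, h2, comul_unitFam, ← add_assoc, ← map_add, ← TensorProduct.tmul_add, ← h1,
        ← hC.unitFam_tens, ← LinearMap.add_apply, h3]
  suffices e : B.T.comul _ _ ∘ₗ F X Y = F.tens F X Y ∘ₗ C.comul X Y from LinearMap.congr_fun e x
  exact hC.hom_ext fun n d x hx => key n X Y d x hx

/-- A solution of the recursion `F(x) = ε(x) 1 + ∑ (x') b ⊗ (x'') F` is a homomorphism. -/
def cohomOfRec (hC : C.Conil) (f : C.Ob → B.Ob) (b : Fam C.toGQuiver B f f) (hb : b.HasDegree 0)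
    (hb1 : ∀ X, b X X (C.one X) = 0) (F : Fam C.toGQuiver B.T.toGQuiver f f)
    (hF : F = C.unitFam B.T f + consConv b F) : CocatHom C B.T where
  obj := f
  map := F
  hasDegree := hC.rec_hasDegree f b hb hb1 F hF
  map_comul := hC.rec_comul f b hb1 F hF
  map_counit X Y x := by
    rw [hF]
    change B.T.counit _ _ (C.unitFam B.T f X Y x + consConv b F X Y x) = _
    rw [map_add, counit_consConv, add_zero]
    by_cases e : X = Y
    · subst e
      rw [unitFam_self, map_smul, B.T_counit_one, smul_eq_mul, mul_one]
    · rw [hC.counit_of_ne e, unitFam_of_counit _ _ _ (hC.counit_of_ne e x), map_zero]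
  map_one X := by
    rw [hF]
    change C.unitFam B.T f X X (C.one X) + consConv b F X X (C.one X) = _
    rw [hC.unitFam_one, hC.consConv_one hb1, add_zero]

/-- `x = ε(x) 1 + ∑ (x') pr₁ ⊗ x''` in `T B`. -/
theorem tHom_eq_cons {X Y : B.Ob} (t : B.tHom X Y) :
    t = B.T.unitFam B.T (fun X => X) X Y t +
      consConv (C := B.T) (B := B) (f := fun X => X) (g := fun X => X) (h := fun X => X)
        B.pr₁ (fun _ _ => LinearMap.id) X Y t := by
  suffices e : LinearMap.id = B.T.unitFam B.T (fun X => X) X Y +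
      consConv (C := B.T) (B := B) (f := fun X => X) (g := fun X => X) (h := fun X => X)
        B.pr₁ (fun _ _ => LinearMap.id) X Y from LinearMap.congr_fun e t
  refine B.tHom_ext (fun e => ?_) fun Z a n p => ?_
  · subst e
    rw [LinearMap.add_apply]
    have h1 := B.conil.unitFam_one B.T (fun X => X) X
    have h2 := B.conil.consConv_one (B := B) (f := fun X => X) (g := fun X => X) (b := B.pr₁)
      B.pr₁_one (fun _ _ => LinearMap.id) X
    exact (by rw [h1, h2, add_zero] : B.T.one X =
      B.T.unitFam B.T (fun X => X) X X (B.T.one X) + consConv (C := B.T) (B := B) (f := fun X => X)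
        (g := fun X => X) (h := fun X => X) B.pr₁ (fun _ _ => LinearMap.id) X X (B.T.one X))
  · generalize B.tIncl n Z Y p = t
    rw [LinearMap.add_apply, unitFam_of_counit _ _ _ (B.T_counit_cons X Z Y a t), zero_add,
      consConv, LinearMap.comp_apply, B.T_comul_cons, map_add, consMap_midIncl]
    rw [show B.pr₁ X X (B.tOne X) = 0 from B.pr₁_one X, map_zero, LinearMap.zero_apply, zero_add]
    have := B.conil.counit_left (consMap (C := B.T) (B := B) (f := fun X => X) (g := fun X => X)
      (h := fun X => X) B.pr₁ (fun _ _ => LinearMap.id) X Y ∘ₗ B.consMid X Z Y a)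
      (fun W b c hb => by
        rw [LinearMap.comp_apply, B.consMid_midIncl, consMap_midIncl,
          B.pr₁_cons_of_counit _ _ _ _ hb, map_zero]; rfl) t
    refine Eq.trans ?_ this.symm
    rw [LinearMap.comp_apply, B.consMid_midIncl, consMap_midIncl]
    rw [show B.pr₁ X Z (B.cons X Z Z a (B.T.one Z)) = a from B.pr₁_cons_one X Z a]
    rfl

end Cocat.Conil

end Cofree

section Universal

variable {k : Type u} [CommRing k]

variable {C : Cocat k} {B : GQuiver k}

/-- The composition of a family of maps to `T B` with `pr₁`. -/
def Fam.lin {f g : C.Ob → B.Ob} (F : Fam C.toGQuiver B.T.toGQuiver f g) : Fam C.toGQuiver B f g :=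
  fun X Y => B.pr₁ (f X) (g Y) ∘ₗ F X Y

theorem Fam.lin_apply {f g : C.Ob → B.Ob} (F : Fam C.toGQuiver B.T.toGQuiver f g) (X Y : C.Ob)
    (x : C.Hom X Y) : F.lin X Y x = B.pr₁ (f X) (g Y) (F X Y x) := rfl

theorem Fam.HasDegree.lin {f g : C.Ob → B.Ob} {F : Fam C.toGQuiver B.T.toGQuiver f g} {d : ℤ}
    (hF : F.HasDegree d) : F.lin.HasDegree d :=
  fun X Y n x hx => B.pr₁_mem (hF X Y n x hx)

/-- The map `t' ⊗ t'' ↦ (t') pr₁ ⊗ t''` on tensors of values of `F` and `G`. -/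
theorem consMap_tens {f g h : C.Ob → B.Ob} (F : Fam C.toGQuiver B.T.toGQuiver f g)
    (G : Fam C.toGQuiver B.T.toGQuiver g h) (X Y : C.Ob) (v : C.Mid X Y) :
    consMap (C := B.T) (B := B) (f := fun X => X) (g := fun X => X) (h := fun X => X)
        B.pr₁ (fun _ _ => LinearMap.id) (f X) (h Y) (F.tens G X Y v) = consMap F.lin G X Y v := by
  suffices e : consMap (C := B.T) (B := B) (f := fun X => X) (g := fun X => X) (h := fun X => X)
        B.pr₁ (fun _ _ => LinearMap.id) (f X) (h Y) ∘ₗ F.tens G X Y = consMap F.lin G X Y from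
    LinearMap.congr_fun e v
  refine C.mid_ext fun Z x y => ?_
  rw [LinearMap.comp_apply, Fam.tens_midIncl, TensorProduct.map_tmul, consMap_midIncl,
    consMap_midIncl]
  rfl

theorem CocatHom.lin_one (F : CocatHom C B.T) (X : C.Ob) : F.map.lin X X (C.one X) = 0 := by
  rw [Fam.lin_apply, F.map_one]; exact B.pr₁_one _

theorem CocatHom.lin_hasDegree (F : CocatHom C B.T) : F.map.lin.HasDegree 0 :=
  F.hasDegree.lin

/-- The recursion `(x)F = ε(x) 1 + ∑ (x')F pr₁ ⊗ (x'')F` for a homomorphism. -/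
theorem CocatHom.map_eq_rec (hC : C.Conil) (F : CocatHom C B.T) :
    F.map = C.unitFam B.T F.obj + consConv F.map.lin F.map := by
  funext X Y
  refine LinearMap.ext fun x => ?_
  have h := Cocat.Conil.tHom_eq_cons (F.map X Y x)
  rw [consConv, LinearMap.comp_apply, F.map_comul X Y x, consMap_tens] at h
  refine h.trans (congrArg (· + consMap F.map.lin F.map X Y (C.comul X Y x)) ?_)
  by_cases e : X = Y
  · subst e
    rw [Cocat.unitFam_self, Cocat.unitFam_self]
    exact congrArg (· • B.T.one _) (F.map_counit X X x)
  · have h0 := hC.counit_of_ne e x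
    rw [Cocat.unitFam_of_counit _ _ _ h0]
    exact Cocat.unitFam_of_counit _ _ _ ((F.map_counit X Y x).trans h0)

/-- Homomorphisms to `T B` are determined by their linear parts. They enter through the recursion of
`CocatHom.map_eq_rec` only, so that both can be taken with literally the same map `f` of objects. -/
theorem CocatHom.eq_of_lin (hC : C.Conil) {f : C.Ob → B.Ob}
    {F G : Fam C.toGQuiver B.T.toGQuiver f f} (hF : F = C.unitFam B.T f + consConv F.lin F)
    (hG : G = C.unitFam B.T f + consConv G.lin G) (h : F.lin = G.lin)
    (h1 : ∀ X, F.lin X X (C.one X) = 0) : F = G := by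
  refine sub_eq_zero.mp (hC.eq_zero_of_rec h1 ?_)
  rw [consConv_sub_right]
  conv_lhs => rw [hF, hG, ← h]
  abel

/-- The linear part of `x ↦ ∑ (x') b ⊗ (x'') G` is `b`, if `G` preserves the counit and the
`1_X`. -/
theorem CocatHom.lin_eq_of_rec (hC : C.Conil) {f g : C.Ob → B.Ob} {b : Fam C.toGQuiver B f g}
    {G : Fam C.toGQuiver B.T.toGQuiver g g} (hG : ∀ X, G X X (C.one X) = B.tOne (g X))
    (hG' : ∀ X Y x, B.T.counit _ _ (G X Y x) = C.counit X Y x) (X Y : C.Ob) (x : C.Hom X Y) :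
    B.pr₁ _ _ (consConv b G X Y x) = b X Y x := by
  have := hC.counit_right (B.pr₁ (f X) (g Y) ∘ₗ consMap b G X Y) (fun Z a c hc => by
    rw [LinearMap.comp_apply, consMap_midIncl]
    exact B.pr₁_cons_of_counit _ _ _ _ ((hG' _ _ _).trans hc)) x
  refine this.trans ?_
  rw [LinearMap.comp_apply, consMap_midIncl, hG, B.pr₁_cons_one]

theorem Cocat.Conil.pr₁_unitFam (f : C.Ob → B.Ob) (X Y : C.Ob) (x : C.Hom X Y) :
    B.pr₁ _ _ (C.unitFam B.T f X Y x) = 0 := by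
  by_cases e : X = Y
  · subst e
    rw [unitFam_self, map_smul]
    exact (congrArg _ (B.pr₁_one _)).trans (smul_zero _)
  · rw [unitFam, dif_neg e, LinearMap.zero_apply, map_zero]

/-- The linear part of a solution of the recursion for homomorphisms. -/
theorem Cocat.Conil.lin_of_rec (hC : C.Conil) {f : C.Ob → B.Ob} {b : Fam C.toGQuiver B f f}
    (hb : b.HasDegree 0) (hb1 : ∀ X, b X X (C.one X) = 0) {F : Fam C.toGQuiver B.T.toGQuiver f f}
    (hF : F = C.unitFam B.T f + consConv b F) : F.lin = b := by
  let G := hC.cohomOfRec f b hb hb1 F hF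
  funext X Y
  refine LinearMap.ext fun x => ?_
  have h1 : F X Y x = C.unitFam B.T f X Y x + consConv b F X Y x :=
    LinearMap.congr_fun (congrFun (congrFun hF X) Y) x
  rw [Fam.lin_apply, h1, map_add, Cocat.Conil.pr₁_unitFam, zero_add]
  exact CocatHom.lin_eq_of_rec hC G.map_one G.map_counit X Y x

/-- A sequence of linear maps which is stationary at every element has a limit. -/
theorem exists_limit {M N : Type*} [AddCommGroup M] [Module k M] [AddCommGroup N] [Module k N]
    (F : ℕ → M →ₗ[k] N) (hF : ∀ x, ∃ n, ∀ m, n ≤ m → F m x = F n x) :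
    ∃ G : M →ₗ[k] N, ∀ x n, (∀ m, n ≤ m → F m x = F n x) → G x = F n x := by
  choose n hn using hF
  have key : ∀ x m, n x ≤ m → F m x = F (n x) x := hn
  refine ⟨⟨⟨fun x => F (n x) x, fun x y => ?_⟩, fun c x => ?_⟩, fun x m hm => ?_⟩
  · rw [← key (x + y) (max (n (x + y)) (max (n x) (n y))) (le_max_left _ _),
      ← key x (max (n (x + y)) (max (n x) (n y))) ((le_max_left _ _).trans (le_max_right _ _)),
      ← key y (max (n (x + y)) (max (n x) (n y))) ((le_max_right _ _).trans (le_max_right _ _)),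
      map_add]
  · change F (n (c • x)) (c • x) = c • F (n x) x
    rw [← key (c • x) (max (n (c • x)) (n x)) (le_max_left _ _),
      ← key x (max (n (c • x)) (n x)) (le_max_right _ _), map_smul]
  · change F (n x) x = F m x
    rw [← key x (max (n x) m) (le_max_left _ _), hm _ (le_max_right _ _)]

/-- The iterates for the recursion `(x)F = ε(x) 1 + ∑ (x') b ⊗ (x'') F`. -/
def recSeq (f : C.Ob → B.Ob) (b : Fam C.toGQuiver B f f) : ℕ → Fam C.toGQuiver B.T.toGQuiver f f
  | 0 => C.unitFam B.T f
  | n + 1 => C.unitFam B.T f + consConv b (recSeq f b n)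

theorem recSeq_stationary (hC : C.Conil) {f : C.Ob → B.Ob} {b : Fam C.toGQuiver B f f}
    (hb1 : ∀ X, b X X (C.one X) = 0) (m : ℕ) : ∀ n ≤ m, ∀ X Y d, ∀ x ∈ hC.W X Y n d,
      recSeq f b (m + 1) X Y x = recSeq f b m X Y x := by
  induction m with
  | zero =>
    intro n hn X Y d x hx
    obtain rfl : n = 0 := by omega
    have h0 : ∀ e : X = Y, recSeq f b (0 + 1) X Y (e ▸ C.one X) =
        recSeq f b 0 X Y (e ▸ C.one X) := by
      rintro rfl
      change C.unitFam B.T f X X (C.one X) + consConv b (recSeq f b 0) X X (C.one X) =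
        C.unitFam B.T f X X (C.one X)
      rw [hC.consConv_one hb1, add_zero]
    exact hC.eq_of_weight_zero _ _ h0 hx
  | succ m ih =>
    intro n hn X Y d x hx
    change C.unitFam B.T f X Y x + consConv b (recSeq f b (m + 1)) X Y x =
      C.unitFam B.T f X Y x + consConv b (recSeq f b m) X Y x
    rw [hC.consConv_congr hb1 (fun j hj X Y q x hx => ih j (by omega) X Y q x hx) hx]

/-- The universal property of `T B`: a map of degree `0` which vanishes on the `1_X` is the linear
part of a homomorphism. The maps `F` of the homomorphism are exhibited separately, over the given
map `f` of objects. -/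
theorem exists_cohom (hC : C.Conil) (f : C.Ob → B.Ob) (b : Fam C.toGQuiver B f f)
    (hb : b.HasDegree 0) (hb1 : ∀ X, b X X (C.one X) = 0) :
    ∃ F : Fam C.toGQuiver B.T.toGQuiver f f, ∃ G : CocatHom C B.T, G.toQMap = ⟨f, F⟩ ∧
      F.lin = b := by
  have hstat : ∀ n X Y d, ∀ x ∈ hC.W X Y n d, ∀ m, n ≤ m →
      recSeq f b m X Y x = recSeq f b n X Y x := by
    intro n X Y d x hx m hm
    induction m, hm using Nat.le_induction with
    | base => rfl
    | succ m hm ih => rw [recSeq_stationary hC hb1 m n hm X Y d x hx, ih]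
  have hlim : ∀ X Y, ∃ F : C.Hom X Y →ₗ[k] B.T.Hom (f X) (f Y), ∀ x n,
      (∀ m, n ≤ m → recSeq f b m X Y x = recSeq f b n X Y x) → F x = recSeq f b n X Y x := by
    intro X Y
    refine exists_limit (fun m => recSeq f b m X Y) fun x => ?_
    induction x using hC.induction with
    | zero => exact ⟨0, fun m _ => by rw [map_zero, map_zero]⟩
    | add x y hx hy =>
      obtain ⟨n, hn⟩ := hx
      obtain ⟨n', hn'⟩ := hy
      refine ⟨max n n', fun m hm => ?_⟩
      rw [map_add, map_add, hn m ((le_max_left _ _).trans hm), hn' m ((le_max_right _ _).trans hm),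
        hn _ (le_max_left _ _), hn' _ (le_max_right _ _)]
    | mem n d x hx => exact ⟨n, hstat n X Y d x hx⟩
  choose F hF using hlim
  have hrec : F = C.unitFam B.T f + consConv b F := by
    funext X Y
    refine hC.hom_ext fun n d x hx => ?_
    rw [hF X Y x n (hstat n X Y d x hx), ← recSeq_stationary hC hb1 n n le_rfl X Y d x hx]
    change C.unitFam B.T f X Y x + consConv b (recSeq f b n) X Y x =
      C.unitFam B.T f X Y x + consConv b F X Y x
    rw [hC.consConv_congr hb1 (fun j hj X Y q y hy => ?_) hx]
    have h1 := hF X Y y j (hstat j X Y q y hy)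
    rw [h1, hstat j X Y q y hy n hj.le]
  exact ⟨F, hC.cohomOfRec f b hb hb1 F hrec, rfl, hC.lin_of_rec hb hb1 hrec⟩

/-! ### Coderivations -/

/-- As the degree is additive, `x ↦ (-1) ^ (d * deg x) (x) g` is compatible with the
comultiplication. -/
theorem comul_twist (hC : C.Conil) {D : Cocat k} (g : CocatHom C D) (d : ℤ) (X Y : C.Ob)
    (x : C.Hom X Y) : D.comul _ _ (g.map.twist d X Y x) =
      (g.map.twist d).tens (g.map.twist d) X Y (C.comul X Y x) := by
  rw [Fam.twist, LinearMap.comp_apply, g.map_comul, hC.comul_sgn]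
  exact Fam.tens_comp (f := fun X => X) (g := fun X => X) (h := fun X => X) _ _ g.map g.map X Y _

theorem Cocat.Conil.counit_sgn (hC : C.Conil) (d : ℤ) (X Y : C.Ob) (x : C.Hom X Y) :
    C.counit X Y ((C.Hom X Y).sgn d x) = C.counit X Y x := by
  induction x using GMod.hom_induction with
  | zero => simp
  | add _ _ hx hy => rw [map_add, map_add, map_add, hx, hy]
  | mem n x hx =>
    rw [GMod.sgn_mem _ d hx, map_smul]
    by_cases hn : n = 0
    · subst hn; simp
    · rw [hC.counit_of_deg hn hx, smul_zero]

theorem sgn_one (hC : C.Conil) (d : ℤ) (X : C.Ob) : (C.Hom X X).sgn d (C.one X) = C.one X := by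
  rw [GMod.sgn_mem _ d (hC.one_mem_deg X), mul_zero, ksign_zero, one_smul]

theorem twist_one (hC : C.Conil) {D : Cocat k} (g : CocatHom C D) (d : ℤ) (X : C.Ob) :
    g.map.twist d X X (C.one X) = D.one (g.obj X) := by
  rw [Fam.twist, LinearMap.comp_apply, sgn_one hC, g.map_one]

theorem counit_twist (hC : C.Conil) {D : Cocat k} (g : CocatHom C D) (d : ℤ) (X Y : C.Ob)
    (x : C.Hom X Y) : D.counit _ _ (g.map.twist d X Y x) = C.counit X Y x := by
  rw [Fam.twist, LinearMap.comp_apply, g.map_counit, hC.counit_sgn]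

theorem twist_hasDegree {D : GQuiver k} {f g : C.Ob → D.Ob} {r : Fam C.toGQuiver D f g} {e : ℤ}
    (hr : r.HasDegree e) (d : ℤ) : (r.twist d).HasDegree e :=
  fun X Y n _ hx => hr X Y n _ (GMod.sgn_mem_deg _ d hx)

/-- The values of coderivations have counit zero. -/
theorem IsCoderivation.counit {D : Cocat k} (hC : C.Conil) (hD : D.Conil) {f g : CocatHom C D}
    {d : ℤ} {r : Fam C.toGQuiver D.toGQuiver f.obj g.obj}
    (hr : IsCoderivation f.toQMap g.toQMap d r) (X Y : C.Ob) (x : C.Hom X Y) :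
    D.counit _ _ (r X Y x) = 0 := by
  let e : D.Mid (f.obj X) (g.obj Y) →ₗ[k] k := D.midDesc fun Z =>
    LinearMap.mul' k k ∘ₗ TensorProduct.map (D.counit _ Z) (D.counit Z _)
  have he : ∀ Z a c, e (D.midIncl _ Z _ (a ⊗ₜ c)) = D.counit _ _ a * D.counit _ _ c := by
    intro Z a c
    rw [GQuiver.midDesc_midIncl, LinearMap.comp_apply, TensorProduct.map_tmul,
      LinearMap.mul'_apply]
  have h0 : e (D.comul _ _ (r X Y x)) = D.counit _ _ (r X Y x) := by
    rw [hD.counit_left e (fun Z a c ha => by rw [he, ha, zero_mul]), he, hD.counit_one, one_mul]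
  have h1 : e (f.map.tens r X Y (C.comul X Y x)) = D.counit _ _ (r X Y x) := by
    have := hC.counit_left (e ∘ₗ f.map.tens r X Y) (fun Z a c ha => by
      rw [LinearMap.comp_apply, Fam.tens_midIncl, TensorProduct.map_tmul, he, f.map_counit, ha,
        zero_mul]) x
    refine this.trans ?_
    rw [LinearMap.comp_apply, Fam.tens_midIncl, TensorProduct.map_tmul, he, f.map_counit,
      hC.counit_one, one_mul]
  have h2 : e (r.tens (g.map.twist d) X Y (C.comul X Y x)) = D.counit _ _ (r X Y x) := by
    have := hC.counit_right (e ∘ₗ r.tens (g.map.twist d) X Y) (fun Z a c hc => by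
      rw [LinearMap.comp_apply, Fam.tens_midIncl, TensorProduct.map_tmul, he, counit_twist hC, hc,
        mul_zero]) x
    refine this.trans ?_
    rw [LinearMap.comp_apply, Fam.tens_midIncl, TensorProduct.map_tmul, he, counit_twist hC,
      hC.counit_one, mul_one]
  have h3 := congrArg e (hr.2 X Y x)
  rw [map_add, h0, h1, h2] at h3
  exact left_eq_add.mp h3

/-- The recursion `(x)r = ∑ (x') f pr₁ ⊗ (x'') r + ∑ ± (x') r pr₁ ⊗ (x'') g` for a coderivation. -/
theorem IsCoderivation.eq_rec (hC : C.Conil) {f g : CocatHom C B.T} {d : ℤ}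
    {r : Fam C.toGQuiver B.T.toGQuiver f.obj g.obj}
    (hr : IsCoderivation f.toQMap g.toQMap d r) :
    r = consConv f.map.lin r + consConv r.lin (g.map.twist d) := by
  funext X Y
  refine LinearMap.ext fun x => ?_
  have h := Cocat.Conil.tHom_eq_cons (r X Y x)
  rw [Cocat.unitFam_of_counit _ _ _ (hr.counit hC B.conil X Y x), zero_add, consConv,
    LinearMap.comp_apply, hr.2 X Y x, map_add, consMap_tens, consMap_tens] at h
  exact h

/-- Coderivations are determined by their linear parts. -/
theorem IsCoderivation.eq_of_lin (hC : C.Conil) {f g : CocatHom C B.T} {d : ℤ}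
    {r s : Fam C.toGQuiver B.T.toGQuiver f.obj g.obj} (hr : IsCoderivation f.toQMap g.toQMap d r)
    (hs : IsCoderivation f.toQMap g.toQMap d s) (h : r.lin = s.lin) : r = s := by
  refine sub_eq_zero.mp (hC.eq_zero_of_rec f.lin_one ?_)
  rw [consConv_sub_right]
  conv_lhs => rw [hr.eq_rec hC, hs.eq_rec hC, h]
  abel

/-- A solution of the recursion for coderivations is a coderivation. -/
theorem isCoderivation_of_rec (hC : C.Conil) {f g : CocatHom C B.T} {d : ℤ}
    {b : Fam C.toGQuiver B f.obj g.obj} (hb : b.HasDegree d)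
    {r : Fam C.toGQuiver B.T.toGQuiver f.obj g.obj}
    (hr : r = consConv f.map.lin r + consConv b (g.map.twist d)) :
    IsCoderivation f.toQMap g.toQMap d r := by
  have hr' : ∀ X Y x, r X Y x = consConv f.map.lin r X Y x +
      consConv b (g.map.twist d) X Y x := fun X Y x =>
    LinearMap.congr_fun (congrFun (congrFun hr X) Y) x
  constructor
  · refine hC.hasDegree_of_weight r d fun n => ?_
    induction n using Nat.strong_induction_on with
    | _ n ih =>
      intro X Y p x hx
      rw [hr']
      have h1 := hC.consConv_mem_of_lt f.lin_hasDegree f.lin_one r ih hx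
      rw [zero_add] at h1
      refine add_mem h1 ?_
      refine C.midW_map (consMap b (g.map.twist d) X Y) _ ?_ (hC.comul_mem hx)
      intro Z i j p' q _ _ hpq a ha c hc
      rw [consMap_midIncl]
      have := B.cons_mem_deg (hb _ _ _ _ (hC.le_deg _ _ _ _ ha))
        (twist_hasDegree g.hasDegree d _ _ _ _ (hC.le_deg _ _ _ _ hc))
      rwa [show p' + d + (q + 0) = p' + q + d by ring, hpq] at this
  · have key : ∀ n X Y p, ∀ x ∈ hC.W X Y n p, B.T.comul _ _ (r X Y x) =
        f.map.tens r X Y (C.comul X Y x) + r.tens (g.map.twist d) X Y (C.comul X Y x) := by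
      intro n
      induction n using Nat.strong_induction_on with
      | _ n ih =>
        intro X Y p x hx
        have e1 := Cocat.Conil.comul_consMap f.map.lin r X Y (C.comul X Y x)
        have e2 := hC.consMid_congr f.lin_one (G := fun X Y => B.T.comul _ _ ∘ₗ r X Y)
          (G' := fun X Y => f.map.tens r X Y ∘ₗ C.comul X Y +
            r.tens (g.map.twist d) X Y ∘ₗ C.comul X Y) ih hx
        have e3 := Cocat.Conil.comul_consMap b (g.map.twist d) X Y (C.comul X Y x)
        have e4 : (fun Z Y => B.T.comul _ _ ∘ₗ g.map.twist d Z Y) =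
            fun Z Y => (g.map.twist d).tens (g.map.twist d) Z Y ∘ₗ C.comul Z Y := by
          funext Z Y
          exact LinearMap.ext fun y => comul_twist hC g d Z Y y
        have e5 := hC.consMid_coassoc b (g.map.twist d) (g.map.twist d) X Y x
        have e6 := hC.consMid_coassoc f.map.lin f.map r X Y x
        have e7 := hC.consMid_coassoc f.map.lin r (g.map.twist d) X Y x
        have e8 : C.midDesc (fun Z =>
            TensorProduct.lift (B.consMid (f.obj X) (f.obj Z) (g.obj Y)) ∘ₗ
              TensorProduct.map (f.map.lin X Z) (f.map.tens r Z Y ∘ₗ C.comul Z Y +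
              r.tens (g.map.twist d) Z Y ∘ₗ C.comul Z Y)) =
            C.midDesc (fun Z => TensorProduct.lift (B.consMid (f.obj X) (f.obj Z) (g.obj Y)) ∘ₗ
              TensorProduct.map (f.map.lin X Z) (f.map.tens r Z Y ∘ₗ C.comul Z Y)) +
            C.midDesc (fun Z => TensorProduct.lift (B.consMid (f.obj X) (f.obj Z) (g.obj Y)) ∘ₗ
              TensorProduct.map (f.map.lin X Z) (r.tens (g.map.twist d) Z Y ∘ₗ C.comul Z Y)) := by
          refine C.mid_ext fun Z y z => ?_
          rw [LinearMap.add_apply, GQuiver.midDesc_midIncl, GQuiver.midDesc_midIncl,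
            GQuiver.midDesc_midIncl, TensorProduct.map_add_right, LinearMap.comp_add]
          rfl
        have e9 : f.map.tens r X Y =
            (C.unitFam B.T f.obj).tens r X Y + (consConv f.map.lin f.map).tens r X Y := by
          rw [← Fam.tens_add_left, ← f.map_eq_rec hC]
        have e10 : r.tens (g.map.twist d) X Y = (consConv f.map.lin r).tens (g.map.twist d) X Y +
            (consConv b (g.map.twist d)).tens (g.map.twist d) X Y := by
          rw [← Fam.tens_add_left, ← hr]
        have e11 := hC.unitFam_tens r X Y x
        have e12 := congrArg (C.midDesc · (C.comul X Y x)) (congrArg (fun (G : ∀ Z Y : C.Ob,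
          C.Hom Z Y →ₗ[k] B.tq.Mid (g.obj Z) (g.obj Y)) Z =>
            TensorProduct.lift (B.consMid (f.obj X) (g.obj Z) (g.obj Y)) ∘ₗ
              TensorProduct.map (b X Z) (G Z Y)) e4)
        rw [e2.trans ((LinearMap.congr_fun e8 _).trans (congrArg₂ (· + ·) e6 e7))] at e1
        rw [e12.trans e5] at e3
        have e13 : B.tq.midIncl _ _ _ (B.tOne (f.obj X) ⊗ₜ r X Y x) =
            B.tq.midIncl _ _ _ (B.tOne (f.obj X) ⊗ₜ consMap f.map.lin r X Y (C.comul X Y x)) +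
            B.tq.midIncl _ _ _
              (B.tOne (f.obj X) ⊗ₜ consMap b (g.map.twist d) X Y (C.comul X Y x)) := by
          rw [← map_add, ← TensorProduct.tmul_add]
          exact congrArg (fun t => B.tq.midIncl _ _ _ (B.tOne (f.obj X) ⊗ₜ t)) (hr' X Y x)
        rw [hr', map_add]
        refine (congrArg₂ (· + ·) e1 e3).trans ?_
        rw [e9, e10, LinearMap.add_apply, LinearMap.add_apply, e11, e13]
        abel
    intro X Y x
    suffices e : B.T.comul _ _ ∘ₗ r X Y = f.map.tens r X Y ∘ₗ C.comul X Y +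
        r.tens (g.map.twist d) X Y ∘ₗ C.comul X Y from LinearMap.congr_fun e x
    exact hC.hom_ext fun n p x hx => key n X Y p x hx

end Universal

section Convolution

variable {k : Type u} [CommRing k]

/-! ### Convolution and existence of coderivations -/

namespace GQuiver

variable (B : GQuiver k)

theorem concat_one (X Y : B.Ob) (t : B.tHom X Y) : B.concat X X Y (B.tOne X) t = t := by
  rw [concat, tOne, tDesc_tIncl, powConcat, powZeroDesc_powOne]
  rfl

theorem concat_cons (X W Y Z : B.Ob) (a : B.Hom X W) (t : B.tHom W Y) (s : B.tHom Y Z) :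
    B.concat X Y Z (B.cons X W Y a t) s = B.cons X W Z a (B.concat W Y Z t s) := by
  suffices e : (B.concat X Y Z).flip s ∘ₗ B.cons X W Y a =
      B.cons X W Z a ∘ₗ (B.concat W Y Z).flip s from LinearMap.congr_fun e t
  refine B.tHom_hom_ext fun n p => ?_
  simp only [LinearMap.comp_apply, LinearMap.flip_apply]
  rw [cons_tIncl, concat, concat, tDesc_tIncl, tDesc_tIncl, powConcat, powSuccDesc_powCons]
  rfl

theorem concat_tIncl₁ (X Y Z : B.Ob) (a : B.Hom X Y) (s : B.tHom Y Z) :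
    B.concat X Y Z (B.tIncl₁ X Y a) s = B.cons X Y Z a s := by
  rw [tIncl₁, LinearMap.flip_apply, concat_cons, concat_one]

end GQuiver

variable {A B : GQuiver k}

/-- `x ⊗ y ↦ (x) r · (y) s`. -/
def concatMap {f g h : A.Ob → B.Ob} (r : Fam A.T.toGQuiver B.T.toGQuiver f g)
    (s : Fam A.T.toGQuiver B.T.toGQuiver g h) (X Y : A.Ob) :
    A.T.Mid X Y →ₗ[k] B.tHom (f X) (h Y) :=
  (B.T.midDesc fun W => TensorProduct.lift (B.concat (f X) W (h Y))) ∘ₗ r.tens s X Y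

theorem concatMap_midIncl {f g h : A.Ob → B.Ob} (r : Fam A.T.toGQuiver B.T.toGQuiver f g)
    (s : Fam A.T.toGQuiver B.T.toGQuiver g h) (X Z Y : A.Ob) (x : A.T.Hom X Z) (y : A.T.Hom Z Y) :
    concatMap r s X Y (A.T.midIncl X Z Y (x ⊗ₜ y)) = B.concat _ _ _ (r X Z x) (s Z Y y) := by
  rw [concatMap, LinearMap.comp_apply, Fam.tens_midIncl, GQuiver.midDesc_midIncl,
    TensorProduct.map_tmul, TensorProduct.lift.tmul]

theorem conv_eq {f g h : A.Ob → B.Ob} (r : Fam A.T.toGQuiver B.T.toGQuiver f g)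
    (s : Fam A.T.toGQuiver B.T.toGQuiver g h) (X Y : A.Ob) (x : A.T.Hom X Y) :
    conv r s X Y x = concatMap r s X Y (A.T.comul X Y x) := rfl

/-- The convolution product with a map to `T¹ B` is `consConv`. -/
theorem conv_tIncl₁ {f g h : A.Ob → B.Ob} (b : Fam A.T.toGQuiver B f g)
    (s : Fam A.T.toGQuiver B.T.toGQuiver g h) :
    conv (fun X Y => B.tIncl₁ (f X) (g Y) ∘ₗ b X Y) s = consConv b s := by
  funext X Y
  refine LinearMap.ext fun x => ?_
  suffices e : concatMap (fun X Y => B.tIncl₁ (f X) (g Y) ∘ₗ b X Y) s X Y = consMap b s X Y from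
    LinearMap.congr_fun e _
  refine A.T.mid_ext fun Z x y => ?_
  rw [concatMap_midIncl, consMap_midIncl, LinearMap.comp_apply, B.concat_tIncl₁]

theorem conv_unitFam {f g : A.Ob → B.Ob} (s : Fam A.T.toGQuiver B.T.toGQuiver f g) :
    conv (A.T.unitFam B.T f) s = s := by
  funext X Y
  refine LinearMap.ext fun x => ?_
  rw [conv_eq, A.conil.counit_left _ (fun Z a c ha => ?_), concatMap_midIncl, A.conil.unitFam_one]
  · exact B.concat_one _ _ _
  · rw [concatMap_midIncl, Cocat.unitFam_of_counit _ _ _ ha, map_zero]; rfl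

theorem conv_consConv {f g h l : A.Ob → B.Ob} (b : Fam A.T.toGQuiver B f g)
    (F : Fam A.T.toGQuiver B.T.toGQuiver g h) (s : Fam A.T.toGQuiver B.T.toGQuiver h l) :
    conv (consConv b F) s = consConv b (conv F s) := by
  funext X Y
  refine LinearMap.ext fun x => Eq.symm ?_
  refine A.conil.coassoc_apply (fun Z W => TensorProduct.lift (B.cons (f X) (g Z) (l Y)) ∘ₗ
    TensorProduct.map (b X Z) (TensorProduct.lift (B.concat (g Z) (h W) (l Y)) ∘ₗ
      TensorProduct.map (F Z W) (s W Y))) (consMap b (conv F s) X Y)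
    (concatMap (consConv b F) s X Y) (fun Z a c => ?_) (fun W a c => ?_) x
  · rw [consMap_midIncl, conv_eq]
    suffices e : B.cons (f X) (g Z) (l Y) (b X Z a) ∘ₗ concatMap F s Z Y =
        A.T.midDesc (fun W => (TensorProduct.lift (B.cons (f X) (g Z) (l Y)) ∘ₗ
          TensorProduct.map (b X Z) (TensorProduct.lift (B.concat (g Z) (h W) (l Y)) ∘ₗ
            TensorProduct.map (F Z W) (s W Y))) ∘ₗ TensorProduct.mk k _ _ a) from
      LinearMap.congr_fun e _
    refine A.T.mid_ext fun W y z => ?_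
    rw [LinearMap.comp_apply, concatMap_midIncl, GQuiver.midDesc_midIncl]
    rfl
  · rw [concatMap_midIncl]
    suffices e : (B.concat (f X) (h W) (l Y)).flip (s W Y c) ∘ₗ consMap b F X W =
        A.T.midDesc (fun Z => (TensorProduct.lift (B.cons (f X) (g Z) (l Y)) ∘ₗ
          TensorProduct.map (b X Z) (TensorProduct.lift (B.concat (g Z) (h W) (l Y)) ∘ₗ
            TensorProduct.map (F Z W) (s W Y))) ∘ₗ (TensorProduct.assoc k _ _ _).toLinearMap ∘ₗ
              (TensorProduct.mk k _ _).flip c) from LinearMap.congr_fun e _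
    refine A.T.mid_ext fun Z y z => ?_
    rw [LinearMap.comp_apply, consMap_midIncl, GQuiver.midDesc_midIncl]
    exact B.concat_cons _ _ _ _ _ _ _

theorem conv_add_left {f g h : A.Ob → B.Ob} (r r' : Fam A.T.toGQuiver B.T.toGQuiver f g)
    (s : Fam A.T.toGQuiver B.T.toGQuiver g h) : conv (r + r') s = conv r s + conv r' s :=
  (LinearMap.congr_fun (map_add (convL f g h) r r') s :)

/-- The recursion for convolution products with a homomorphism on the left. -/
theorem conv_map_eq_rec (F : CocatHom A.T B.T) {g : A.Ob → B.Ob}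
    (s : Fam A.T.toGQuiver B.T.toGQuiver F.obj g) :
    conv F.map s = s + consConv F.map.lin (conv F.map s) := by
  conv_lhs => rw [F.map_eq_rec A.conil, conv_add_left, conv_unitFam, conv_consConv]

/-- The families of maps of degree `d`, as a submodule. -/
def famDeg (C D : GQuiver k) (f g : C.Ob → D.Ob) (d : ℤ) : Submodule k (Fam C D f g) where
  carrier := {b | b.HasDegree d}
  add_mem' hb hb' X Y n x hx := add_mem (hb X Y n x hx) (hb' X Y n x hx)
  zero_mem' _ _ _ _ _ := zero_mem _
  smul_mem' c _ hb X Y n x hx := Submodule.smul_mem _ c (hb X Y n x hx)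

theorem pr₁_consConv_of_counit {C : Cocat k} {f g h : C.Ob → B.Ob} (b : Fam C.toGQuiver B f g)
    {G : Fam C.toGQuiver B.T.toGQuiver g h} (hG : ∀ X Y x, B.T.counit _ _ (G X Y x) = 0)
    (X Y : C.Ob) (x : C.Hom X Y) : B.pr₁ _ _ (consConv b G X Y x) = 0 := by
  suffices e : B.pr₁ _ _ ∘ₗ consMap b G X Y = 0 from LinearMap.congr_fun e _
  refine C.mid_ext fun Z x y => ?_
  rw [LinearMap.comp_apply, consMap_midIncl]
  exact B.pr₁_cons_of_counit _ _ _ _ (hG _ _ _)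

variable (f g : CocatHom A.T B.T)

/-- The family `Δ⁽³⁾ (f ⊗ b ⊗ g) μ⁽³⁾`, with the sign for a family `b` of degree `d`. -/
def coderOf (d : ℤ) : Fam A.T.toGQuiver B f.obj g.obj →ₗ[k]
    Fam A.T.toGQuiver B.T.toGQuiver f.obj g.obj :=
  convL (A := A) (B := B) f.obj f.obj g.obj f.map ∘ₗ
    (convL (A := A) (B := B) f.obj g.obj g.obj).flip (g.map.twist d) ∘ₗ
    { toFun := fun b X Y => B.tIncl₁ (f.obj X) (g.obj Y) ∘ₗ b X Y
      map_add' := fun b b' => by funext X Y; exact LinearMap.comp_add _ _ _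
      map_smul' := fun c b => by funext X Y; exact LinearMap.comp_smul _ _ _ }

theorem coderOf_eq (d : ℤ) (b : Fam A.T.toGQuiver B f.obj g.obj) :
    coderOf f g d b = conv f.map (consConv b (g.map.twist d)) :=
  congrArg (conv f.map) (conv_tIncl₁ b (g.map.twist d))

/-- Every family of degree `d` is the linear part of a coderivation, namely of `coderOf`; see
`coderOf_lin`. -/
theorem isCoderivation_coderOf {d : ℤ} {b : Fam A.T.toGQuiver B f.obj g.obj}
    (hb : b.HasDegree d) : IsCoderivation f.toQMap g.toQMap d (coderOf f g d b) := by
  refine isCoderivation_of_rec A.conil hb ?_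
  rw [coderOf_eq]
  conv_lhs => rw [conv_map_eq_rec]
  rw [add_comm]

theorem coderOf_lin {d : ℤ} {b : Fam A.T.toGQuiver B f.obj g.obj} (hb : b.HasDegree d) :
    (coderOf f g d b).lin = b := by
  have h := isCoderivation_coderOf f g hb
  funext X Y
  refine LinearMap.ext fun x => ?_
  have h1 : coderOf f g d b X Y x = consConv b (g.map.twist d) X Y x +
      consConv f.map.lin (coderOf f g d b) X Y x := by
    have := conv_map_eq_rec f (consConv b (g.map.twist d))
    rw [← coderOf_eq] at this
    exact LinearMap.congr_fun (congrFun (congrFun this X) Y) x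
  rw [Fam.lin_apply, h1, map_add, pr₁_consConv_of_counit _ (h.counit A.conil B.conil), add_zero]
  exact CocatHom.lin_eq_of_rec A.conil (twist_one A.conil g d) (counit_twist A.conil g d) X Y x

/-- The coderivations with prescribed linear part of degree `d`. -/
def coderLift (d : ℤ) : famDeg A.T.toGQuiver B f.obj g.obj d →ₗ[k]
    coderivations f.toQMap g.toQMap d :=
  ((coderOf f g d).domRestrict _).codRestrict _ fun b => isCoderivation_coderOf f g b.2

theorem coderLift_lin (d : ℤ) (b : famDeg A.T.toGQuiver B f.obj g.obj d) :
    Fam.lin (coderLift f g d b : Fam A.T.toGQuiver B.T.toGQuiver f.obj g.obj) = b :=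
  coderOf_lin f g b.2

/-- The linear part `r ↦ r pr₁` on `Coder(A, B)(f, g)`. -/
def coderLin : (Coder A B).Hom f g →ₗ[k] Fam A.T.toGQuiver B f.obj g.obj :=
  DirectSum.toModule k ℤ _ fun d =>
    { toFun := fun r => Fam.lin (r : Fam A.T.toGQuiver B.T.toGQuiver f.obj g.obj)
      map_add' := fun r r' => by funext X Y; exact LinearMap.comp_add _ _ _
      map_smul' := fun c r => by funext X Y; exact LinearMap.comp_smul _ _ _ }

/-- A coderivation of degree `d` as an element of `Coder(A, B)(f, g)`, which is the direct sum of
the modules of coderivations of all degrees. -/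
def coderOfDeg (d : ℤ) : coderivations f.toQMap g.toQMap d →ₗ[k] (Coder A B).Hom f g :=
  DirectSum.lof k ℤ (fun d => coderivations f.toQMap g.toQMap d) d

theorem coderLin_coderOfDeg (d : ℤ) (r : coderivations f.toQMap g.toQMap d) :
    coderLin f g (coderOfDeg f g d r) =
      Fam.lin (r : Fam A.T.toGQuiver B.T.toGQuiver f.obj g.obj) :=
  DirectSum.toModule_lof k _ _

theorem coderLin_hasDegree {d : ℤ} {r : (Coder A B).Hom f g}
    (hr : r ∈ ((Coder A B).Hom f g).deg d) : (coderLin f g r).HasDegree d := by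
  obtain ⟨r, rfl⟩ := hr
  have : (coderLin f g (coderOfDeg f g d r)).HasDegree d := by
    rw [coderLin_coderOfDeg]
    exact Fam.HasDegree.lin r.2.1
  exact this

/-- Elements of `Coder(A, B)(f, g)` are determined by their linear parts. -/
theorem coderLin_injective : Function.Injective (coderLin f g) := by
  rw [injective_iff_map_eq_zero]
  intro r hr
  -- The homogeneous components of `r` are recovered from the degrees of its values.
  have hr0 : ∀ (s : ⨁ d, coderivations f.toQMap g.toQMap d) (n d : ℤ) (X Y : A.Ob)
      (x : A.T.Hom X Y), x ∈ (A.T.Hom X Y).deg n →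
      (B.Hom (f.obj X) (g.obj Y)).proj (n + d) (coderLin f g s X Y x) =
        Fam.lin (s d : Fam A.T.toGQuiver B.T.toGQuiver f.obj g.obj) X Y x := by
    intro s n d X Y x hx
    induction s using DirectSum.induction_on with
    | zero =>
      rw [show coderLin f g (0 : ⨁ d, coderivations f.toQMap g.toQMap d) = 0 from map_zero _]
      rw [DirectSum.zero_apply]
      exact (map_zero _).trans (map_zero (B.pr₁ _ _)).symm
    | of e s =>
      have h1 : coderLin f g (DirectSum.of (fun d => coderivations f.toQMap g.toQMap d) e s) =
        Fam.lin (s : Fam A.T.toGQuiver B.T.toGQuiver f.obj g.obj) := coderLin_coderOfDeg f g e s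
      rw [h1, GMod.proj_of_mem _ _ (Fam.HasDegree.lin s.2.1 X Y n x hx)]
      by_cases h : e = d
      · subst h
        rw [if_pos rfl, DirectSum.of_eq_same]
      · rw [if_neg (by omega), DirectSum.of_eq_of_ne _ _ _ (Ne.symm h)]
        exact (map_zero (B.pr₁ _ _)).symm
    | add s s' h h' =>
      rw [show coderLin f g (s + s' : ⨁ d, coderivations f.toQMap g.toQMap d) =
        coderLin f g s + coderLin f g s' from map_add _ _ _]
      refine (map_add _ _ _).trans ((congrArg₂ (· + ·) h h').trans ?_)
      rw [DirectSum.add_apply]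
      exact (map_add (B.pr₁ _ _) _ _).symm
  have hr1 : ∀ d, (r : ⨁ d, coderivations f.toQMap g.toQMap d) d = 0 := by
    intro d
    refine Subtype.ext (IsCoderivation.eq_of_lin A.conil
      ((r : ⨁ d, coderivations f.toQMap g.toQMap d) d).2
      (coderivations f.toQMap g.toQMap d).zero_mem ?_)
    funext X Y
    refine GMod.hom_ext fun n x hx => ?_
    rw [← hr0 r n d X Y x hx, hr]
    exact (map_zero _).trans (map_zero (B.pr₁ _ _)).symm
  exact DFinsupp.ext hr1

end Convolution

section Action

variable {k : Type u} [CommRing k] {A B : GQuiver k}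

/-! ### The action of coderivations -/

theorem theta_one (f : CocatHom A.T B.T) :
    theta A B f f ((Coder A B).tOne f) = f.map := by
  rw [theta, GQuiver.tOne, GQuiver.tDesc_tIncl, thetaPow, GQuiver.powZeroDesc_powOne]

theorem theta_cons (f h g : CocatHom A.T B.T) {d : ℤ}
    (r : coderivations f.toQMap h.toQMap d) (t : (Coder A B).tHom h g) :
    theta A B f g ((Coder A B).cons f h g (coderOfDeg f h d r) t) =
      conv f.map (conv (linPart (A := A) (B := B) f.obj h.obj r)
        ((theta A B h g t).twist d)) := by
  suffices e : theta A B f g ∘ₗ (Coder A B).cons f h g (coderOfDeg f h d r) =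
      convL (A := A) (B := B) f.obj f.obj g.obj f.map ∘ₗ
        convL (A := A) (B := B) f.obj h.obj g.obj (linPart (A := A) (B := B) f.obj h.obj r) ∘ₗ
          twistL h.obj g.obj d ∘ₗ theta A B h g from LinearMap.congr_fun e t
  refine (Coder A B).tHom_hom_ext fun n p => ?_
  simp only [LinearMap.comp_apply]
  rw [GQuiver.cons_tIncl, theta, theta, GQuiver.tDesc_tIncl, GQuiver.tDesc_tIncl, thetaPow,
    GQuiver.powSuccDesc_powCons, coderOfDeg, DirectSum.toModule_lof]
  rfl

/-- The recursion for `θ`. -/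
theorem theta_cons_eq_rec (f h g : CocatHom A.T B.T) {d : ℤ}
    (r : coderivations f.toQMap h.toQMap d) (t : (Coder A B).tHom h g) :
    theta A B f g ((Coder A B).cons f h g (coderOfDeg f h d r) t) =
      consConv (Fam.lin (r : Fam A.T.toGQuiver B.T.toGQuiver f.obj h.obj))
        ((theta A B h g t).twist d) +
      consConv f.map.lin (theta A B f g ((Coder A B).cons f h g (coderOfDeg f h d r) t)) := by
  have h1 := theta_cons f h g r t
  have h2 := conv_tIncl₁ (Fam.lin (r : Fam A.T.toGQuiver B.T.toGQuiver f.obj h.obj))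
    ((theta A B h g t).twist d)
  rw [show (conv (linPart (A := A) (B := B) f.obj h.obj r) ((theta A B h g t).twist d)) = _ from h2]
    at h1
  rw [h1]
  exact conv_map_eq_rec f _

/-- Elements of `T B` are linear combinations of the `1_X` and of elements `a ⊗ t`. -/
theorem GQuiver.tHom_induction (B : GQuiver k) {X Y : B.Ob} {p : B.tHom X Y → Prop} (zero : p 0)
    (add : ∀ s t, p s → p t → p (s + t)) (smul : ∀ (c : k) t, p t → p (c • t))
    (one : ∀ e : X = Y, p (e ▸ B.tOne X)) (cons : ∀ Z a t, p (B.cons X Z Y a t))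
    (t : B.tHom X Y) : p t := by
  let S : Submodule k (B.tHom X Y) := Submodule.span k
    {t | (∃ e : X = Y, t = e ▸ B.tOne X) ∨ ∃ Z a s, t = B.cons X Z Y a s}
  have h : S.mkQ = 0 := B.tHom_ext
    (fun e => (Submodule.Quotient.mk_eq_zero _).mpr (Submodule.subset_span (Or.inl ⟨e, rfl⟩)))
    (fun Z a n q => (Submodule.Quotient.mk_eq_zero _).mpr
      (Submodule.subset_span (Or.inr ⟨Z, a, _, rfl⟩)))
  have ht : t ∈ S := (Submodule.Quotient.mk_eq_zero _).mp (LinearMap.congr_fun h t)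
  induction ht using Submodule.span_induction with
  | zero => exact zero
  | add s t _ _ hs ht => exact add s t hs ht
  | smul c t _ ht => exact smul c t ht
  | mem t ht =>
    obtain ⟨e, rfl⟩ | ⟨Z, a, s, rfl⟩ := ht
    · exact one e
    · exact cons Z a s

/-- Induction over the direct sum of the modules of coderivations. -/
theorem coder_induction {f g : CocatHom A.T B.T} {p : (Coder A B).Hom f g → Prop} (zero : p 0)
    (add : ∀ r s, p r → p s → p (r + s)) (of : ∀ d r, p (coderOfDeg f g d r))
    (r : (Coder A B).Hom f g) : p r := by
  refine DirectSum.induction_on (motive := p) r zero (fun d r => ?_) add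
  rw [← DirectSum.lof_eq_of k]
  exact of d r

theorem coder_tHom_induction {f g : CocatHom A.T B.T} {p : (Coder A B).tHom f g → Prop}
    (zero : p 0) (add : ∀ s t, p s → p t → p (s + t)) (smul : ∀ (c : k) t, p t → p (c • t))
    (one : ∀ e : f = g, p (e ▸ (Coder A B).tOne f))
    (cons : ∀ h d r t, p ((Coder A B).cons f h g (coderOfDeg f h d r) t))
    (t : (Coder A B).tHom f g) : p t := by
  refine (Coder A B).tHom_induction zero add smul one (fun h r t => ?_) t
  induction r using coder_induction with
  | zero => rw [map_zero]; exact zero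
  | add r s hr hs => rw [map_add]; exact add _ _ hr hs
  | of d r => exact cons h d r t

/-- `z ↦ (a) z θ`. -/
def thetaEval (f g : CocatHom A.T B.T) {X Y : A.Ob} (a : A.T.Hom X Y) :
    (Coder A B).tHom f g →ₗ[k] B.tHom (f.obj X) (g.obj Y) :=
  (Fam.evalL (C := A.T.toGQuiver) (D := B.T.toGQuiver) f.obj g.obj X Y).flip a ∘ₗ theta A B f g

theorem thetaEval_apply (f g : CocatHom A.T B.T) {X Y : A.Ob} (a : A.T.Hom X Y)
    (z : (Coder A B).tHom f g) : thetaEval f g a z = theta A B f g z X Y a := rfl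

theorem thetaEval_one (f : CocatHom A.T B.T) {X Y : A.Ob} (a : A.T.Hom X Y) :
    thetaEval f f a ((Coder A B).tOne f) = f.map X Y a := by
  rw [thetaEval_apply, theta_one]

theorem thetaEval_cons (f h g : CocatHom A.T B.T) {d : ℤ}
    (r : coderivations f.toQMap h.toQMap d) (t : (Coder A B).tHom h g) {X Y : A.Ob}
    (a : A.T.Hom X Y) : thetaEval f g a ((Coder A B).cons f h g (coderOfDeg f h d r) t) =
      consConv (Fam.lin (r : Fam A.T.toGQuiver B.T.toGQuiver f.obj h.obj))
        ((theta A B h g t).twist d) X Y a +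
      consConv f.map.lin
        (theta A B f g ((Coder A B).cons f h g (coderOfDeg f h d r) t)) X Y a :=
  LinearMap.congr_fun (congrFun (congrFun (theta_cons_eq_rec f h g r t) X) Y) a

theorem counit_theta (f g : CocatHom A.T B.T) (z : (Coder A B).tHom f g) (X Y : A.Ob)
    (a : A.T.Hom X Y) : B.T.counit _ _ (theta A B f g z X Y a) =
      (Coder A B).T.counit f g z * A.T.counit X Y a := by
  rw [← thetaEval_apply]
  induction z using coder_tHom_induction with
  | zero => rw [map_zero, map_zero, map_zero, zero_mul]
  | add s t hs ht => rw [map_add, map_add, map_add, add_mul, hs, ht]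
  | smul c t ht => rw [map_smul, map_smul, map_smul, ht, smul_mul_assoc]
  | one e =>
    cases e
    rw [thetaEval_one, GQuiver.T_counit_one, one_mul]
    exact f.map_counit X Y a
  | cons h d r t =>
    rw [thetaEval_cons, map_add, GQuiver.T_counit_cons, zero_mul]
    exact (congrArg₂ (· + ·) (Cocat.Conil.counit_consConv (C := A.T) _ _ X Y a)
      (Cocat.Conil.counit_consConv (C := A.T) _ _ X Y a)).trans (add_zero 0)

/-- `pr₁` of the action of `r ⊗ t`: zero unless `t` is of tensor degree `0`. -/
theorem pr₁_theta_cons (f h g : CocatHom A.T B.T) (r : (Coder A B).Hom f h)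
    {t : (Coder A B).tHom h g} (ht : (Coder A B).T.counit h g t = 0) (X Y : A.Ob)
    (a : A.T.Hom X Y) :
    B.pr₁ _ _ (thetaEval f g a ((Coder A B).cons f h g r t)) = 0 := by
  induction r using coder_induction with
  | zero => rw [map_zero, LinearMap.zero_apply, map_zero, map_zero]
  | add r s hr hs => rw [map_add, LinearMap.add_apply, map_add, map_add, hr, hs, add_zero]
  | of d r =>
    rw [thetaEval_cons, map_add]
    refine (congrArg₂ (· + ·) (pr₁_consConv_of_counit (C := A.T) _ ?_ X Y a)
      (pr₁_consConv_of_counit (C := A.T) _ ?_ X Y a)).trans (add_zero 0)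
    · intro X Y x
      rw [Fam.twist, LinearMap.comp_apply, counit_theta, ht, zero_mul]
    · intro X Y x
      rw [counit_theta, GQuiver.T_counit_cons, zero_mul]

/-- `pr₁` of the action of a single coderivation `r` is `r pr₁`. -/
theorem pr₁_theta_cons_one (f h : CocatHom A.T B.T) (r : (Coder A B).Hom f h) (X Y : A.Ob)
    (a : A.T.Hom X Y) :
    B.pr₁ _ _ (thetaEval f h a ((Coder A B).cons f h h r ((Coder A B).tOne h))) =
      coderLin f h r X Y a := by
  induction r using coder_induction with
  | zero => rw [map_zero, LinearMap.zero_apply, map_zero, map_zero, map_zero]; rfl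
  | add r s hr hs => rw [map_add, LinearMap.add_apply, map_add, map_add, hr, hs, map_add]; rfl
  | of d r =>
    rw [coderLin_coderOfDeg, thetaEval_cons, map_add, theta_one]
    refine (congrArg₂ (· + ·) (CocatHom.lin_eq_of_rec (C := A.T) A.conil
      (twist_one A.conil h d) (counit_twist A.conil h d) X Y a)
      (pr₁_consConv_of_counit (C := A.T) _ ?_ X Y a)).trans (add_zero _)
    intro X Y x
    rw [counit_theta, GQuiver.T_counit_cons, zero_mul]

theorem Cocat.Conil.weight_zero_cases {C : Cocat k} (hC : C.Conil) {X Y : C.Ob} {d : ℤ}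
    {x : C.Hom X Y} (hx : x ∈ hC.W X Y 0 d) :
    x = 0 ∨ ∃ (e : X = Y) (c : k), d = 0 ∧ x = c • (e ▸ C.one X) := by
  by_cases e : X = Y
  · subst e
    obtain ⟨c, rfl⟩ := Submodule.mem_span_singleton.mp (hC.weight_zero _ _ hx)
    by_cases hd : d = 0
    · exact Or.inr ⟨rfl, c, hd, rfl⟩
    · exact Or.inl (GMod.eq_zero_of_mem_mem _ hd (hC.le_deg _ _ _ _ hx)
        (Submodule.smul_mem _ c (hC.one_mem_deg X)))
  · rw [hC.weight_zero_ne _ _ e] at hx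
    exact Or.inl ((Submodule.mem_bot k).mp hx)

/-- Families of maps out of a tensor product have degree `e` if they do so on pure tensors. -/
theorem tensor_hasDegree {C D E : GQuiver k} {f g : C.Ob × D.Ob → E.Ob}
    (F : Fam (C.tensor D) E f g) (e : ℤ)
    (h : ∀ (X Y : C.Ob × D.Ob) (p q : ℤ) (x : C.Hom X.1 Y.1) (y : D.Hom X.2 Y.2),
      x ∈ (C.Hom X.1 Y.1).deg p → y ∈ (D.Hom X.2 Y.2).deg q →
      F X Y (x ⊗ₜ y) ∈ (E.Hom (f X) (g Y)).deg (p + q + e)) : F.HasDegree e := by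
  intro X Y n z hz
  have : ((C.Hom X.1 Y.1).tensor (D.Hom X.2 Y.2)).deg n ≤
      ((E.Hom (f X) (g Y)).deg (n + e)).comap (F X Y) := by
    refine Submodule.span_le.mpr ?_
    rintro _ ⟨p, q, rfl, x, hx, y, hy, rfl⟩
    exact h X Y p q x y hx hy
  exact this hz

/-- The linear part of the action has degree `0`. -/
theorem pr₁_theta_mem {f g : CocatHom A.T B.T} {X Y : A.Ob} {p q : ℤ} {a : A.T.Hom X Y}
    (ha : a ∈ (A.T.Hom X Y).deg p) {z : (Coder A B).tHom f g}
    (hz : z ∈ ((Coder A B).tHom f g).deg q) :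
    B.pr₁ _ _ (thetaEval f g a z) ∈ (B.Hom (f.obj X) (g.obj Y)).deg (p + q) := by
  have : ⨆ n, (Coder A B).tW f g n q ≤ Submodule.comap (B.pr₁ _ _ ∘ₗ thetaEval f g a)
      ((B.Hom (f.obj X) (g.obj Y)).deg (p + q)) := by
    refine iSup_le fun n => ?_
    cases n with
    | zero =>
      intro z hz
      rw [Submodule.mem_comap, LinearMap.comp_apply]
      obtain rfl | ⟨e, c, rfl, rfl⟩ := (Coder A B).conil.weight_zero_cases hz
      · rw [map_zero, map_zero]
        exact zero_mem _
      · subst e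
        rw [map_smul, map_smul]
        refine Submodule.smul_mem _ c ?_
        rw [show thetaEval f f a ((Coder A B).T.one f) = _ from thetaEval_one f a]
        exact f.lin_hasDegree _ _ _ _ ha
    | succ n =>
      refine (Coder A B).tW_succ_le fun h i j hij r hr t ht => ?_
      rw [Submodule.mem_comap, LinearMap.comp_apply]
      obtain rfl | hn := n.eq_zero_or_pos
      · obtain rfl | ⟨e, c, rfl, rfl⟩ := (Coder A B).conil.weight_zero_cases ht
        · rw [map_zero, map_zero, map_zero]
          exact zero_mem _
        · subst e
          rw [map_smul, map_smul, map_smul]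
          refine Submodule.smul_mem _ c ?_
          have h1 := pr₁_theta_cons_one f h r X Y a
          rw [add_zero] at hij
          rw [show B.pr₁ _ _ (thetaEval f h a ((Coder A B).cons f h h r ((Coder A B).T.one h))) = _
            from h1, ← hij]
          exact coderLin_hasDegree f h hr _ _ _ _ ha
      · rw [pr₁_theta_cons _ _ _ _ ((Coder A B).conil.counit_pos _ _ _ _ _ hn ht)]
        exact zero_mem _
  exact this ((Coder A B).deg_le_iSup_tW _ _ _ hz)

/-- The linear part of the action. -/
def actionLin (A B : GQuiver k) :
    Fam (A.T.tensor (Coder A B).T).toGQuiver B (action A B).obj (action A B).obj :=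
  Fam.lin (C := A.T.tensor (Coder A B).T) (action A B).map

theorem actionLin_tmul (X Y : A.Ob × CocatHom A.T B.T) (a : A.T.Hom X.1 Y.1)
    (z : (Coder A B).T.Hom X.2 Y.2) :
    actionLin A B X Y (a ⊗ₜ z) = B.pr₁ _ _ (thetaEval X.2 Y.2 a z) := rfl

theorem actionLin_hasDegree : (actionLin A B).HasDegree 0 := by
  refine tensor_hasDegree (C := A.tq) (D := (Coder A B).tq) _ 0 fun X Y p q a z ha hz => ?_
  rw [add_zero]
  exact pr₁_theta_mem ha hz

theorem actionLin_one (X : A.Ob × CocatHom A.T B.T) :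
    actionLin A B X X ((A.T.tensor (Coder A B).T).one X) = 0 := by
  refine (actionLin_tmul X X (A.tOne X.1) ((Coder A B).tOne X.2)).trans ?_
  rw [thetaEval_one]
  exact X.2.lin_one X.1

/-- The convolution `pr₁ α ⊗ α` evaluated at `u ⊗ (s ⊗ t)`. -/
theorem consMap_action (X Y : A.Ob × CocatHom A.T B.T) (h : CocatHom A.T B.T) {d : ℤ}
    {s : (Coder A B).tHom X.2 h} (hs : s ∈ ((Coder A B).tHom X.2 h).deg d)
    (t : (Coder A B).tHom h Y.2) (u : A.T.Mid X.1 Y.1) :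
    consMap (C := A.T.tensor (Coder A B).T) (actionLin A B) (action A B).map X Y
        (midShuffle A.tq (Coder A B).tq X Y (u ⊗ₜ (Coder A B).tq.midIncl X.2 h Y.2 (s ⊗ₜ t))) =
      consMap (Fam.lin (theta A B X.2 h s)) ((theta A B h Y.2 t).twist d) X.1 Y.1 u := by
  induction u using A.T.mid_induction with
  | zero => rw [TensorProduct.zero_tmul, map_zero, map_zero, map_zero]; rfl
  | add u u' hu hu' => rw [TensorProduct.add_tmul, map_add, map_add, map_add, hu, hu']; rfl
  | mem Z _ a _ i a' ha' =>
    rw [midShuffle_hom A.tq (Coder A B).tq X Y Z h a t ha' hs, map_smul]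
    refine Eq.trans (congrArg _ (consMap_midIncl (C := A.T.tensor (Coder A B).T) (actionLin A B)
      (action A B).map X (Z, h) Y (a ⊗ₜ s) (a' ⊗ₜ t))) ?_
    rw [consMap_midIncl, Fam.twist, LinearMap.comp_apply, GMod.sgn_mem _ d ha', map_smul, map_smul,
      mul_comm]
    rfl

end Action

section ActionHom

variable {k : Type u} [CommRing k] {A B : GQuiver k}

theorem Fam.twist_even {C D : GQuiver k} {f g : C.Ob → D.Ob} (r : Fam C D f g) {n : ℤ}
    (hn : Even n) : r.twist n = r := by
  funext X Y
  refine LinearMap.ext fun x => ?_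
  rw [Fam.twist, LinearMap.comp_apply, GMod.sgn_even _ hn]

theorem consMap_zero_left {C : Cocat k} {f g h : C.Ob → B.Ob}
    (G : Fam C.toGQuiver B.T.toGQuiver g h) (X Y : C.Ob) (u : C.Mid X Y) :
    consMap (B := B) (0 : Fam C.toGQuiver B f g) G X Y u = 0 := by
  suffices e : consMap (B := B) (0 : Fam C.toGQuiver B f g) G X Y = 0 from LinearMap.congr_fun e u
  refine C.mid_ext fun Z x y => ?_
  rw [consMap_midIncl]
  exact LinearMap.congr_fun (map_zero (B.cons (f X) (g Z) (h Y))) _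

/-- The left counit law, for linear maps which are only known to vanish on homogeneous elements. -/
theorem Cocat.Conil.counit_left_of_mem {C : Cocat k} (hC : C.Conil) {X Y : C.Ob} {N : Type*}
    [AddCommGroup N] [Module k N] (t : C.Mid X Y →ₗ[k] N)
    (ht : ∀ Z d a b, a ∈ (C.Hom X Z).deg d → C.counit X Z a = 0 →
      t (C.midIncl X Z Y (a ⊗ₜ b)) = 0) (x : C.Hom X Y) :
    t (C.comul X Y x) = t (C.midIncl X X Y (C.one X ⊗ₜ x)) := by
  induction x using hC.induction with
  | zero => simp
  | add x y hx hy => simp [TensorProduct.tmul_add, hx, hy]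
  | mem n d x hx =>
    have := C.midW_map t ⊥ (fun Z i j p q h1 h2 _ a ha b hb => by
      simpa using ht Z p a b (hC.le_deg _ _ _ _ ha) (hC.counit_pos _ _ _ _ a h1 ha))
      (hC.comul_left X Y n d x hx)
    simpa [sub_eq_zero] using this

theorem unitFam_tensor_one (f : CocatHom A.T B.T) (X Y : A.Ob) (a : A.T.Hom X Y) :
    (A.T.tensor (Coder A B).T).unitFam B.T (action A B).obj (X, f) (Y, f)
      (a ⊗ₜ (Coder A B).tOne f) = A.T.unitFam B.T f.obj X Y a := by
  have h : (A.T.tensor (Coder A B).T).counit (X, f) (Y, f) (a ⊗ₜ (Coder A B).tOne f) =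
      A.T.counit X Y a := by
    change A.T.counit X Y a * (Coder A B).T.counit f f ((Coder A B).tOne f) = _
    rw [GQuiver.T_counit_one, mul_one]
  by_cases e : X = Y
  · subst e
    refine (Cocat.unitFam_self (A.T.tensor (Coder A B).T) B.T (action A B).obj (X, f) _).trans ?_
    rw [h]
    exact (Cocat.unitFam_self A.T B.T f.obj X a).symm
  · have h0 := A.conil.counit_of_ne e a
    rw [Cocat.unitFam_of_counit _ _ _ h0]
    exact Cocat.unitFam_of_counit (A.T.tensor (Coder A B).T) B.T (action A B).obj (h.trans h0)

/-- The right hand side of the recursion for the action. -/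
def actionRec (X Y : A.Ob × CocatHom A.T B.T) :
    (A.T.tensor (Coder A B).T).Hom X Y →ₗ[k] B.tHom ((action A B).obj X) ((action A B).obj Y) :=
  (A.T.tensor (Coder A B).T).unitFam B.T (action A B).obj X Y +
    consConv (C := A.T.tensor (Coder A B).T) (actionLin A B) (action A B).map X Y

theorem actionRec_tmul (X Y : A.Ob × CocatHom A.T B.T) (a : A.T.Hom X.1 Y.1)
    (z : (Coder A B).T.Hom X.2 Y.2) : actionRec X Y (a ⊗ₜ z) =
      (A.T.tensor (Coder A B).T).unitFam B.T (action A B).obj X Y (a ⊗ₜ z) +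
        consMap (C := A.T.tensor (Coder A B).T) (actionLin A B) (action A B).map X Y
          (midShuffle A.tq (Coder A B).tq X Y
            (A.T.comul X.1 Y.1 a ⊗ₜ (Coder A B).T.comul X.2 Y.2 z)) := rfl

theorem theta_cons_one_lin (f h : CocatHom A.T B.T) {d : ℤ}
    (r : coderivations f.toQMap h.toQMap d) :
    Fam.lin (theta A B f h ((Coder A B).cons f h h (coderOfDeg f h d r) ((Coder A B).tOne h))) =
      Fam.lin (r : Fam A.T.toGQuiver B.T.toGQuiver f.obj h.obj) := by
  funext X Y
  refine LinearMap.ext fun a => ?_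
  rw [← coderLin_coderOfDeg]
  exact pr₁_theta_cons_one f h _ X Y a

theorem coderOfDeg_mem (f g : CocatHom A.T B.T) (d : ℤ) (r : coderivations f.toQMap g.toQMap d) :
    coderOfDeg f g d r ∈ ((Coder A B).Hom f g).deg d := ⟨r, rfl⟩

/-- The recursion `α = ε 1 + (α pr₁ ⊗ α)` for the action, on `a ⊗ z`. For `z = r ⊗ t`, the
comultiplication of `z` consists of `1 ⊗ z` and of tensors `(r ⊗ t') ⊗ t''`. As `α pr₁` vanishes on
tensors of length at least two in the second argument, only `1 ⊗ z` and `r ⊗ t` contribute, and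
these are the two summands in `theta_cons_eq_rec`. -/
theorem thetaEval_eq_actionRec (f g : CocatHom A.T B.T) {X Y : A.Ob} (a : A.T.Hom X Y)
    (z : (Coder A B).tHom f g) :
    thetaEval f g a z = actionRec (A := A) (B := B) (X, f) (Y, g) (a ⊗ₜ z) := by
  induction z using coder_tHom_induction with
  | zero => rw [TensorProduct.tmul_zero, map_zero, map_zero]; rfl
  | add s t hs ht => rw [TensorProduct.tmul_add, map_add, map_add, hs, ht]; rfl
  | smul c t ht => rw [TensorProduct.tmul_smul, map_smul, map_smul, ht]; rfl
  | one e =>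
    cases e
    have h1 := consMap_action (X, f) (Y, f) f
      ((Coder A B).conil.one_mem_deg f) ((Coder A B).tOne f) (A.T.comul X Y a)
    rw [Fam.twist_even _ (by simp)] at h1
    rw [thetaEval_one, actionRec_tmul, GQuiver.T_comul_one, unitFam_tensor_one]
    refine Eq.trans ?_ (congrArg (A.T.unitFam B.T f.obj X Y a + ·) h1.symm)
    have h2 := theta_one f
    change f.map X Y a = _ + consMap (Fam.lin (theta A B f f ((Coder A B).tOne f)))
      (theta A B f f ((Coder A B).tOne f)) X Y (A.T.comul X Y a)
    rw [h2]
    exact LinearMap.congr_fun (congrFun (congrFun (f.map_eq_rec A.conil) X) Y) a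
  | cons h d r t =>
    generalize hr' : coderOfDeg f h d r = r'
    have hr : r' ∈ ((Coder A B).Hom f h).deg d := hr' ▸ coderOfDeg_mem f h d r
    have h0 : (A.T.tensor (Coder A B).T).counit (X, f) (Y, g)
        (a ⊗ₜ (Coder A B).cons f h g r' t) = 0 := by
      change A.T.counit X Y a * (Coder A B).T.counit f g ((Coder A B).cons f h g r' t) = 0
      rw [GQuiver.T_counit_cons, mul_zero]
    have h1 := consMap_action (X, f) (Y, g) f ((Coder A B).conil.one_mem_deg f)
      ((Coder A B).cons f h g r' t) (A.T.comul X Y a)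
    rw [Fam.twist_even _ (by simp)] at h1
    -- `τ` is the contribution of the tensors `(r ⊗ t') ⊗ t''`.
    let τ := consMap (C := A.T.tensor (Coder A B).T) (actionLin A B) (action A B).map (X, f)
      (Y, g) ∘ₗ midShuffle A.tq (Coder A B).tq (X, f) (Y, g) ∘ₗ
        TensorProduct.mk k (A.T.Mid X Y) ((Coder A B).T.Mid f g) (A.T.comul X Y a) ∘ₗ
          (Coder A B).consMid f h g r'
    have hτ : ∀ l e (t' : (Coder A B).tHom h l) (t'' : (Coder A B).tHom l g),
        t' ∈ ((Coder A B).tHom h l).deg e → τ ((Coder A B).tq.midIncl h l g (t' ⊗ₜ t'')) =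
          consMap (Fam.lin (theta A B f l ((Coder A B).cons f h l r' t')))
            ((theta A B l g t'').twist (d + e)) X Y (A.T.comul X Y a) := by
      intro l e t' t'' ht'
      have := consMap_action (X, f) (Y, g) l ((Coder A B).cons_mem_deg hr ht') t'' (A.T.comul X Y a)
      rw [← GQuiver.consMid_midIncl] at this
      exact this
    have h2 : τ ((Coder A B).T.comul h g t) =
        τ ((Coder A B).tq.midIncl h h g ((Coder A B).tOne h ⊗ₜ t)) := by
      refine (Coder A B).conil.counit_left_of_mem τ (fun l e t' t'' ht' ht0 => ?_) t
      rw [hτ l e t' t'' ht']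
      have : Fam.lin (theta A B f l ((Coder A B).cons f h l r' t')) = 0 := by
        funext X Y
        exact LinearMap.ext fun a => pr₁_theta_cons f h l r' ht0 X Y a
      rw [this, consMap_zero_left]; rfl
    rw [hτ h 0 _ _ ((Coder A B).conil.one_mem_deg h), add_zero] at h2
    rw [actionRec_tmul, Cocat.unitFam_of_counit (A.T.tensor (Coder A B).T) B.T (action A B).obj h0,
      zero_add, GQuiver.T_comul_cons, TensorProduct.tmul_add, map_add, map_add]
    refine Eq.trans ?_ (congrArg₂ (· + ·) h1.symm h2.symm)
    subst hr'
    rw [thetaEval_cons, theta_cons_one_lin, add_comm]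
    refine congrArg (· + _) ?_
    have h3 := theta_one f
    change _ = consMap (Fam.lin (theta A B f f ((Coder A B).tOne f))) _ X Y (A.T.comul X Y a)
    rw [h3]
    rfl

theorem action_eq_rec : (action A B).map =
    (A.T.tensor (Coder A B).T).unitFam B.T (action A B).obj +
      consConv (C := A.T.tensor (Coder A B).T) (actionLin A B) (action A B).map := by
  funext X Y
  exact TensorProduct.ext' fun a z => thetaEval_eq_actionRec X.2 Y.2 a z

/-- The action as a homomorphism of cocategories; its underlying map of quivers is `action A B` by
definition. -/
def actionHom (A B : GQuiver k) : CocatHom (A.T.tensor (Coder A B).T) B.T :=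
  Cocat.Conil.cohomOfRec (C := A.T.tensor (Coder A B).T) (B := B)
    (A.conil.tensor (Coder A B).conil) (action A B).obj (actionLin A B)
    actionLin_hasDegree (fun X => actionLin_one (A := A) (B := B) X) (action A B).map action_eq_rec

end ActionHom

section Homs

variable {k : Type u} [CommRing k]

/-! ### Composition and tensor products of homomorphisms -/

theorem CocatHom.toQMap_injective {C D : Cocat k} {f g : CocatHom C D}
    (h : f.toQMap = g.toQMap) : f = g := by
  cases f
  cases g
  cases h
  rfl

/-- The identity homomorphism. -/
def CocatHom.id (C : Cocat k) : CocatHom C C where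
  toQMap := QMap.id C.toGQuiver
  hasDegree X Y n x hx := by rw [add_zero]; exact hx
  map_comul X Y x := by
    suffices e : LinearMap.id = (QMap.id C.toGQuiver).map.tens (QMap.id C.toGQuiver).map X Y from
      LinearMap.congr_fun e _
    refine C.mid_ext fun Z x y => Eq.symm ?_
    exact Fam.tens_midIncl (QMap.id C.toGQuiver).map (QMap.id C.toGQuiver).map X Z Y (x ⊗ₜ y)
  map_counit _ _ _ := rfl
  map_one _ := rfl

/-- The composition of homomorphisms. -/
def CocatHom.comp {C D E : Cocat k} (f : CocatHom C D) (g : CocatHom D E) : CocatHom C E where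
  toQMap := f.toQMap.comp g.toQMap
  hasDegree X Y n x hx := by
    have := g.hasDegree _ _ _ _ (f.hasDegree X Y n x hx)
    rw [add_zero] at this
    exact this
  map_comul X Y x := by
    refine (g.map_comul _ _ (f.map X Y x)).trans ?_
    rw [f.map_comul]
    exact Fam.tens_comp f.map f.map g.map g.map X Y _
  map_counit X Y x := (g.map_counit _ _ _).trans (f.map_counit X Y x)
  map_one X := (congrArg (g.map _ _) (f.map_one X)).trans (g.map_one _)

/-- The families `r ⊗ s` on a tensor product, without signs. -/
def tensFam {C D C' D' : GQuiver k} {f f' : C.Ob → C'.Ob} {g g' : D.Ob → D'.Ob} (r : Fam C C' f f')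
    (s : Fam D D' g g') : Fam (C.tensor D) (C'.tensor D') (fun X => (f X.1, g X.2))
      (fun X => (f' X.1, g' X.2)) :=
  fun X Y => TensorProduct.map (r X.1 Y.1) (s X.2 Y.2)

/-- The interchange of factors and tensor products of maps: up to the sign `(-1) ^ (i * j)`, the
map `(r ⊗ r') ⊗ (s ⊗ s')` corresponds to `(r ⊗ s) ⊗ (r' ⊗ s')`, where `s` and `r'` are twisted
because `tens` and `tensFam` do not contain the signs of Koszul's rule. -/
theorem midShuffle_tens {C D C' D' : GQuiver k} {f f' f'' : C.Ob → C'.Ob} {g g' g'' : D.Ob → D'.Ob}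
    (r : Fam C C' f f') (r' : Fam C C' f' f'') (s : Fam D D' g g') (s' : Fam D D' g' g'')
    {i j : ℤ} (hr : r'.HasDegree i) (hs : s.HasDegree j) (X Y : C.Ob × D.Ob)
    (u : C.Mid X.1 Y.1) (v : D.Mid X.2 Y.2) :
    midShuffle C' D' (f X.1, g X.2) (f'' Y.1, g'' Y.2)
        (r.tens r' X.1 Y.1 u ⊗ₜ s.tens s' X.2 Y.2 v) =
      ksign k (i * j) • Fam.tens (D := C'.tensor D') (tensFam r (s.twist i))
        (tensFam (r'.twist j) s') X Y (midShuffle C D X Y (u ⊗ₜ v)) := by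
  induction u using C.mid_induction with
  | zero => simp only [TensorProduct.zero_tmul, map_zero, smul_zero]
  | add u u' hu hu' => simp only [TensorProduct.add_tmul, map_add, smul_add, hu, hu']
  | mem Z _ a _ p a' ha' =>
    induction v using D.mid_induction with
    | zero => simp only [TensorProduct.tmul_zero, map_zero, smul_zero]
    | add u u' hu hu' => simp only [TensorProduct.tmul_add, map_add, smul_add, hu, hu']
    | mem W q b hb _ b' _ =>
      rw [Fam.tens_midIncl, Fam.tens_midIncl, TensorProduct.map_tmul, TensorProduct.map_tmul,
        midShuffle_hom C D X Y Z W a b' ha' hb, map_smul]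
      refine (midShuffle_hom C' D' (f X.1, g X.2) (f'' Y.1, g'' Y.2) (f' Z) (g' W) (r X.1 Z a)
        (s' W Y.2 b') (hr _ _ _ _ ha') (hs _ _ _ _ hb)).trans ?_
      rw [smul_smul, Fam.tens_midIncl, TensorProduct.map_tmul]
      have h1 : tensFam r (s.twist i) X (Z, W) (a ⊗ₜ b) =
          ksign k (i * q) • (r X.1 Z a ⊗ₜ s X.2 W b) := by
        rw [tensFam, TensorProduct.map_tmul, Fam.twist, LinearMap.comp_apply, GMod.sgn_mem _ i hb,
          map_smul, TensorProduct.tmul_smul]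
      have h2 : tensFam (r'.twist j) s' (Z, W) Y (a' ⊗ₜ b') =
          ksign k (j * p) • (r' Z Y.1 a' ⊗ₜ s' W Y.2 b') := by
        rw [tensFam, TensorProduct.map_tmul, Fam.twist, LinearMap.comp_apply, GMod.sgn_mem _ j ha',
          map_smul, TensorProduct.smul_tmul']
      rw [h1, h2, TensorProduct.smul_tmul_smul, map_smul, smul_smul, ← ksign_add, ← ksign_add,
        ← ksign_add]
      congr 2
      ring

/-- The tensor product of homomorphisms. -/
def CocatHom.tensor {C D C' D' : Cocat k} (f : CocatHom C C') (g : CocatHom D D') :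
    CocatHom (C.tensor D) (C'.tensor D') where
  toQMap := f.toQMap.tensor g.toQMap
  hasDegree := by
    refine tensor_hasDegree _ 0 fun X Y p q x y hx hy => ?_
    have := GMod.tmul_mem _ _ (f.hasDegree _ _ _ _ hx) (g.hasDegree _ _ _ _ hy)
    rw [add_zero, add_zero] at this
    rw [add_zero]
    exact this
  map_comul X Y x := by
    induction x using TensorProduct.induction_on with
    | zero => simp only [map_zero]
    | add x y hx hy => simp only [map_add, hx, hy]
    | tmul x y =>
      have h := midShuffle_tens f.map f.map g.map g.map f.hasDegree g.hasDegree X Y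
        (C.comul X.1 Y.1 x) (D.comul X.2 Y.2 y)
      rw [Fam.twist_even _ Even.zero, Fam.twist_even _ Even.zero, mul_zero, ksign_zero, one_smul,
        ← f.map_comul, ← g.map_comul] at h
      exact h
  map_counit X Y x := by
    induction x using TensorProduct.induction_on with
    | zero => simp only [map_zero]
    | add x y hx hy => simp only [map_add, hx, hy]
    | tmul x y => exact congrArg₂ (· * ·) (f.map_counit _ _ x) (g.map_counit _ _ y)
  map_one X := congrArg₂ (· ⊗ₜ[k] ·) (f.map_one X.1) (g.map_one X.2)

/-- The maps of `T F`. -/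
def QMap.tFam {A B : GQuiver k} (F : QMap A B) : Fam A.T.toGQuiver B.T.toGQuiver F.obj F.obj :=
  fun X Y => A.tDesc fun n => F.powMap n X Y

theorem QMap.T_eq {A B : GQuiver k} (F : QMap A B) : F.T = ⟨F.obj, F.tFam⟩ := rfl

theorem QMap.tFam_one {A B : GQuiver k} (F : QMap A B) (X : A.Ob) :
    F.tFam X X (A.tOne X) = B.tOne (F.obj X) := by
  rw [QMap.tFam, GQuiver.tOne, GQuiver.tDesc_tIncl, QMap.powMap, GQuiver.powZeroDesc_powOne]

theorem QMap.tFam_cons {A B : GQuiver k} (F : QMap A B) (X Z Y : A.Ob) (a : A.Hom X Z)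
    (t : A.tHom Z Y) : F.tFam X Y (A.cons X Z Y a t) =
      B.cons _ _ _ (F.map X Z a) (F.tFam Z Y t) := by
  suffices e : F.tFam X Y ∘ₗ A.cons X Z Y a =
      B.cons _ _ _ (F.map X Z a) ∘ₗ F.tFam Z Y from LinearMap.congr_fun e t
  refine A.tHom_hom_ext fun n p => ?_
  rw [LinearMap.comp_apply, LinearMap.comp_apply, GQuiver.cons_tIncl, QMap.tFam, QMap.tFam,
    GQuiver.tDesc_tIncl, GQuiver.tDesc_tIncl, QMap.powMap, GQuiver.powSuccDesc_powCons]
  rfl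

theorem QMap.T_id (A : GQuiver k) : (QMap.id A).T = QMap.id A.T.toGQuiver := by
  have key : ∀ (X Y : A.Ob) (t : A.tHom X Y), (QMap.id A).tFam X Y t = t := by
    suffices h : ∀ n (X Y : A.Ob) (p : A.pow n X Y),
        (QMap.id A).tFam X Y (A.tIncl n X Y p) = A.tIncl n X Y p by
      intro X Y t
      suffices e : (QMap.id A).tFam X Y = LinearMap.id from LinearMap.congr_fun e t
      exact A.tHom_hom_ext fun n p => h n X Y p
    intro n
    induction n with
    | zero =>
      intro X Y p
      suffices e : (QMap.id A).tFam X Y ∘ₗ A.tIncl 0 X Y = A.tIncl 0 X Y from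
        LinearMap.congr_fun e p
      refine A.pow_zero_ext fun e => ?_
      subst e
      exact QMap.tFam_one (QMap.id A) X
    | succ n ih =>
      intro X Y p
      suffices e : (QMap.id A).tFam X Y ∘ₗ A.tIncl (n + 1) X Y = A.tIncl (n + 1) X Y from
        LinearMap.congr_fun e p
      refine A.pow_succ_ext fun Z a p => ?_
      have h1 := A.cons_tIncl X Z Y n a p
      change (QMap.id A).tFam X Y (A.tIncl (n + 1) X Y (A.powCons n X Z Y a p)) =
        A.tIncl (n + 1) X Y (A.powCons n X Z Y a p)
      refine (congrArg _ h1.symm).trans (Eq.trans ?_ h1)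
      refine (QMap.tFam_cons (QMap.id A) X Z Y a _).trans ?_
      exact congrArg (A.cons X Z Y a) (ih Z Y p)
  rw [QMap.T_eq]
  refine congrArg (QMap.mk (fun X => X)) ?_
  funext X Y
  exact LinearMap.ext fun t => key X Y t

/-- The linear part of `T F`. -/
def QMap.tLin {A B : GQuiver k} (F : QMap A B) : Fam A.T.toGQuiver B F.obj F.obj :=
  fun X Y => F.map X Y ∘ₗ A.pr₁ X Y

/-- The recursion which characterizes `T F` as the homomorphism with linear part `pr₁ F`. -/
theorem QMap.tFam_eq_rec {A B : GQuiver k} (F : QMap A B) :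
    F.tFam = A.T.unitFam B.T F.obj + consConv F.tLin F.tFam := by
  have h1 : ∀ X, F.tLin X X (A.tOne X) = 0 := fun X => by
    rw [QMap.tLin, LinearMap.comp_apply, A.pr₁_one, map_zero]
  funext X Y
  refine A.tHom_ext (fun e => ?_) fun Z a n p => ?_
  · subst e
    have h2 := A.conil.unitFam_one B.T F.obj X
    have h3 := A.conil.consConv_one h1 F.tFam X
    refine (F.tFam_one X).trans ?_
    exact ((congrArg₂ (· + ·) h2 h3).trans (add_zero _)).symm
  · generalize A.tIncl n Z Y p = t
    rw [QMap.tFam_cons]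
    change _ = A.T.unitFam B.T F.obj X Y (A.cons X Z Y a t) +
      consMap F.tLin F.tFam X Y (A.T.comul X Y (A.cons X Z Y a t))
    rw [Cocat.unitFam_of_counit _ _ _ (A.T_counit_cons X Z Y a t), zero_add, A.T_comul_cons,
      map_add, consMap_midIncl, h1, map_zero, LinearMap.zero_apply, zero_add]
    have := A.conil.counit_left (consMap F.tLin F.tFam X Y ∘ₗ A.consMid X Z Y a)
      (fun W b c hb => by
        rw [LinearMap.comp_apply, A.consMid_midIncl, consMap_midIncl, QMap.tLin,
          LinearMap.comp_apply, A.pr₁_cons_of_counit _ _ _ _ hb, map_zero, map_zero]; rfl) t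
    refine Eq.trans ?_ this.symm
    rw [LinearMap.comp_apply, A.consMid_midIncl, consMap_midIncl, QMap.tLin, LinearMap.comp_apply]
    exact congrArg (fun b => B.cons _ _ _ (F.map X Z b) (F.tFam Z Y t)) (A.pr₁_cons_one X Z a).symm

theorem QMap.tLin_one {A B : GQuiver k} (F : QMap A B) (X : A.Ob) :
    F.tLin X X (A.T.one X) = 0 :=
  (congrArg (F.map X X) (A.pr₁_one X)).trans (map_zero _)

theorem QMap.tLin_hasDegree {A B : GQuiver k} {F : QMap A B} (hF : F.map.HasDegree 0) :
    F.tLin.HasDegree 0 :=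
  fun X Y n _ hx => hF X Y n _ (A.pr₁_mem hx)

/-- `T F` as a homomorphism. -/
def QMap.tHom {A B : GQuiver k} (F : QMap A B) (hF : F.map.HasDegree 0) : CocatHom A.T B.T :=
  A.conil.cohomOfRec F.obj F.tLin (QMap.tLin_hasDegree hF) F.tLin_one F.tFam F.tFam_eq_rec

theorem QMap.pr₁_tFam {A B : GQuiver k} {F : QMap A B} (hF : F.map.HasDegree 0) (X Y : A.Ob)
    (t : A.tHom X Y) : B.pr₁ _ _ (F.tFam X Y t) = F.map X Y (A.pr₁ X Y t) :=
  LinearMap.congr_fun (congrFun (congrFun (A.conil.lin_of_rec (QMap.tLin_hasDegree hF) F.tLin_one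
    F.tFam_eq_rec) X) Y) t

/-- A linear map of degree `e` from a graded module `M` to families of maps `T A → B` lifts to a
linear map of degree `e` from `M` to `Coder(A, B)(f, g)`. -/
theorem exists_coderLift {A B : GQuiver k} (f g : CocatHom A.T B.T) (M : GMod.{u, u} k) (e : ℤ)
    (E : M →ₗ[k] Fam A.T.toGQuiver B f.obj g.obj)
    (hE : ∀ d, ∀ c ∈ M.deg d, (E c).HasDegree (d + e)) :
    ∃ E' : M →ₗ[k] (Coder A B).Hom f g,
      (∀ d, ∀ c ∈ M.deg d, E' c ∈ ((Coder A B).Hom f g).deg (d + e)) ∧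
        ∀ c, coderLin f g (E' c) = E c := by
  let E' : M →ₗ[k] (Coder A B).Hom f g := M.lift fun d =>
    coderOfDeg f g (d + e) ∘ₗ coderLift f g (d + e) ∘ₗ
      (E.domRestrict (M.deg d)).codRestrict (famDeg A.T.toGQuiver B f.obj g.obj (d + e))
        fun c => hE d c c.2
  have hE' : ∀ d (c : M) (hc : c ∈ M.deg d), E' c = coderOfDeg f g (d + e) (coderLift f g (d + e)
      ⟨E c, hE d c hc⟩) := fun d c hc => M.lift_of_mem _ hc
  refine ⟨E', fun d c hc => ?_, fun c => ?_⟩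
  · rw [hE' d c hc]
    exact coderOfDeg_mem _ _ _ _
  · suffices h : coderLin f g ∘ₗ E' = E from LinearMap.congr_fun h c
    refine GMod.hom_ext fun d c hc => ?_
    rw [LinearMap.comp_apply, hE' d c hc, coderLin_coderOfDeg, coderLift_lin]

end Homs

section Curry

variable {k : Type u} [CommRing k] {A B Q : GQuiver k}

/-! ### The universal property of the action -/

/-- The linear part of the action on the kernel of the counit: it is zero on the summands `Tⁿ` with
`n ≥ 2`, and on `T¹` it is `r ↦ r pr₁`. -/
theorem pr₁_thetaEval (f g : CocatHom A.T B.T) {X Y : A.Ob} (a : A.T.Hom X Y)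
    {z : (Coder A B).tHom f g} (hz : (Coder A B).T.counit f g z = 0) :
    B.pr₁ _ _ (thetaEval f g a z) = coderLin f g ((Coder A B).pr₁ f g z) X Y a := by
  let F : (Coder A B).tHom f g →ₗ[k] B.Hom (f.obj X) (g.obj Y) :=
    B.pr₁ _ _ ∘ₗ thetaEval f g a -
      (Fam.evalL (C := A.T.toGQuiver) (D := B) f.obj g.obj X Y).flip a ∘ₗ coderLin f g ∘ₗ
        (Coder A B).pr₁ f g
  have hF : ∀ z, F z = B.pr₁ _ _ (thetaEval f g a z) -
      coderLin f g ((Coder A B).pr₁ f g z) X Y a := fun z => rfl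
  refine sub_eq_zero.mp ((hF z).symm.trans ?_)
  refine (Coder A B).conil.eq_zero_of_counit F (fun n d hn z hz => ?_) hz
  obtain ⟨n, rfl⟩ := Nat.exists_eq_succ_of_ne_zero hn.ne'
  suffices h : (Coder A B).tW f g (n + 1) d ≤ LinearMap.ker F from h hz
  refine (Coder A B).tW_succ_le fun h i j _ r _ t ht => ?_
  rw [LinearMap.mem_ker, hF]
  obtain rfl | hn := n.eq_zero_or_pos
  · obtain rfl | ⟨e, c, rfl, rfl⟩ := (Coder A B).conil.weight_zero_cases ht
    · rw [map_zero, map_zero, map_zero, map_zero, map_zero]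
      exact sub_self 0
    · cases e
      have h1 := pr₁_theta_cons_one f g r X Y a
      have h2 := (Coder A B).pr₁_cons_one f g r
      rw [map_smul, map_smul, map_smul, map_smul, map_smul]
      refine sub_eq_zero.mpr (congrArg (c • ·) (h1.trans ?_))
      exact congrArg (fun r => coderLin f g r X Y a) h2.symm
  · have ht0 := (Coder A B).conil.counit_pos _ _ _ _ _ hn ht
    rw [pr₁_theta_cons _ _ _ _ ht0, (Coder A B).pr₁_cons_of_counit _ _ _ _ ht0, map_zero]
    exact sub_zero _

/-- A map of quivers which is an isomorphism on all graded modules of morphisms. -/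
structure QMap.IsFull (ι : QMap Q B) : Prop where
  bijective : ∀ x y, Function.Bijective (ι.map x y)
  deg_iff : ∀ x y d (r : Q.Hom x y), ι.map x y r ∈ (B.Hom (ι.obj x) (ι.obj y)).deg d ↔
    r ∈ (Q.Hom x y).deg d

theorem QMap.IsFull.hasDegree {ι : QMap Q B} (hι : ι.IsFull) : ι.map.HasDegree 0 :=
  fun X Y n x hx => by rw [add_zero]; exact (hι.deg_iff X Y n x).mpr hx

/-- The action restricted to a quiver `Q` over `Coder(A, B)`. It is used for `Q = Coder(A, B)` and
for `Q = s A∞(A, B)`. -/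
def subAction (ι : QMap Q (Coder A B)) : QMap (A.T.tensor Q.T).toGQuiver B.T.toGQuiver :=
  ((QMap.id A.T.toGQuiver).tensor ι.T).comp (action A B)

/-- The objects of `T A ⊗ C` act on objects through a map from `C` to the homomorphisms. -/
abbrev actOb {C : Type u} (o : C → CocatHom A.T B.T) (X : A.Ob × C) : B.Ob := (o X.2).obj X.1

/-- The maps of `subAction`. -/
def subActionFam (ι : QMap Q (Coder A B)) : Fam (A.T.tensor Q.T).toGQuiver B.T.toGQuiver
    (actOb (A := A) (B := B) ι.obj) (actOb (A := A) (B := B) ι.obj) := (subAction ι).map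

theorem subActionFam_tmul (ι : QMap Q (Coder A B)) (X Y : A.Ob × Q.Ob) (a : A.T.Hom X.1 Y.1)
    (z : Q.T.Hom X.2 Y.2) : subActionFam ι X Y (a ⊗ₜ z) =
      thetaEval (ι.obj X.2) (ι.obj Y.2) a (ι.tFam X.2 Y.2 z) := rfl

/-- The restricted action as a homomorphism. -/
def subActionHom {ι : QMap Q (Coder A B)} (hι : ι.IsFull) : CocatHom (A.T.tensor Q.T) B.T :=
  ((CocatHom.id A.T).tensor (ι.tHom hι.hasDegree)).comp (actionHom A B)

theorem subActionFam_one (ι : QMap Q (Coder A B)) (x : Q.Ob) (X Y : A.Ob) (a : A.T.Hom X Y) :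
    subActionFam ι (X, x) (Y, x) (a ⊗ₜ Q.tOne x) = (ι.obj x).map X Y a := by
  rw [subActionFam_tmul]
  exact (congrArg _ (ι.tFam_one x)).trans (thetaEval_one (ι.obj x) a)

theorem pr₁_subActionFam {ι : QMap Q (Coder A B)} (hι : ι.IsFull) (X Y : A.Ob) (x y : Q.Ob)
    (a : A.T.Hom X Y) {z : Q.tHom x y} (hz : Q.T.counit x y z = 0) :
    B.pr₁ _ _ (subActionFam ι (X, x) (Y, y) (a ⊗ₜ z)) =
      coderLin (ι.obj x) (ι.obj y) (ι.map x y (Q.pr₁ x y z)) X Y a := by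
  have h := (ι.tHom hι.hasDegree).map_counit x y z
  rw [subActionFam_tmul]
  refine (pr₁_thetaEval (ι.obj x) (ι.obj y) a (h.trans hz)).trans ?_
  exact congrArg (fun r => coderLin (ι.obj x) (ι.obj y) r X Y a)
    (QMap.pr₁_tFam hι.hasDegree x y z)

/-- The morphisms of `Q` are determined by the linear parts of the corresponding coderivations. -/
theorem eq_of_coderLin {ι : QMap Q (Coder A B)} (hι : ι.IsFull) {x y : Q.Ob} {r s : Q.Hom x y}
    (h : ∀ X Y a, coderLin (ι.obj x) (ι.obj y) (ι.map x y r) X Y a =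
      coderLin (ι.obj x) (ι.obj y) (ι.map x y s) X Y a) : r = s := by
  refine (hι.bijective x y).1 (coderLin_injective _ _ ?_)
  funext X Y
  exact LinearMap.ext fun a => h X Y a

/-- A linear map of degree `e` from a graded module `M` to families of maps `T A → B` lifts to a
linear map of degree `e` from `M` to `Q(x, y)`. -/
theorem exists_subLift {ι : QMap Q (Coder A B)} (hι : ι.IsFull) (x y : Q.Ob) (M : GMod.{u, u} k)
    (e : ℤ) (E : M →ₗ[k] Fam A.T.toGQuiver B (ι.obj x).obj (ι.obj y).obj)
    (hE : ∀ d, ∀ c ∈ M.deg d, (E c).HasDegree (d + e)) :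
    ∃ E' : M →ₗ[k] Q.Hom x y, (∀ d, ∀ c ∈ M.deg d, E' c ∈ (Q.Hom x y).deg (d + e)) ∧
      ∀ c, coderLin (ι.obj x) (ι.obj y) (ι.map x y (E' c)) = E c := by
  obtain ⟨E', h1, h2⟩ := exists_coderLift (ι.obj x) (ι.obj y) M e E hE
  let L : Q.Hom x y ≃ₗ[k] (Coder A B).Hom (ι.obj x) (ι.obj y) :=
    LinearEquiv.ofBijective (ι.map x y) (hι.bijective x y)
  have hL : ∀ c, ι.map x y (L.symm (E' c)) = E' c := fun c => L.apply_symm_apply (E' c)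
  refine ⟨L.symm.toLinearMap ∘ₗ E', fun d c hc => ?_, fun c => ?_⟩
  · refine (hι.deg_iff x y (d + e) _).mp ?_
    have := h1 d c hc
    rw [← hL] at this
    exact this
  · rw [← h2]
    exact congrArg _ (hL c)

variable {C : Cocat k}

/-- `c ↦ c - ε(c) 1`. -/
def Cocat.reduced (C : Cocat k) (x y : C.Ob) : C.Hom x y →ₗ[k] C.Hom x y :=
  LinearMap.id - C.unitFam C (fun x => x) x y

theorem Cocat.reduced_of_counit {x y : C.Ob} {c : C.Hom x y} (hc : C.counit x y c = 0) :
    C.reduced x y c = c := by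
  rw [reduced, LinearMap.sub_apply, unitFam_of_counit _ _ _ hc, LinearMap.id_apply, sub_zero]

theorem Cocat.Conil.reduced_one (hC : C.Conil) (x : C.Ob) : C.reduced x x (C.one x) = 0 := by
  rw [reduced, LinearMap.sub_apply, hC.unitFam_one, LinearMap.id_apply, sub_self]

theorem Cocat.Conil.reduced_mem (hC : C.Conil) {x y : C.Ob} {d : ℤ} {c : C.Hom x y}
    (hc : c ∈ (C.Hom x y).deg d) : C.reduced x y c ∈ (C.Hom x y).deg d := by
  refine sub_mem hc ?_
  by_cases hd : d = 0
  · subst hd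
    by_cases e : x = y
    · subst e
      rw [unitFam_self]
      exact Submodule.smul_mem _ _ (hC.one_mem_deg x)
    · rw [unitFam, dif_neg e]
      exact zero_mem _
  · rw [unitFam_of_counit _ _ _ (hC.counit_of_deg hd hc)]
    exact zero_mem _

/-- Linear maps out of `C(x, y)` agree if they agree on the `1_x` and on the kernel of the
counit. -/
theorem Cocat.Conil.hom_ext_counit (hC : C.Conil) {x y : C.Ob} {N : Type*} [AddCommGroup N]
    [Module k N] {s t : C.Hom x y →ₗ[k] N} (h1 : ∀ e : x = y, s (e ▸ C.one x) = t (e ▸ C.one x))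
    (h0 : ∀ c, C.counit x y c = 0 → s c = t c) : s = t :=
  hC.hom_ext fun n d c hc => by
    obtain rfl | hn := n.eq_zero_or_pos
    · exact hC.eq_of_weight_zero s t h1 hc
    · exact h0 c (hC.counit_pos _ _ _ _ c hn hc)

end Curry

section Universal

variable {k : Type u} [CommRing k] {A B Q : GQuiver k} {C : Cocat k}

-- The map of objects of a homomorphism is often only known up to an equation. The following lemmas
-- eliminate such an equation once and for all.

theorem CocatHom.eq_rec_of_toQMap (hC : C.Conil) {f : C.Ob → B.Ob}
    {F : Fam C.toGQuiver B.T.toGQuiver f f} {φ : CocatHom C B.T} (h : φ.toQMap = ⟨f, F⟩) :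
    F = C.unitFam B.T f + consConv F.lin F := by
  obtain ⟨⟨f', F'⟩, h1, h2, h3, h4⟩ := φ
  cases h
  exact CocatHom.map_eq_rec hC ⟨⟨f, F⟩, h1, h2, h3, h4⟩

theorem CocatHom.lin_one_of_toQMap {f : C.Ob → B.Ob}
    {F : Fam C.toGQuiver B.T.toGQuiver f f} {φ : CocatHom C B.T} (h : φ.toQMap = ⟨f, F⟩)
    (X : C.Ob) : F.lin X X (C.one X) = 0 := by
  obtain ⟨⟨f', F'⟩, h1, h2, h3, h4⟩ := φ
  cases h
  exact CocatHom.lin_one ⟨⟨f, F⟩, h1, h2, h3, h4⟩ X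

theorem CocatHom.counit_of_toQMap {D : Cocat k} {f : C.Ob → D.Ob}
    {F : Fam C.toGQuiver D.toGQuiver f f} {φ : CocatHom C D} (h : φ.toQMap = ⟨f, F⟩)
    (X Y : C.Ob) (x : C.Hom X Y) : D.counit _ _ (F X Y x) = C.counit X Y x := by
  obtain ⟨⟨f', F'⟩, h1, h2, h3, h4⟩ := φ
  cases h
  exact h3 X Y x

theorem CocatHom.one_of_toQMap {D : Cocat k} {f : C.Ob → D.Ob}
    {F : Fam C.toGQuiver D.toGQuiver f f} {φ : CocatHom C D} (h : φ.toQMap = ⟨f, F⟩)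
    (X : C.Ob) : F X X (C.one X) = D.one (f X) := by
  obtain ⟨⟨f', F'⟩, h1, h2, h3, h4⟩ := φ
  cases h
  exact h4 X

theorem CocatHom.hasDegree_of_toQMap {D : Cocat k} {f : C.Ob → D.Ob}
    {F : Fam C.toGQuiver D.toGQuiver f f} {φ : CocatHom C D} (h : φ.toQMap = ⟨f, F⟩) :
    F.HasDegree 0 := by
  obtain ⟨⟨f', F'⟩, h1, h2, h3, h4⟩ := φ
  cases h
  exact h1

/-- The maps `a ⊗ c ↦ (a ⊗ (c) G)α`. -/
def curryFam (ι : QMap Q (Coder A B)) {o o' : C.Ob → Q.Ob}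
    (G : Fam C.toGQuiver Q.T.toGQuiver o o') :
    Fam (A.T.tensor C).toGQuiver B.T.toGQuiver
      (actOb (A := A) (B := B) fun x : C.Ob => ι.obj (o x))
      (actOb (A := A) (B := B) fun x : C.Ob => ι.obj (o' x)) :=
  fun X Y => subActionFam ι (X.1, o X.2) (Y.1, o' Y.2) ∘ₗ LinearMap.lTensor _ (G X.2 Y.2)

theorem curryFam_tmul (ι : QMap Q (Coder A B)) {o o' : C.Ob → Q.Ob}
    (G : Fam C.toGQuiver Q.T.toGQuiver o o') (X Y : A.Ob) (x y : C.Ob) (a : A.T.Hom X Y)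
    (c : C.Hom x y) : curryFam ι G (X, x) (Y, y) (a ⊗ₜ c) =
      subActionFam ι (X, o x) (Y, o' y) (a ⊗ₜ G x y c) := rfl

theorem curry_toQMap (ι : QMap Q (Coder A B)) (o : C.Ob → Q.Ob)
    (G : Fam C.toGQuiver Q.T.toGQuiver o o) :
    ((QMap.id A.T.toGQuiver).tensor (⟨o, G⟩ : QMap C.toGQuiver Q.T.toGQuiver)).comp (subAction ι) =
      ⟨actOb (A := A) (B := B) fun x : C.Ob => ι.obj (o x), curryFam ι G⟩ := rfl

theorem exists_curryHom {ι : QMap Q (Coder A B)} (hι : ι.IsFull) {o : C.Ob → Q.Ob}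
    {G : Fam C.toGQuiver Q.T.toGQuiver o o} {ψ : CocatHom C Q.T} (hψ : ψ.toQMap = ⟨o, G⟩) :
    ∃ φ : CocatHom (A.T.tensor C) B.T, φ.toQMap =
      ⟨actOb (A := A) (B := B) fun x : C.Ob => ι.obj (o x), curryFam ι G⟩ := by
  refine ⟨((CocatHom.id A.T).tensor ψ).comp (subActionHom hι), ?_⟩
  change ((QMap.id A.T.toGQuiver).tensor ψ.toQMap).comp (subAction ι) = _
  rw [hψ, curry_toQMap]

/-- The maps `a ↦ (a ⊗ c) F pr₁`. -/
def partialLin {p p' : A.Ob × C.Ob → B.Ob} (F : Fam (A.T.tensor C).toGQuiver B.T.toGQuiver p p')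
    (x y : C.Ob) : C.Hom x y →ₗ[k]
      Fam A.T.toGQuiver B (fun X => p (X, x)) (fun X => p' (X, y)) where
  toFun c X Y := (B.pr₁ _ _ ∘ₗ F (X, x) (Y, y)) ∘ₗ (TensorProduct.mk k _ _).flip c
  map_add' c c' := by
    funext X Y
    rw [map_add, LinearMap.comp_add]
    rfl
  map_smul' r c := by
    funext X Y
    rw [map_smul, LinearMap.comp_smul]
    rfl

theorem partialLin_hasDegree {p p' : A.Ob × C.Ob → B.Ob}
    {F : Fam (A.T.tensor C).toGQuiver B.T.toGQuiver p p'} {e : ℤ} (hF : F.HasDegree e) (x y : C.Ob)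
    (d : ℤ) (c : C.Hom x y) (hc : c ∈ (C.Hom x y).deg d) :
    (partialLin F x y c).HasDegree (d + e) := by
  intro X Y n a ha
  have := B.pr₁_mem (hF (X, x) (Y, y) _ _ (GMod.tmul_mem _ _ ha hc))
  rw [add_assoc] at this
  exact this

/-- Existence in the universal property: a homomorphism `F` which restricts to the given
homomorphisms `T A → T B` on the `1_x` factors through the action. The linear part of the factor
`ψ` at `c` is the coderivation with linear part `a ↦ (a ⊗ c) F pr₁`. -/
theorem exists_curry (hC : C.Conil) {ι : QMap Q (Coder A B)} (hι : ι.IsFull) (o : C.Ob → Q.Ob)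
    {F : Fam (A.T.tensor C).toGQuiver B.T.toGQuiver
      (actOb (A := A) (B := B) fun x : C.Ob => ι.obj (o x))
      (actOb (A := A) (B := B) fun x : C.Ob => ι.obj (o x))}
    {φ : CocatHom (A.T.tensor C) B.T}
    (hφ : φ.toQMap = ⟨actOb (A := A) (B := B) fun x : C.Ob => ι.obj (o x), F⟩)
    (h1 : ∀ x X Y (a : A.T.Hom X Y), F (X, x) (Y, x) (a ⊗ₜ C.one x) = (ι.obj (o x)).map X Y a) :
    ∃ (G : Fam C.toGQuiver Q.T.toGQuiver o o) (ψ : CocatHom C Q.T), ψ.toQMap = ⟨o, G⟩ ∧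
      F = curryFam ι G := by
  have hE := fun x y : C.Ob => exists_subLift hι (o x) (o y) (C.Hom x y) 0 (partialLin F x y)
    (partialLin_hasDegree (CocatHom.hasDegree_of_toQMap hφ) x y)
  choose E hE1 hE2 using hE
  let b : Fam C.toGQuiver Q o o := fun x y => E x y ∘ₗ C.reduced x y
  have hb : b.HasDegree 0 := fun x y n c hc => hE1 x y n _ (hC.reduced_mem hc)
  have hb1 : ∀ x, b x x (C.one x) = 0 := fun x => by
    change E x x (C.reduced x x (C.one x)) = 0
    rw [hC.reduced_one, map_zero]
  obtain ⟨G, ψ, hψ, hG⟩ := exists_cohom hC o b hb hb1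
  refine ⟨G, ψ, hψ, ?_⟩
  obtain ⟨χ, hχ⟩ := exists_curryHom hι hψ
  have hT := A.conil.tensor hC
  refine CocatHom.eq_of_lin hT (CocatHom.eq_rec_of_toQMap hT hφ)
    (CocatHom.eq_rec_of_toQMap hT hχ) ?_ (CocatHom.lin_one_of_toQMap hφ)
  funext X Y
  obtain ⟨X, x⟩ := X
  obtain ⟨Y, y⟩ := Y
  refine TensorProduct.ext' fun a c => ?_
  change B.pr₁ _ _ (F (X, x) (Y, y) (a ⊗ₜ c)) = B.pr₁ _ _ (curryFam ι G (X, x) (Y, y) (a ⊗ₜ c))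
  suffices h : (B.pr₁ _ _ ∘ₗ F (X, x) (Y, y)) ∘ₗ TensorProduct.mk k _ _ a =
      (B.pr₁ _ _ ∘ₗ curryFam ι G (X, x) (Y, y)) ∘ₗ TensorProduct.mk k _ _ a from
    LinearMap.congr_fun h c
  refine hC.hom_ext_counit (fun e => ?_) fun c hc => ?_
  · cases e
    change B.pr₁ _ _ (F (X, x) (Y, x) (a ⊗ₜ C.one x)) =
      B.pr₁ _ _ (curryFam ι G (X, x) (Y, x) (a ⊗ₜ C.one x))
    rw [h1, curryFam_tmul, CocatHom.one_of_toQMap hψ]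
    exact congrArg _ (subActionFam_one ι (o x) X Y a).symm
  · change B.pr₁ _ _ (F (X, x) (Y, y) (a ⊗ₜ c)) =
      B.pr₁ _ _ (curryFam ι G (X, x) (Y, y) (a ⊗ₜ c))
    rw [curryFam_tmul]
    have h2 := pr₁_subActionFam hι X Y (o x) (o y) a
      ((CocatHom.counit_of_toQMap hψ x y c).trans hc)
    refine Eq.trans ?_ h2.symm
    have h3 : Q.pr₁ _ _ (G x y c) = E x y c := by
      have := LinearMap.congr_fun (congrFun (congrFun hG x) y) c
      refine this.trans ?_
      change E x y (C.reduced x y c) = E x y c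
      rw [Cocat.reduced_of_counit hc]
    rw [h3, hE2]
    rfl

/-- A family of maps to `T Q` without component in `T⁰ Q` has linear part determined by its action
on `T A`. -/
theorem lin_eq_of_curryFam {ι : QMap Q (Coder A B)} (hι : ι.IsFull) {o o' : C.Ob → Q.Ob}
    {G G' : Fam C.toGQuiver Q.T.toGQuiver o o'} (h : curryFam ι G = curryFam ι G') {x y : C.Ob}
    {c : C.Hom x y} (hc : Q.T.counit _ _ (G x y c) = 0) (hc' : Q.T.counit _ _ (G' x y c) = 0) :
    G.lin x y c = G'.lin x y c := by
  refine eq_of_coderLin hι fun X Y a => ?_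
  have h1 := pr₁_subActionFam hι X Y (o x) (o' y) a hc
  have h2 := pr₁_subActionFam hι X Y (o x) (o' y) a hc'
  rw [← curryFam_tmul] at h1 h2
  rw [h] at h1
  exact h1.symm.trans h2

/-- Coderivations are determined by their action on `T A`. -/
theorem IsCoderivation.eq_of_curryFam (hC : C.Conil) {ι : QMap Q (Coder A B)} (hι : ι.IsFull)
    {f g : CocatHom C Q.T} {d : ℤ} {r s : Fam C.toGQuiver Q.T.toGQuiver f.obj g.obj}
    (hr : IsCoderivation f.toQMap g.toQMap d r) (hs : IsCoderivation f.toQMap g.toQMap d s)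
    (h : curryFam ι r = curryFam ι s) : r = s := by
  refine hr.eq_of_lin hC hs ?_
  funext x y
  exact LinearMap.ext fun c => lin_eq_of_curryFam hι h (hr.counit hC Q.conil x y c)
    (hs.counit hC Q.conil x y c)

/-- Homomorphisms with the same map of objects are determined by their action on `T A`. -/
theorem eq_of_curryFam (hC : C.Conil) {ι : QMap Q (Coder A B)} (hι : ι.IsFull) {o : C.Ob → Q.Ob}
    {G G' : Fam C.toGQuiver Q.T.toGQuiver o o} {ψ ψ' : CocatHom C Q.T} (hψ : ψ.toQMap = ⟨o, G⟩)
    (hψ' : ψ'.toQMap = ⟨o, G'⟩) (h : curryFam ι G = curryFam ι G') : G = G' := by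
  refine CocatHom.eq_of_lin hC (CocatHom.eq_rec_of_toQMap hC hψ) (CocatHom.eq_rec_of_toQMap hC hψ')
    ?_ (CocatHom.lin_one_of_toQMap hψ)
  funext x y
  refine hC.hom_ext_counit (fun e => ?_) fun c hc => ?_
  · subst e
    exact (CocatHom.lin_one_of_toQMap hψ x).trans (CocatHom.lin_one_of_toQMap hψ' x).symm
  · exact lin_eq_of_curryFam hι h ((CocatHom.counit_of_toQMap hψ x y c).trans hc)
      ((CocatHom.counit_of_toQMap hψ' x y c).trans hc)

/-- The restriction of a map on `T A ⊗ C` to the `a ⊗ 1_x`. -/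
def restrictOne (q : QMap (A.T.tensor C).toGQuiver B.T.toGQuiver) (x : C.Ob) :
    QMap A.T.toGQuiver B.T.toGQuiver :=
  ⟨fun X => q.obj (X, x), fun X Y => q.map (X, x) (Y, x) ∘ₗ
    (TensorProduct.mk k _ _).flip (C.one x)⟩

theorem restrictOne_curry (ι : QMap Q (Coder A B)) (ψ : CocatHom C Q.T) (x : C.Ob) :
    restrictOne (((QMap.id A.T.toGQuiver).tensor ψ.toQMap).comp (subAction ι)) x =
      (ι.obj (ψ.obj x)).toQMap := by
  refine congrArg (QMap.mk _) ?_
  funext X Y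
  refine LinearMap.ext fun a => ?_
  change subActionFam ι (X, ψ.obj x) (Y, ψ.obj x) (a ⊗ₜ ψ.map x x (C.one x)) = _
  rw [ψ.map_one]
  exact subActionFam_one ι (ψ.obj x) X Y a

/-- Uniqueness in the universal property. -/
theorem curry_unique (hC : C.Conil) {ι : QMap Q (Coder A B)} (hι : ι.IsFull)
    (hinj : Function.Injective ι.obj) {ψ ψ' : CocatHom C Q.T}
    (h : ((QMap.id A.T.toGQuiver).tensor ψ.toQMap).comp (subAction ι) =
      ((QMap.id A.T.toGQuiver).tensor ψ'.toQMap).comp (subAction ι)) : ψ = ψ' := by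
  have ho : ψ.obj = ψ'.obj := by
    funext x
    refine hinj (CocatHom.toQMap_injective ?_)
    rw [← restrictOne_curry ι ψ x, ← restrictOne_curry ι ψ' x, h]
  apply CocatHom.toQMap_injective
  obtain ⟨o, G, hG⟩ : ∃ o G, ψ.toQMap = ⟨o, G⟩ := ⟨ψ.obj, ψ.map, rfl⟩
  obtain ⟨o', G', hG'⟩ : ∃ o G, ψ'.toQMap = ⟨o, G⟩ := ⟨ψ'.obj, ψ'.map, rfl⟩
  rw [hG, hG'] at ho h ⊢
  cases ho
  have h3 := (curry_toQMap ι o G).symm.trans (h.trans (curry_toQMap ι o G'))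
  injection h3 with _ h2
  rw [eq_of_curryFam hC hι hG hG' h2]

end Universal

section Graded

variable {k : Type u} [CommRing k]

theorem QMap.isFull_id (A : GQuiver k) : (QMap.id A).IsFull :=
  ⟨fun _ _ => Function.bijective_id, fun _ _ _ _ => Iff.rfl⟩

/-- For the identity, `subAction` is the action itself. -/
theorem subAction_id (A B : GQuiver k) : subAction (QMap.id (Coder A B)) = action A B := by
  rw [subAction, QMap.T_id]
  refine congrArg (QMap.mk _) ?_
  funext X Y
  exact TensorProduct.ext' fun a z => rfl

/-- The restriction of a homomorphism `T A ⊗ C → T B` to the `a ⊗ 1_x`. -/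
def CocatHom.restrict {A B : GQuiver k} {C : Cocat k} (hC : C.Conil)
    (φ : CocatHom (A.T.tensor C) B.T) (x : C.Ob) : CocatHom A.T B.T where
  toQMap := restrictOne φ.toQMap x
  hasDegree X Y n a ha := by
    have := φ.hasDegree (X, x) (Y, x) _ _ (GMod.tmul_mem _ _ ha (hC.one_mem_deg x))
    rw [add_zero] at this
    exact this
  map_comul X Y a := by
    refine (φ.map_comul (X, x) (Y, x) (a ⊗ₜ C.one x)).trans ?_
    rw [tensor_comul_tmul, hC.comul_one]
    change _ = (restrictOne φ.toQMap x).map.tens (restrictOne φ.toQMap x).map X Y _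
    generalize A.T.comul X Y a = u
    induction u using A.T.mid_induction with
    | zero => rw [TensorProduct.zero_tmul, map_zero, map_zero, map_zero]; rfl
    | add u u' hu hu' => rw [TensorProduct.add_tmul, map_add, map_add, map_add, hu, hu']; rfl
    | mem Z _ a _ i a' ha' =>
      rw [midShuffle_hom A.tq C.toGQuiver (X, x) (Y, x) Z x a (C.one x) ha' (hC.one_mem_deg x),
        mul_zero, ksign_zero, one_smul]
      rw [Fam.tens_midIncl]
      exact (Fam.tens_midIncl (restrictOne φ.toQMap x).map (restrictOne φ.toQMap x).map X Z Y
        (a ⊗ₜ a')).symm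
  map_counit X Y a := by
    refine (φ.map_counit (X, x) (Y, x) (a ⊗ₜ C.one x)).trans ?_
    change A.T.counit X Y a * C.counit x x (C.one x) = _
    rw [hC.counit_one, mul_one]
  map_one X := φ.map_one (X, x)

/-- The universal property of the action. -/
theorem existsUnique_curry {A B : GQuiver k} {C : Cocat k} (hC : C.Conil)
    (φ : CocatHom (A.T.tensor C) B.T) : ∃! ψ : CocatHom C (Coder A B).T,
      φ.toQMap = ((QMap.id _).tensor ψ.toQMap).comp (action A B) := by
  have hι := QMap.isFull_id (Coder A B)
  obtain ⟨G, ψ, hψ, hG⟩ := exists_curry hC hι (fun x => φ.restrict hC x) (F := φ.map) (φ := φ) rfl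
    (fun x X Y a => rfl)
  have h1 : φ.toQMap = ((QMap.id _).tensor ψ.toQMap).comp (subAction (QMap.id (Coder A B))) := by
    rw [hψ]
    refine Eq.trans ?_ (curry_toQMap (QMap.id (Coder A B)) (fun x => φ.restrict hC x) G).symm
    rw [← hG]
    rfl
  rw [← subAction_id]
  exact ⟨ψ, h1, fun ψ' hψ' => curry_unique hC hι Function.injective_id (hψ'.symm.trans h1)⟩

/-- Iterated tensor products of conilpotent cocategories are conilpotent. -/
theorem nonempty_conil_tensorList {C : Cocat k} (hC : Nonempty C.Conil) (L : List (Cocat k))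
    (hL : ∀ D ∈ L, Nonempty D.Conil) : Nonempty (Cocat.tensorList C L).Conil := by
  induction L generalizing C with
  | nil => exact hC
  | cons D L ih =>
    obtain ⟨hC⟩ := hC
    obtain ⟨hD⟩ := ih (hL D List.mem_cons_self) fun E hE => hL E (List.mem_cons_of_mem _ hE)
    exact ⟨hC.tensor hD⟩

end Graded

section CoderivationCalculus

variable {k : Type u} [CommRing k]

/-! ### Coderivations, homomorphisms and tensor products -/

/-- The composition of a homomorphism and a coderivation. -/
theorem IsCoderivation.comp_left {C D E : Cocat k} (p : CocatHom C D)
    {f g : QMap D.toGQuiver E.toGQuiver} {d : ℤ} {r : Fam D.toGQuiver E.toGQuiver f.obj g.obj}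
    (hr : IsCoderivation f g d r) : IsCoderivation (C := C) (D := E) (p.toQMap.comp f)
      (p.toQMap.comp g) d (fun X Y => r _ _ ∘ₗ p.map X Y) := by
  constructor
  · intro X Y n x hx
    have := hr.1 _ _ _ _ (p.hasDegree X Y n x hx)
    rw [add_zero] at this
    exact this
  · intro X Y x
    refine (hr.2 _ _ (p.map X Y x)).trans ?_
    rw [p.map_comul]
    refine congrArg₂ (· + ·) (Fam.tens_comp p.map p.map f.map r X Y _) ?_
    refine (Fam.tens_comp p.map p.map r (g.map.twist d) X Y _).trans ?_
    have : (fun X Y => g.map.twist d _ _ ∘ₗ p.map X Y :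
        Fam C.toGQuiver E.toGQuiver (p.toQMap.comp g).obj (p.toQMap.comp g).obj) =
        (p.toQMap.comp g).map.twist d := by
      funext X Y
      refine LinearMap.ext fun x => ?_
      have h := GMod.sgn_comm (p.map X Y) (p.hasDegree X Y) d x
      rw [mul_zero, ksign_zero, one_smul] at h
      exact congrArg (g.map _ _) h
    exact congrArg (fun t => Fam.tens (C := C.toGQuiver) (D := E.toGQuiver)
      (f := (p.toQMap.comp f).obj) (g := (p.toQMap.comp g).obj) (h := (p.toQMap.comp g).obj)
      (fun X Y => r _ _ ∘ₗ p.map X Y) t X Y (C.comul X Y x)) this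

/-- The composition of a coderivation and a homomorphism. -/
theorem IsCoderivation.comp_right {C D E : Cocat k} {f g : QMap C.toGQuiver D.toGQuiver} {d : ℤ}
    {r : Fam C.toGQuiver D.toGQuiver f.obj g.obj} (hr : IsCoderivation f g d r)
    (p : CocatHom D E) : IsCoderivation (C := C) (D := E) (f.comp p.toQMap) (g.comp p.toQMap) d
      (fun X Y => p.map _ _ ∘ₗ r X Y) := by
  constructor
  · intro X Y n x hx
    have := p.hasDegree _ _ _ _ (hr.1 X Y n x hx)
    rw [add_zero] at this
    exact this
  · intro X Y x
    refine (p.map_comul _ _ (r X Y x)).trans ?_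
    rw [hr.2, map_add]
    exact congrArg₂ (· + ·) (Fam.tens_comp f.map r p.map p.map X Y _)
      (Fam.tens_comp r (g.map.twist d) p.map p.map X Y _)

theorem tensFam_twist {C D C' D' : GQuiver k} {f f' : C.Ob → C'.Ob} {g g' : D.Ob → D'.Ob}
    (r : Fam C C' f f') (s : Fam D D' g g') (n : ℤ) :
    (tensFam r s).twist n = tensFam (r.twist n) (s.twist n) := by
  funext X Y
  refine TensorProduct.ext' fun x y => ?_
  change tensFam r s X Y (((C.Hom X.1 Y.1).tensor (D.Hom X.2 Y.2)).sgn n (x ⊗ₜ y)) = _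
  rw [GMod.sgn_tmul]
  rfl

theorem Fam.twist_twist {C D : GQuiver k} {f g : C.Ob → D.Ob} (r : Fam C D f g) (m n : ℤ) :
    (r.twist m).twist n = r.twist (m + n) := by
  funext X Y
  refine LinearMap.ext fun x => ?_
  change r X Y ((C.Hom X Y).sgn m ((C.Hom X Y).sgn n x)) = r X Y ((C.Hom X Y).sgn (m + n) x)
  rw [GMod.sgn_sgn]

theorem tensFam_hasDegree {C D C' D' : GQuiver k} {f f' : C.Ob → C'.Ob} {g g' : D.Ob → D'.Ob}
    {r : Fam C C' f f'} {s : Fam D D' g g'} {i j : ℤ} (hr : r.HasDegree i) (hs : s.HasDegree j) :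
    (tensFam r s).HasDegree (i + j) := by
  refine tensor_hasDegree _ _ fun X Y p q x y hx hy => ?_
  have := GMod.tmul_mem _ _ (hr _ _ _ _ hx) (hs _ _ _ _ hy)
  rwa [show p + i + (q + j) = p + q + (i + j) by ring] at this

/-- The condition on a coderivation of a tensor product needs to be checked on pure tensors only. -/
theorem isCoderivation_of_tmul {C D E : Cocat k}
    {f g : QMap (C.tensor D).toGQuiver E.toGQuiver} {d : ℤ}
    {r : Fam (C.tensor D).toGQuiver E.toGQuiver f.obj g.obj} (hd : r.HasDegree d)
    (h : ∀ (X Y : C.Ob × D.Ob) (x : C.Hom X.1 Y.1) (y : D.Hom X.2 Y.2),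
      E.comul _ _ (r X Y (x ⊗ₜ y)) =
        f.map.tens r X Y ((C.tensor D).comul X Y (x ⊗ₜ y)) +
          r.tens (g.map.twist d) X Y ((C.tensor D).comul X Y (x ⊗ₜ y))) :
    IsCoderivation f g d r := by
  refine ⟨hd, fun X Y x => ?_⟩
  suffices e : E.comul _ _ ∘ₗ r X Y =
      (f.map.tens r X Y + r.tens (g.map.twist d) X Y) ∘ₗ (C.tensor D).comul X Y from
    LinearMap.congr_fun e x
  exact TensorProduct.ext' fun x y => h X Y x y

/-- The tensor product of a homomorphism and a coderivation. -/
theorem IsCoderivation.tensor_right {C D C' D' : Cocat k} (p : CocatHom C C')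
    {f g : QMap D.toGQuiver D'.toGQuiver} (hf : f.map.HasDegree 0) {d : ℤ}
    {r : Fam D.toGQuiver D'.toGQuiver f.obj g.obj} (hr : IsCoderivation f g d r) :
    IsCoderivation (C := C.tensor D) (D := C'.tensor D') (p.toQMap.tensor f) (p.toQMap.tensor g) d
      (tensFam p.map r) := by
  refine isCoderivation_of_tmul ?_ fun X Y x y => ?_
  · have := tensFam_hasDegree p.hasDegree hr.1
    rwa [zero_add] at this
  · have h1 := midShuffle_tens p.map p.map f.map r p.hasDegree hf X Y
      (C.comul X.1 Y.1 x) (D.comul X.2 Y.2 y)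
    have h2 := midShuffle_tens p.map p.map r (g.map.twist d) p.hasDegree hr.1 X Y
      (C.comul X.1 Y.1 x) (D.comul X.2 Y.2 y)
    rw [Fam.twist_even _ Even.zero, Fam.twist_even _ Even.zero, mul_zero, ksign_zero,
      one_smul] at h1
    rw [Fam.twist_even _ Even.zero, zero_mul, ksign_zero, one_smul, ← tensFam_twist] at h2
    have h0 : C'.comul _ _ (p.map X.1 Y.1 x) ⊗ₜ[k] D'.comul _ _ (r X.2 Y.2 y) =
        p.map.tens p.map X.1 Y.1 (C.comul X.1 Y.1 x) ⊗ₜ f.map.tens r X.2 Y.2 (D.comul X.2 Y.2 y) +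
          p.map.tens p.map X.1 Y.1 (C.comul X.1 Y.1 x) ⊗ₜ
            r.tens (g.map.twist d) X.2 Y.2 (D.comul X.2 Y.2 y) := by
      rw [p.map_comul, hr.2, TensorProduct.tmul_add]
    exact (congrArg (midShuffle C'.toGQuiver D'.toGQuiver (p.obj X.1, f.obj X.2)
      (p.obj Y.1, g.obj Y.2)) h0).trans ((map_add _ _ _).trans (congrArg₂ (· + ·) h1 h2))

/-- The tensor product of a coderivation and a homomorphism, with the sign of Koszul's rule. -/
theorem IsCoderivation.tensor_left {C D C' D' : Cocat k} (hD : D.Conil)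
    {f g : QMap C.toGQuiver C'.toGQuiver} (hg : g.map.HasDegree 0) {d : ℤ}
    {r : Fam C.toGQuiver C'.toGQuiver f.obj g.obj} (hr : IsCoderivation f g d r)
    (p : CocatHom D D') : IsCoderivation (C := C.tensor D) (D := C'.tensor D')
      (f.tensor p.toQMap) (g.tensor p.toQMap) d (tensFam r (p.map.twist d)) := by
  have hp := twist_hasDegree (C := D) p.hasDegree d
  refine isCoderivation_of_tmul ?_ fun X Y x y => ?_
  · have := tensFam_hasDegree hr.1 hp
    rwa [add_zero] at this
  · have h1 := midShuffle_tens f.map r (p.map.twist d) (p.map.twist d) hr.1 hp X Y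
      (C.comul X.1 Y.1 x) (D.comul X.2 Y.2 y)
    have h2 := midShuffle_tens r (g.map.twist d) (p.map.twist d) (p.map.twist d)
      (twist_hasDegree (C := C) hg d) hp X Y (C.comul X.1 Y.1 x) (D.comul X.2 Y.2 y)
    rw [Fam.twist_twist, Fam.twist_even _ ⟨d, rfl⟩, Fam.twist_even _ Even.zero, mul_zero,
      ksign_zero, one_smul] at h1
    rw [Fam.twist_even _ Even.zero, Fam.twist_even _ Even.zero, mul_zero, ksign_zero, one_smul,
      ← tensFam_twist] at h2
    have h0 : C'.comul _ _ (r X.1 Y.1 x) ⊗ₜ[k] D'.comul _ _ (p.map.twist d X.2 Y.2 y) =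
        f.map.tens r X.1 Y.1 (C.comul X.1 Y.1 x) ⊗ₜ
          (p.map.twist d).tens (p.map.twist d) X.2 Y.2 (D.comul X.2 Y.2 y) +
        r.tens (g.map.twist d) X.1 Y.1 (C.comul X.1 Y.1 x) ⊗ₜ
          (p.map.twist d).tens (p.map.twist d) X.2 Y.2 (D.comul X.2 Y.2 y) := by
      rw [comul_twist hD p, hr.2, TensorProduct.add_tmul]
    exact (congrArg (midShuffle C'.toGQuiver D'.toGQuiver (f.obj X.1, p.obj X.2)
      (g.obj Y.1, p.obj Y.2)) h0).trans ((map_add _ _ _).trans (congrArg₂ (· + ·) h1 h2))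

/-- The square of a coderivation of odd degree is a coderivation: the mixed terms cancel. -/
theorem IsCoderivation.sq {C : Cocat k} {d : ℤ} (hd : Odd d)
    {r : Fam C.toGQuiver C.toGQuiver (fun X => X) (fun X => X)}
    (hr : IsCoderivation (QMap.id C.toGQuiver) (QMap.id C.toGQuiver) d r) :
    IsCoderivation (QMap.id C.toGQuiver) (QMap.id C.toGQuiver) (d + d)
      (fun X Y => r X Y ∘ₗ r X Y) := by
  constructor
  · intro X Y n x hx
    have := hr.1 _ _ _ _ (hr.1 X Y n x hx)
    rwa [add_assoc] at this
  · intro X Y x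
    let I : Fam C.toGQuiver C.toGQuiver (fun X => X) (fun X => X) := fun _ _ => LinearMap.id
    let r2 : Fam C.toGQuiver C.toGQuiver (fun X => X) (fun X => X) := fun X Y => r X Y ∘ₗ r X Y
    have hr2 : ∀ X Y x, C.comul X Y (r X Y x) = I.tens r X Y (C.comul X Y x) +
      r.tens (I.twist d) X Y (C.comul X Y x) := hr.2
    change C.comul X Y (r X Y (r X Y x)) = I.tens r2 X Y (C.comul X Y x) +
      r2.tens (I.twist (d + d)) X Y (C.comul X Y x)
    rw [hr2, hr2, map_add, map_add, Fam.twist_even _ ⟨d, rfl⟩]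
    generalize C.comul X Y x = u
    induction u using C.mid_induction with
    | zero => simp only [map_zero, add_zero]
    | add u v hu hv =>
      simp only [map_add] at hu hv ⊢
      rw [show ∀ a b c d e f g h : C.Mid X Y, a + b + (c + d) + (e + f + (g + h)) =
        (a + c + (e + g)) + (b + d + (f + h)) by intros; abel, hu, hv]
      abel
    | mem Z i a ha j b hb =>
      have e1 : ∀ (a : C.Hom X Z) (b : C.Hom Z Y), I.tens r X Y (C.midIncl X Z Y (a ⊗ₜ b)) =
          C.midIncl X Z Y (a ⊗ₜ r Z Y b) := fun a b => Fam.tens_midIncl I r X Z Y (a ⊗ₜ b)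
      have e2 : ∀ (a : C.Hom X Z) (b : C.Hom Z Y) (j : ℤ), b ∈ (C.Hom Z Y).deg j →
          r.tens (I.twist d) X Y (C.midIncl X Z Y (a ⊗ₜ b)) =
            ksign k (d * j) • C.midIncl X Z Y (r X Z a ⊗ₜ b) := by
        intro a b j hb
        refine (Fam.tens_midIncl r (I.twist d) X Z Y (a ⊗ₜ b)).trans ?_
        rw [← map_smul, ← TensorProduct.tmul_smul, ← GMod.sgn_mem _ d hb]
        rfl
      have e3 : I.tens r2 X Y (C.midIncl X Z Y (a ⊗ₜ b)) =
          C.midIncl X Z Y (a ⊗ₜ r Z Y (r Z Y b)) := Fam.tens_midIncl I r2 X Z Y (a ⊗ₜ b)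
      have e4 : r2.tens I X Y (C.midIncl X Z Y (a ⊗ₜ b)) =
          C.midIncl X Z Y (r X Z (r X Z a) ⊗ₜ b) := Fam.tens_midIncl r2 I X Z Y (a ⊗ₜ b)
      have h1 : ksign k (d * j) * ksign k (d * j) = 1 := by
        rw [← ksign_add]
        exact ksign_even ⟨_, rfl⟩
      have h2 : ksign k (d * (j + d)) = -ksign k (d * j) := by
        have h3 : ksign k (d * d) = -1 := by
          rw [← ksign_one (k := k)]
          refine ksign_congr ?_
          exact (Int.odd_mul.mpr ⟨hd, hd⟩).sub_odd odd_one
        rw [mul_add, ksign_add, h3, mul_neg_one]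
      have e5 : r.tens (I.twist d) X Y (C.midIncl X Z Y (a ⊗ₜ r Z Y b)) =
          ksign k (d * (j + d)) • C.midIncl X Z Y (r X Z a ⊗ₜ r Z Y b) :=
        e2 a (r Z Y b) (j + d) (hr.1 _ _ _ _ hb)
      rw [e1, e1, e3, e4, e5, e2 a b j hb, (I.tens r X Y).map_smul, (r.tens _ X Y).map_smul, e1,
        e2 _ b j hb, smul_smul, h1, one_smul, h2, neg_smul]
      abel

/-- A coderivation whose linear part vanishes on the `1_X` does so itself. -/
theorem IsCoderivation.map_one_of_lin {C : Cocat k} {B : GQuiver k} (hC : C.Conil)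
    {f g : CocatHom C B.T} {d : ℤ} {r : Fam C.toGQuiver B.T.toGQuiver f.obj g.obj}
    (hr : IsCoderivation f.toQMap g.toQMap d r)
    (h : ∀ X, r.lin X X (C.one X) = 0) (X : C.Ob) : r X X (C.one X) = 0 := by
  have h1 : consConv f.map.lin r X X (C.one X) = 0 :=
    Cocat.Conil.consConv_one hC f.lin_one r X
  have h2 : consConv r.lin (g.map.twist d) X X (C.one X) = 0 := by
    rw [consConv, LinearMap.comp_apply, hC.comul_one, consMap_midIncl, h]
    exact LinearMap.congr_fun (map_zero (B.cons _ _ _)) _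
  have h3 : r X X (C.one X) = consConv f.map.lin r X X (C.one X) +
      consConv r.lin (g.map.twist d) X X (C.one X) :=
    LinearMap.congr_fun (congrFun (congrFun (hr.eq_rec hC) X) X) (C.one X)
  exact h3.trans ((congrArg₂ (· + ·) h1 h2).trans (add_zero 0))

theorem IsCoderivation.congr_map {C D : Cocat k} {o : C.Ob → D.Ob} {d : ℤ}
    {r F F' : Fam C.toGQuiver D.toGQuiver o o}
    (hr : IsCoderivation (C := C) (D := D) ⟨o, F⟩ ⟨o, F⟩ d r) (h : F = F') :
    IsCoderivation (C := C) (D := D) ⟨o, F'⟩ ⟨o, F'⟩ d r := by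
  cases h
  exact hr

/-- A coderivation over `1 ⊗ 1` is one over `1`; the two maps are equal, but not definitionally. -/
theorem isCoderivation_id_tensor {C D : Cocat k} {d : ℤ}
    {r : Fam (C.tensor D).toGQuiver (C.tensor D).toGQuiver (fun X => X) (fun X => X)}
    (hr : IsCoderivation (C := C.tensor D) (D := C.tensor D)
      ((QMap.id C.toGQuiver).tensor (QMap.id D.toGQuiver))
      ((QMap.id C.toGQuiver).tensor (QMap.id D.toGQuiver)) d r) :
    IsCoderivation (C := C.tensor D) (D := C.tensor D) (QMap.id (C.tensor D).toGQuiver)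
      (QMap.id (C.tensor D).toGQuiver) d r :=
  IsCoderivation.congr_map (C := C.tensor D) (D := C.tensor D) (o := fun X => X) (r := r)
    (F := fun _ _ => TensorProduct.map LinearMap.id LinearMap.id)
    (F' := fun _ _ => LinearMap.id) hr (funext fun _ => funext fun _ => TensorProduct.map_id)

end CoderivationCalculus

section Differential

variable {k : Type u} [CommRing k] {A B Q : GQuiver k}

/-! ### The differential on the quiver of coderivations -/

/-- The maps `a ⊗ z ↦ (a ⊗ z) α b_B - (-1) ^ deg z (a b_A ⊗ z) α`. -/
def commFam (ι : QMap Q (Coder A B))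
    (bA : Fam A.T.toGQuiver A.T.toGQuiver (fun X => X) (fun X => X))
    (bB : Fam B.T.toGQuiver B.T.toGQuiver (fun X => X) (fun X => X)) :
    Fam (A.T.tensor Q.T).toGQuiver B.T.toGQuiver
      (actOb (A := A) (B := B) ι.obj) (actOb (A := A) (B := B) ι.obj) :=
  (fun X Y => bB _ _ ∘ₗ subActionFam ι X Y) -
    fun X Y => subActionFam ι X Y ∘ₗ TensorProduct.map (bA X.1 Y.1) ((Q.T.Hom X.2 Y.2).sgn 1)

variable {bA : Fam A.T.toGQuiver A.T.toGQuiver (fun X => X) (fun X => X)}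
  {bB : Fam B.T.toGQuiver B.T.toGQuiver (fun X => X) (fun X => X)}

/-- Both terms of `commFam` are coderivations over the action. -/
theorem isCoderivation_commFam {ι : QMap Q (Coder A B)} (hι : ι.IsFull)
    (hA : IsCoderivation (QMap.id A.T.toGQuiver) (QMap.id A.T.toGQuiver) 1 bA)
    (hB : IsCoderivation (QMap.id B.T.toGQuiver) (QMap.id B.T.toGQuiver) 1 bB) :
    IsCoderivation (C := A.T.tensor Q.T) (D := B.T) (subActionHom hι).toQMap
      (subActionHom hι).toQMap 1 (commFam ι bA bB) := by
  have h1 := hB.comp_left (subActionHom hι)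
  have h2 := (isCoderivation_id_tensor (hA.tensor_left (Q.conil)
    (CocatHom.id A.T).hasDegree (CocatHom.id Q.T))).comp_right (subActionHom hι)
  exact (coderivations (C := A.T.tensor Q.T) (D := B.T) (subActionHom hι).toQMap
    (subActionHom hι).toQMap 1).sub_mem h1 h2

theorem isCoderivation_curryFam {ι : QMap Q (Coder A B)} (hι : ι.IsFull) {d : ℤ}
    {b : Fam Q.T.toGQuiver Q.T.toGQuiver (fun x => x) (fun x => x)}
    (hb : IsCoderivation (QMap.id Q.T.toGQuiver) (QMap.id Q.T.toGQuiver) d b) :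
    IsCoderivation (C := A.T.tensor Q.T) (D := B.T) (subActionHom hι).toQMap
      (subActionHom hι).toQMap d (curryFam (C := Q.T) ι b) :=
  (isCoderivation_id_tensor (hb.tensor_right (CocatHom.id A.T)
    (CocatHom.id Q.T).hasDegree)).comp_right (subActionHom hι)

/-- There is a coderivation `b` of `T Q` for which `(a ⊗ (z) b)α` is the commutator of `commFam`.
Its linear part lifts the linear part of `commFam`; both sides are coderivations over the action, so
it suffices to compare linear parts. -/
theorem exists_coderivation {ι : QMap Q (Coder A B)} (hι : ι.IsFull)
    (hA : IsCoderivation (QMap.id A.T.toGQuiver) (QMap.id A.T.toGQuiver) 1 bA)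
    (hB : IsCoderivation (QMap.id B.T.toGQuiver) (QMap.id B.T.toGQuiver) 1 bB) :
    ∃ b : Fam Q.T.toGQuiver Q.T.toGQuiver (fun x => x) (fun x => x),
      IsCoderivation (QMap.id Q.T.toGQuiver) (QMap.id Q.T.toGQuiver) 1 b ∧
        curryFam (C := Q.T) ι b = commFam ι bA bB := by
  have hc := isCoderivation_commFam hι hA hB
  have hE := fun x y : Q.Ob => exists_subLift hι x y (Q.T.Hom x y) 1
    (partialLin (C := Q.T) (commFam ι bA bB) x y) (partialLin_hasDegree hc.1 x y)
  choose E hE1 hE2 using hE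
  have hE' : Fam.HasDegree (C := Q.T.toGQuiver) (D := Q) (f := fun x => x) (g := fun x => x) E 1 :=
    fun x y n z hz => hE1 x y n z hz
  let b := coderOf (CocatHom.id Q.T) (CocatHom.id Q.T) 1 E
  have hb : IsCoderivation (QMap.id Q.T.toGQuiver) (QMap.id Q.T.toGQuiver) 1 b :=
    isCoderivation_coderOf (CocatHom.id Q.T) (CocatHom.id Q.T) hE'
  have hlin : ∀ x y z, Q.pr₁ x y (b x y z) = E x y z := fun x y z =>
    LinearMap.congr_fun (congrFun (congrFun
      (coderOf_lin (CocatHom.id Q.T) (CocatHom.id Q.T) hE') x) y) z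
  refine ⟨b, hb, ?_⟩
  refine (isCoderivation_curryFam hι hb).eq_of_lin (A.conil.tensor Q.conil) hc ?_
  funext X Y
  obtain ⟨X, x⟩ := X
  obtain ⟨Y, y⟩ := Y
  refine TensorProduct.ext' fun a z => ?_
  change B.pr₁ _ _ (subActionFam ι (X, x) (Y, y) (a ⊗ₜ b x y z)) =
    B.pr₁ _ _ (commFam ι bA bB (X, x) (Y, y) (a ⊗ₜ z))
  have h0 : Q.T.counit x y (b x y z) = 0 :=
    IsCoderivation.counit (f := CocatHom.id Q.T) (g := CocatHom.id Q.T) Q.conil Q.conil hb x y z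
  rw [pr₁_subActionFam hι X Y x y a h0, hlin, hE2]
  rfl

/-- The action on a value of the differential. -/
theorem subActionFam_differential {ι : QMap Q (Coder A B)}
    {b : Fam Q.T.toGQuiver Q.T.toGQuiver (fun x => x) (fun x => x)}
    (h : curryFam (C := Q.T) ι b = commFam ι bA bB) (X Y : A.Ob) (x y : Q.Ob) (a : A.T.Hom X Y)
    (z : Q.T.Hom x y) : subActionFam ι (X, x) (Y, y) (a ⊗ₜ b x y z) =
      bB _ _ (subActionFam ι (X, x) (Y, y) (a ⊗ₜ z)) -
        subActionFam ι (X, x) (Y, y) (bA X Y a ⊗ₜ (Q.T.Hom x y).sgn 1 z) := by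
  rw [← curryFam_tmul (C := Q.T) ι b X Y x y a z, h]
  rfl

/-- The differential vanishes on the `1_x`, because the homomorphisms `ι x` commute with the
differentials. -/
theorem differential_one {ι : QMap Q (Coder A B)} (hι : ι.IsFull)
    {b : Fam Q.T.toGQuiver Q.T.toGQuiver (fun x => x) (fun x => x)}
    (hb : IsCoderivation (QMap.id Q.T.toGQuiver) (QMap.id Q.T.toGQuiver) 1 b)
    (h : curryFam (C := Q.T) ι b = commFam ι bA bB)
    (hchain : ∀ x X Y a, bB _ _ ((ι.obj x).map X Y a) = (ι.obj x).map X Y (bA X Y a)) (x : Q.Ob) :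
    b x x (Q.tOne x) = 0 := by
  refine IsCoderivation.map_one_of_lin (f := CocatHom.id Q.T) (g := CocatHom.id Q.T) Q.conil hb
    (fun x => ?_) x
  refine eq_of_coderLin hι fun X Y a => ?_
  have h0 : Q.T.counit x x (b x x (Q.T.one x)) = 0 :=
    IsCoderivation.counit (f := CocatHom.id Q.T) (g := CocatHom.id Q.T) Q.conil Q.conil hb x x _
  have h1 := pr₁_subActionFam hι X Y x x a h0
  rw [subActionFam_differential h, sgn_one Q.conil] at h1
  have h2 : bB _ _ (subActionFam ι (X, x) (Y, x) (a ⊗ₜ Q.T.one x)) =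
      subActionFam ι (X, x) (Y, x) (bA X Y a ⊗ₜ Q.T.one x) := by
    refine (congrArg (bB _ _) (subActionFam_one ι x X Y a)).trans ((hchain x X Y a).trans ?_)
    exact (subActionFam_one ι x X Y (bA X Y a)).symm
  rw [h2, sub_self, map_zero] at h1
  rw [map_zero, map_zero]
  exact h1.symm

/-- The differential has square zero. Its square is a coderivation of degree `2`, and it acts by
zero: the action of `(z) b²` is the commutator with `b` applied twice. -/
theorem differential_sq {ι : QMap Q (Coder A B)} (hι : ι.IsFull)
    {b : Fam Q.T.toGQuiver Q.T.toGQuiver (fun x => x) (fun x => x)}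
    (hb : IsCoderivation (QMap.id Q.T.toGQuiver) (QMap.id Q.T.toGQuiver) 1 b)
    (h : curryFam (C := Q.T) ι b = commFam ι bA bB)
    (hA2 : ∀ X Y a, bA X Y (bA X Y a) = 0) (hB2 : ∀ X Y a, bB X Y (bB X Y a) = 0) (x y : Q.Ob)
    (z : Q.T.Hom x y) : b x y (b x y z) = 0 := by
  suffices e : (fun x y => b x y ∘ₗ b x y :
      Fam Q.T.toGQuiver Q.T.toGQuiver (fun x => x) (fun x => x)) = 0 from
    LinearMap.congr_fun (congrFun (congrFun e x) y) z
  refine IsCoderivation.eq_of_curryFam (C := Q.T) Q.conil hι (f := CocatHom.id Q.T)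
    (g := CocatHom.id Q.T) (hb.sq odd_one) (Submodule.zero_mem (coderivations _ _ _)) ?_
  funext X Y
  obtain ⟨X, x⟩ := X
  obtain ⟨Y, y⟩ := Y
  refine TensorProduct.ext' fun a z => ?_
  change subActionFam ι (X, x) (Y, y) (a ⊗ₜ b x y (b x y z)) =
    subActionFam ι (X, x) (Y, y) (a ⊗ₜ (0 : Q.T.Hom x y))
  have hs : (Q.T.Hom x y).sgn 1 (b x y z) = - b x y ((Q.T.Hom x y).sgn 1 z) := by
    have := GMod.sgn_comm (b x y) (hb.1 x y) 1 z
    rwa [mul_one, ksign_one, neg_one_smul] at this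
  rw [subActionFam_differential h, subActionFam_differential h, hs, TensorProduct.tmul_neg, map_neg,
    subActionFam_differential h, hA2, map_sub, hB2, TensorProduct.zero_tmul, map_zero,
    TensorProduct.tmul_zero, map_zero]
  abel

end Differential

/-! ### The `A∞`-category of `A∞`-functors -/

section Chain

variable {k : Type u} [CommRing k] {A B Q : GQuiver k}
  {bA : Fam A.T.toGQuiver A.T.toGQuiver (fun X => X) (fun X => X)}
  {bB : Fam B.T.toGQuiver B.T.toGQuiver (fun X => X) (fun X => X)}

/-- The action commutes with the differentials if and only if the differential on `T Q` acts by
the commutator. -/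
theorem curryFam_eq_commFam_iff {ι : QMap Q (Coder A B)}
    {b : Fam Q.T.toGQuiver Q.T.toGQuiver (fun x => x) (fun x => x)} :
    curryFam (C := Q.T) ι b = commFam ι bA bB ↔ ∀ X Y (t : (A.T.tensor Q.T).Hom X Y),
      bB _ _ (subActionFam ι X Y t) = subActionFam ι X Y
        ((LinearMap.lTensor (A.T.Hom X.1 Y.1) (b X.2 Y.2) +
          TensorProduct.map (bA X.1 Y.1) ((Q.T.Hom X.2 Y.2).sgn 1)) t) := by
  constructor
  · intro h X Y t
    rw [LinearMap.add_apply, map_add]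
    have h1 := LinearMap.congr_fun (congrFun (congrFun h X) Y) t
    exact sub_eq_iff_eq_add.mp h1.symm
  · intro h
    funext X Y
    refine LinearMap.ext fun t => ?_
    have h1 := h X Y t
    rw [LinearMap.add_apply, map_add] at h1
    exact (sub_eq_iff_eq_add.mpr h1).symm

/-- If the action of a homomorphism `ψ : C → T Q` commutes with the differentials, so does `ψ`: the
families `ψ b` and `d ψ` are coderivations over `ψ` with the same action. -/
theorem isChain_of_curryFam {C : Cocat k} (hC : C.Conil) {ι : QMap Q (Coder A B)} (hι : ι.IsFull)
    {b : Fam Q.T.toGQuiver Q.T.toGQuiver (fun x => x) (fun x => x)}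
    (hb : IsCoderivation (QMap.id Q.T.toGQuiver) (QMap.id Q.T.toGQuiver) 1 b)
    (h : curryFam (C := Q.T) ι b = commFam ι bA bB)
    {d : Fam C.toGQuiver C.toGQuiver (fun x => x) (fun x => x)}
    (hd : IsCoderivation (QMap.id C.toGQuiver) (QMap.id C.toGQuiver) 1 d) (ψ : CocatHom C Q.T)
    (hψ : ∀ X Y x y (a : A.T.Hom X Y) (c : C.Hom x y),
      bB _ _ (curryFam ι ψ.map (X, x) (Y, y) (a ⊗ₜ c)) =
        curryFam ι ψ.map (X, x) (Y, y) (a ⊗ₜ d x y c) +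
          curryFam ι ψ.map (X, x) (Y, y) (bA X Y a ⊗ₜ (C.Hom x y).sgn 1 c)) (x y : C.Ob)
    (c : C.Hom x y) : b _ _ (ψ.map x y c) = ψ.map x y (d x y c) := by
  suffices e : (fun x y => b _ _ ∘ₗ ψ.map x y : Fam C.toGQuiver Q.T.toGQuiver ψ.obj ψ.obj) =
      fun x y => ψ.map x y ∘ₗ d x y from LinearMap.congr_fun (congrFun (congrFun e x) y) c
  refine IsCoderivation.eq_of_curryFam hC hι (f := ψ) (g := ψ) (hb.comp_left ψ)
    (hd.comp_right ψ) ?_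
  funext X Y
  obtain ⟨X, x⟩ := X
  obtain ⟨Y, y⟩ := Y
  refine TensorProduct.ext' fun a c => ?_
  change subActionFam ι (X, ψ.obj x) (Y, ψ.obj y) (a ⊗ₜ b _ _ (ψ.map x y c)) =
    curryFam ι ψ.map (X, x) (Y, y) (a ⊗ₜ d x y c)
  have hs : (Q.T.Hom _ _).sgn 1 (ψ.map x y c) = ψ.map x y ((C.Hom x y).sgn 1 c) := by
    have := GMod.sgn_comm (ψ.map x y) (ψ.hasDegree x y) 1 c
    rwa [mul_zero, ksign_zero, one_smul] at this
  rw [subActionFam_differential h, hs]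
  exact sub_eq_iff_eq_add.mpr (hψ X Y x y a c)

/-- A differential graded cocategory of the kind considered for `A∞`-categories: it is
conilpotent, and its differential is a coderivation of degree `1` which vanishes on the `1_X`. -/
structure DGCocat.IsBar (C : DGCocat k) : Prop where
  conil : Nonempty C.toCocat.Conil
  coderivation : IsCoderivation (C := C.toCocat) (D := C.toCocat) (QMap.id C.toGQuiver)
    (QMap.id C.toGQuiver) 1 C.d
  map_one : ∀ X, C.d X X (C.one X) = 0

theorem AInfStructure.isBar {A : GQuiver k} (S : AInfStructure A) : S.bar.IsBar :=
  ⟨⟨(A.shift 1).conil⟩, S.coderivation, S.map_one⟩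

theorem DGCocat.IsBar.tensor {C D : DGCocat k} (hC : C.IsBar) (hD : D.IsBar) :
    (C.tensor D).IsBar := by
  obtain ⟨hC0⟩ := hC.conil
  obtain ⟨hD0⟩ := hD.conil
  refine ⟨⟨hC0.tensor hD0⟩, ?_, fun X => ?_⟩
  · have h1 := isCoderivation_id_tensor (hD.coderivation.tensor_right (CocatHom.id C.toCocat)
      (CocatHom.id D.toCocat).hasDegree)
    have h2 := isCoderivation_id_tensor (hC.coderivation.tensor_left hD0
      (CocatHom.id C.toCocat).hasDegree (CocatHom.id D.toCocat))
    exact (coderivations (C := C.toCocat.tensor D.toCocat) (D := C.toCocat.tensor D.toCocat)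
      (QMap.id (C.toCocat.tensor D.toCocat).toGQuiver)
      (QMap.id (C.toCocat.tensor D.toCocat).toGQuiver) 1).add_mem h1 h2
  · change C.one X.1 ⊗ₜ[k] D.d X.2 X.2 (D.one X.2) +
      C.d X.1 X.1 (C.one X.1) ⊗ₜ[k] (D.Hom X.2 X.2).sgn 1 (D.one X.2) = 0
    rw [hC.map_one, hD.map_one, TensorProduct.tmul_zero, TensorProduct.zero_tmul, add_zero]

theorem DGCocat.IsBar.tensorList {C : DGCocat k} (hC : C.IsBar) (L : List (DGCocat k))
    (hL : ∀ D ∈ L, D.IsBar) : (DGCocat.tensorList C L).IsBar := by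
  induction L generalizing C with
  | nil => exact hC
  | cons D L ih =>
    exact hC.tensor (ih (hL D List.mem_cons_self) fun E hE => hL E (List.mem_cons_of_mem _ hE))

end Chain

section Functors

variable {k : Type u} [CommRing k] (A B : AInfCat k)

theorem AInfFunctor.toCocatHom_injective {C D : DGCocat k} :
    Function.Injective (AInfFunctor.toCocatHom (C := C) (D := D)) := by
  rintro ⟨f, hf⟩ ⟨g, hg⟩ h
  cases h
  rfl

/-- The suspension and the shift by `-1` in the definition of `aInfQuiver` cancel. -/
theorem aInfIncl_isFull : (aInfIncl A B).IsFull := by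
  refine ⟨fun _ _ => Function.bijective_id, fun f g d r => ?_⟩
  change r ∈ ((Coder (A.quiver.shift 1) (B.quiver.shift 1)).Hom f.toCocatHom g.toCocatHom).deg d ↔
    r ∈ ((Coder (A.quiver.shift 1) (B.quiver.shift 1)).Hom f.toCocatHom g.toCocatHom).deg
      (d + 1 + -1)
  rw [add_neg_cancel_right]

/-- There is an `A∞`-structure on `A∞(A, B)` whose differential acts by the commutator. -/
theorem exists_aInfStructure : ∃ S : AInfStructure (aInfQuiver A B),
    curryFam (C := ((aInfQuiver A B).shift 1).T) (aInfIncl A B) S.b =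
      commFam (aInfIncl A B) A.str.b B.str.b := by
  have hι := aInfIncl_isFull A B
  obtain ⟨b, hb, h⟩ := exists_coderivation hι A.str.coderivation B.str.coderivation
  exact ⟨⟨b, hb, differential_sq hι hb h A.str.sq_zero B.str.sq_zero,
    differential_one hι hb h fun f X Y a => f.isChain X Y a⟩, h⟩

variable {A B}

/-- An `A∞`-structure makes the action an `A∞`-functor if and only if its differential acts by the
commutator. -/
theorem exists_aInfAction_iff (S : AInfStructure (aInfQuiver A B)) :
    (∃ a : AInfFunctor (A.bar.tensor S.bar) B.bar, a.toQMap = aInfAction A B) ↔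
      curryFam (C := ((aInfQuiver A B).shift 1).T) (aInfIncl A B) S.b =
        commFam (aInfIncl A B) A.str.b B.str.b := by
  rw [curryFam_eq_commFam_iff]
  constructor
  · rintro ⟨⟨⟨q, h1, h2, h3, h4⟩, hq⟩, h⟩
    cases h
    exact hq
  · intro h
    exact ⟨⟨subActionHom (aInfIncl_isFull A B), h⟩, rfl⟩

/-- The universal property of `T s A∞(A, B)`. -/
theorem existsUnique_curry_aInf {S : AInfStructure (aInfQuiver A B)}
    (hS : curryFam (C := ((aInfQuiver A B).shift 1).T) (aInfIncl A B) S.b =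
      commFam (aInfIncl A B) A.str.b B.str.b) {C : DGCocat k} (hC : C.IsBar)
    (φ : AInfFunctor (A.bar.tensor C) B.bar) : ∃! ψ : AInfFunctor C S.bar,
      φ.toQMap = ((QMap.id _).tensor ψ.toQMap).comp (aInfAction A B) := by
  have hι := aInfIncl_isFull A B
  obtain ⟨hC0⟩ := hC.conil
  -- `φ` commutes with the differentials, evaluated at `a ⊗ c`.
  have hφ : ∀ X Y x y (a : A.bar.Hom X Y) (c : C.Hom x y),
      B.str.b _ _ (φ.map (X, x) (Y, y) (a ⊗ₜ c)) = φ.map (X, x) (Y, y) (a ⊗ₜ C.d x y c) +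
        φ.map (X, x) (Y, y) (A.str.b X Y a ⊗ₜ (C.Hom x y).sgn 1 c) := by
    intro X Y x y a c
    refine (φ.isChain (X, x) (Y, y) (a ⊗ₜ c)).trans ?_
    exact map_add (φ.map (X, x) (Y, y)) _ _
  -- As `d` vanishes on the `1_x`, the restrictions of `φ` to the `a ⊗ 1_x` are `A∞`-functors.
  let o : C.Ob → AInfFunctor A.bar B.bar := fun x =>
    { toCocatHom := CocatHom.restrict hC0 φ.toCocatHom x
      isChain := fun X Y a => by
        refine (hφ X Y x x a (C.one x)).trans ?_
        rw [hC.map_one, sgn_one hC0, TensorProduct.tmul_zero, map_zero, zero_add]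
        rfl }
  obtain ⟨G, ψ, hψ, hG⟩ := exists_curry hC0 hι o (F := φ.map) (φ := φ.toCocatHom) rfl
    (fun x X Y a => rfl)
  have h1 : φ.toQMap = ((QMap.id _).tensor ψ.toQMap).comp (subAction (aInfIncl A B)) := by
    rw [hψ]
    refine Eq.trans ?_ (curry_toQMap (aInfIncl A B) o G).symm
    rw [← hG]
    rfl
  have h2 : ψ.toQMap.IsChain (C := C) (D := S.bar) := by
    obtain ⟨⟨o', G'⟩, hψ1, hψ2, hψ3, hψ4⟩ := ψ
    cases hψ
    refine isChain_of_curryFam hC0 hι S.coderivation hS hC.coderivation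
      ⟨⟨o, G⟩, hψ1, hψ2, hψ3, hψ4⟩ ?_
    change ∀ X Y x y (a : A.bar.Hom X Y) (c : C.Hom x y),
      B.str.b _ _ (curryFam (aInfIncl A B) G (X, x) (Y, y) (a ⊗ₜ c)) =
        curryFam (aInfIncl A B) G (X, x) (Y, y) (a ⊗ₜ C.d x y c) +
          curryFam (aInfIncl A B) G (X, x) (Y, y) (A.str.b X Y a ⊗ₜ (C.Hom x y).sgn 1 c)
    rw [← hG]
    exact hφ
  refine ⟨⟨ψ, h2⟩, h1, fun ψ' hψ' => AInfFunctor.toCocatHom_injective ?_⟩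
  exact curry_unique hC0 hι AInfFunctor.toCocatHom_injective (hψ'.symm.trans h1)

end Functors

end AInf
end

theorem mainTheorem3 (k : Type u) [CommRing k] :
    (∀ A B : AInf.GQuiver k,
      (∃ a : AInf.CocatHom (A.T.tensor (AInf.Coder A B).T) B.T, a.toQMap = AInf.action A B) ∧
      ∀ (C : AInf.GQuiver k) (L : List (AInf.GQuiver k))
        (φ : AInf.CocatHom (A.T.tensor (AInf.Cocat.tensorList C.T (L.map AInf.GQuiver.T))) B.T),
        ∃! ψ : AInf.CocatHom (AInf.Cocat.tensorList C.T (L.map AInf.GQuiver.T))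
            (AInf.Coder A B).T,
          φ.toQMap = ((AInf.QMap.id _).tensor ψ.toQMap).comp (AInf.action A B)) ∧
    (∀ A B : AInf.AInfCat k,
      ∃ S : AInf.AInfStructure (AInf.aInfQuiver A B),
        (∀ S' : AInf.AInfStructure (AInf.aInfQuiver A B),
          (∃ a : AInf.AInfFunctor (A.bar.tensor S'.bar) B.bar, a.toQMap = AInf.aInfAction A B) ↔
            S' = S) ∧
        ∀ (C : AInf.AInfCat k) (L : List (AInf.AInfCat k))
          (φ : AInf.AInfFunctor
            (A.bar.tensor (AInf.DGCocat.tensorList C.bar (L.map AInf.AInfCat.bar))) B.bar),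
          ∃! ψ : AInf.AInfFunctor (AInf.DGCocat.tensorList C.bar (L.map AInf.AInfCat.bar)) S.bar,
            φ.toQMap = ((AInf.QMap.id _).tensor ψ.toQMap).comp (AInf.aInfAction A B)) := by
  refine ⟨fun A B => ⟨⟨AInf.actionHom A B, rfl⟩, fun C L φ => ?_⟩, fun A B => ?_⟩
  · obtain ⟨hC⟩ := AInf.nonempty_conil_tensorList ⟨C.conil⟩ (L.map AInf.GQuiver.T) fun D hD => by
      obtain ⟨D', _, rfl⟩ := List.mem_map.mp hD
      exact ⟨D'.conil⟩
    exact AInf.existsUnique_curry hC φ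
  · obtain ⟨S, hS⟩ := AInf.exists_aInfStructure A B
    refine ⟨S, fun S' => ?_, fun C L φ => ?_⟩
    · rw [AInf.exists_aInfAction_iff]
      refine ⟨fun h => AInf.AInfStructure.ext ?_, fun h => h ▸ hS⟩
      -- The condition determines the action of the differential, hence the differential.
      exact AInf.IsCoderivation.eq_of_curryFam (AInf.GQuiver.conil _) (AInf.aInfIncl_isFull A B)
        (f := AInf.CocatHom.id _) (g := AInf.CocatHom.id _) S'.coderivation S.coderivation
        (h.trans hS.symm)
    · refine AInf.existsUnique_curry_aInf hS (C.str.isBar.tensorList _ fun D hD => ?_) φ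
      obtain ⟨D', _, rfl⟩ := List.mem_map.mp hD
      exact D'.str.isBar
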